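/- Let $\mathbb S_1=\{|z|=1\}$ and $\mathbb S_3=\{|z-\tfrac23|=\tfrac13\}$, two circles internally tangent at $z=1$, and let $\Sigma_+=\{|z-\tfrac23|<\tfrac13\}$, $\Sigma_c=\{|z-\tfrac23|>\tfrac13,\ |z|<1\}$, $\Sigma_-=\{|z|>1\}$. Consider the piecewise polynomial holomorphic system $$\dot z=-i(z-1)+\varepsilon h^{\sigma}(z),\quad z\in\Sigma_\sigma,\quad \sigma\in\{+,c,-\},\qquad h^\sigma(z)=\sum_{j=0}^{3}(a_j^\sigma+ib_j^\sigma)z^j,\quad a_j^\sigma,b_j^\sigma\in\mathbb R,$$ with Filippov's convention on the boundaries of the zones (solutions are the absolutely continuous curves whose derivative lies, at almost every time, in the convex hull of the limiting values of the field from the adjacent zones). A limit cycle is a periodic orbit having a neighbourhood that contains no other periodic orbit. For a property $P$ of closed curves we say that at least $n$ limit cycles bifurcate from the periodic orbits with property $P$ if there are $h^+,h^c,h^-$ as above, $n$ distinct periodic orbits $L_1,\dots,L_n$ of the center $\dot z=-i(z-1)$ with property $P$, and $\varepsilon_0>0$, such that for every real $\varepsilon$ with $0<|\varepsilon|<\varepsilon_0$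 the system has $n$ distinct limit cycles $\Gamma_1(\varepsilon),\dots,\Gamma_n(\varepsilon)$ with property $P$, and $\Gamma_i(\varepsilon)\to L_i$ in the Hausdorff distance as $\varepsilon\to0$ for each $i$. Then at least $4$ limit cycles bifurcate from the periodic orbits that cross $\mathbb S_1$ and do not meet $\mathbb S_3$; and, with a possibly different choice of $h^+,h^c,h^-$, at least $8$ limit cycles bifurcate from the periodic orbits that cross both $\mathbb S_1$ and $\mathbb S_3$. (A closed curve crosses a circle if it has points strictly inside and points strictly outside the circle.) -/

import Mathlib

open Set Filter Topology MeasureTheory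

namespace TangentCircles

/-- The labels `+`, `c`, `-` of the three zones. -/
inductive Zone
  | plus
  | central
  | minus

/-- The three open zones cut out by the internally tangent circles `|z| = 1` and
`|z - 2/3| = 1/3`. -/
def region : Zone → Set ℂ
  | .plus => {z | ‖z - 2 / 3‖ < 1 / 3}
  | .central => {z | 1 / 3 < ‖z - 2 / 3‖ ∧ ‖z‖ < 1}
  | .minus => {z | 1 < ‖z‖}

/-- The vector field of the zone `σ`: the center `-i(z - 1)` perturbed by
`ε (c σ 0 + c σ 1 * z + c σ 2 * z ^ 2 + c σ 3 * z ^ 3)`. -/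
noncomputable def field (c : Zone → Fin 4 → ℂ) (ε : ℝ) (σ : Zone) (z : ℂ) : ℂ :=
  -Complex.I * (z - 1) + (ε : ℂ) * ∑ j : Fin 4, c σ j * z ^ (j : ℕ)

/-- Filippov's set-valued field of the piecewise system `z' = X σ z` for `z ∈ region σ`: the convex
hull of the limits at `z` of the fields of the adjacent zones (the fields are continuous on `ℂ`).
Inside the zone `σ` it is the single vector `X σ z`. -/
def filippov (X : Zone → ℂ → ℂ) (z : ℂ) : Set ℂ :=
  convexHull ℝ {v | ∃ σ, z ∈ closure (region σ) ∧ v = X σ z}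

/-- Filippov solutions, defined for all times: `γ` is (locally) absolutely continuous, that is, the
integral of a locally integrable `v`, and `γ' = v ∈ filippov X γ` almost everywhere. -/
def IsSolution (X : Zone → ℂ → ℂ) (γ : ℝ → ℂ) : Prop :=
  ∃ v : ℝ → ℂ, (∀ a b : ℝ, IntervalIntegrable v volume a b) ∧
    (∀ᵐ t : ℝ, v t ∈ filippov X (γ t)) ∧
    ∀ t : ℝ, γ t = γ 0 + ∫ s in (0 : ℝ)..t, v s

/-- `γ` is a nonconstant solution with period `T`. -/
def IsPeriodicSolution (X : Zone → ℂ → ℂ) (γ : ℝ → ℂ) (T : ℝ) : Prop :=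
  0 < T ∧ IsSolution X γ ∧ Function.Periodic γ T ∧ ∃ t, γ t ≠ γ 0

/-- `Γ` is a periodic orbit: a simple closed curve described by a periodic solution. -/
def IsPeriodicOrbit (X : Zone → ℂ → ℂ) (Γ : Set ℂ) : Prop :=
  ∃ (γ : ℝ → ℂ) (T : ℝ), IsPeriodicSolution X γ T ∧ InjOn γ (Ico 0 T) ∧ range γ = Γ

/-- A limit cycle is an isolated periodic orbit: some neighbourhood of it contains no other
nonconstant periodic solution. -/
def IsLimitCycle (X : Zone → ℂ → ℂ) (Γ : Set ℂ) : Prop :=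
  IsPeriodicOrbit X Γ ∧
    ∃ U : Set ℂ, IsOpen U ∧ Γ ⊆ U ∧
      ∀ (γ : ℝ → ℂ) (T : ℝ), IsPeriodicSolution X γ T → range γ ⊆ U → range γ = Γ

/-- A curve `L` crosses the circle of center `a` and radius `r`: it has points strictly inside and
points strictly outside the circle. -/
def Crosses (L : Set ℂ) (a : ℂ) (r : ℝ) : Prop :=
  (∃ z ∈ L, ‖z - a‖ < r) ∧ ∃ z ∈ L, r < ‖z - a‖

/-- `L` crosses `|z| = 1` and does not meet `|z - 2/3| = 1/3`. -/
def CrossesOnlyOuter (L : Set ℂ) : Prop :=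
  Crosses L 0 1 ∧ ∀ z ∈ L, ‖z - 2 / 3‖ ≠ 1 / 3

/-- `L` crosses both `|z| = 1` and `|z - 2/3| = 1/3`. -/
def CrossesBoth (L : Set ℂ) : Prop :=
  Crosses L 0 1 ∧ Crosses L (2 / 3) (1 / 3)

/-- For a suitable cubic perturbation, at least `n` limit cycles bifurcate from periodic orbits of
the center that satisfy `P`: there are `n` distinct such orbits `L i` and, for every sufficiently
small `ε ≠ 0`, there are `n` distinct limit cycles `Γ ε i` of the perturbed system, also satisfying
`P`, with `Γ ε i` tending to `L i` in the Hausdorff distance as `ε → 0`. -/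
def LimitCyclesBifurcate (n : ℕ) (P : Set ℂ → Prop) : Prop :=
  ∃ (c : Zone → Fin 4 → ℂ) (L : Fin n → Set ℂ),
    Function.Injective L ∧
    (∀ i, IsPeriodicOrbit (field c 0) (L i) ∧ P (L i)) ∧
    ∃ (ε₀ : ℝ) (Γ : ℝ → Fin n → Set ℂ), 0 < ε₀ ∧
      (∀ ε : ℝ, 0 < |ε| → |ε| < ε₀ →
        Function.Injective (Γ ε) ∧
        ∀ i, IsLimitCycle (field c ε) (Γ ε i) ∧ P (Γ ε i)) ∧
      ∀ i, Tendsto (fun ε => Metric.hausdorffEDist (Γ ε i) (L i)) (𝓝[≠] 0) (𝓝 0)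

end TangentCircles

/-! In the coordinate `W` with `z = 1 + e⁻ᵂ` the center becomes the constant field `i`: its orbits
are the vertical lines `Re W = y`, closed up modulo `2πi`. Circles tangent at `1` become lines `Re w
= -c` in `w = e^W = 1/(z - 1)`, with `c = 1/2` for `|z| = 1` and `c = 3/2` for the inner circle,
that is, graphs `Im W = arccos(-c e⁻ˢ)` over `s = Re W`. A perturbation `-∑ aⱼ (z - 1)^j` with real
`aⱼ` becomes `ε ∑ aⱼ e^((1-j)W)`.

Real coefficients give a time-reversing symmetry: conjugation exchanges `ε` and `-ε`. Hence only the
upper half strip `0 ≤ Im W ≤ π` is analysed. If `half ε` sends an abscissa on `Im W = π` backward to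
one on `Im W = 0`, the lower half of a turn is the mirror image for `-ε`, and closed orbits are the
zeros of `half ε - half (-ε)`.

Within one zone the primitive `Φ` of `1/(1 - iε drift)` grows at speed `i` along the flow, so `Re Φ`
is a first integral and `Im Φ` a clock. Comparing `Re Φ` on consecutive switching curves gives `half
ε y = y + ε M(y) + O(ε²)` with `half ε` analytic and increasing (`Model.eventually_good`), so the
displacement is `2ε M(y) + O(ε²)`. Every Filippov velocity is close to `i`, so all solutions cross
the switching curves transversally, sliding is impossible, and arcs are determined by their end
points (`Sector.arc`).

The function `M` is an arbitrary combination of four functions for each curve where the coefficients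
jump, and a constant. These `5` or `9` functions are linearly independent (`eq_zero_of_sum_curveFn`,
`eq_zero_of_sum_curveFn_add`): derivatives are polynomials in `e⁻²ˢ` over square roots, and the two
square roots have different branch points. Interpolating alternating values (`exists_interpolation`)
gives `4` or `8` sign changes.

Each sign change persists as a zero of the displacement (`Model.limitCyclesBifurcate`). Analyticity
makes this zero isolated, and monotonicity of the half maps forces any periodic solution nearby,
even one winding several times, to be the same orbit (`Good.range_eq_orbit`); so it is a limit
cycle. -/

namespace TangentCircles

/-! ### Primitives of integrable functions: chain rule and existence of solutions. -/

section Primitives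

variable {E F : Type*} [NormedAddCommGroup E] [NormedSpace ℝ E] [CompleteSpace E]
  [NormedAddCommGroup F] [NormedSpace ℝ F] [CompleteSpace F]

omit [CompleteSpace E] in
theorem sub_eq_integral_of_primitive {u ω : ℝ → E} {a b : ℝ}
    (hω : IntervalIntegrable ω volume a b)
    (hu : ∀ t ∈ Icc a b, u t = u a + ∫ s in a..t, ω s)
    {s t : ℝ} (hs : s ∈ Icc a b) (ht : t ∈ Icc a b) :
    IntervalIntegrable ω volume s t ∧ u t - u s = ∫ r in s..t, ω r := by
  have hab : a ≤ b := hs.1.trans hs.2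
  have h1 : ∀ r ∈ Icc a b, IntervalIntegrable ω volume a r := fun r hr =>
    hω.mono_set (by rw [uIcc_of_le hr.1, uIcc_of_le hab]; exact Icc_subset_Icc_right hr.2)
  refine ⟨(h1 s hs).symm.trans (h1 t ht), ?_⟩
  rw [hu t ht, hu s hs, ← intervalIntegral.integral_interval_sub_left (h1 t ht) (h1 s hs)]
  abel

omit [CompleteSpace E] in
/-- A bounded derivative gives a Lipschitz primitive. -/
theorem norm_sub_le_of_primitive {u ω : ℝ → E} {a b K : ℝ}
    (hω : IntervalIntegrable ω volume a b)
    (hK : ∀ᵐ t, t ∈ Ioc a b → ‖ω t‖ ≤ K)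
    (hu : ∀ t ∈ Icc a b, u t = u a + ∫ s in a..t, ω s)
    {s t : ℝ} (hs : s ∈ Icc a b) (ht : t ∈ Icc a b) :
    ‖u t - u s‖ ≤ K * |t - s| := by
  rw [(sub_eq_integral_of_primitive hω hu hs ht).2]
  apply intervalIntegral.norm_integral_le_of_norm_le_const_ae
  filter_upwards [hK] with r hr hr'
  apply hr
  rcases le_total s t with h | h
  · rw [uIoc_of_le h] at hr'
    exact ⟨hs.1.trans_lt hr'.1, hr'.2.trans ht.2⟩
  · rw [uIoc_of_ge h] at hr'
    exact ⟨ht.1.trans_lt hr'.1, hr'.2.trans hs.2⟩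

/-- The chain rule for primitives of bounded functions, in integral form. -/
theorem comp_eq_add_integral_of_primitive {f : E → F} {f' : E → E →L[ℝ] F} {u ω : ℝ → E}
    {a b K : ℝ} (hab : a ≤ b) (hω : IntervalIntegrable ω volume a b)
    (hK : ∀ᵐ t, t ∈ Ioc a b → ‖ω t‖ ≤ K)
    (hu : ∀ t ∈ Icc a b, u t = u a + ∫ s in a..t, ω s)
    (hf : ∀ t ∈ Icc a b, HasFDerivAt f (f' (u t)) (u t))
    (hf' : ContinuousOn (fun t => f' (u t)) (Icc a b)) :
    IntervalIntegrable (fun s => f' (u s) (ω s)) volume a b ∧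
    ∀ t ∈ Icc a b, f (u t) = f (u a) + ∫ s in a..t, f' (u s) (ω s) := by
  obtain ⟨C, hC⟩ := isCompact_Icc.exists_bound_of_continuousOn hf'
  have hint : IntervalIntegrable (fun s => f' (u s) (ω s)) volume a b := by
    rw [intervalIntegrable_iff_integrableOn_Ioc_of_le hab] at hω ⊢
    have hm : AEStronglyMeasurable (fun t => f' (u t)) (volume.restrict (Ioc a b)) :=
      (hf'.mono Ioc_subset_Icc_self).aestronglyMeasurable measurableSet_Ioc
    refine Integrable.mono' (hω.norm.const_mul C)
      ((ContinuousLinearMap.id ℝ (E →L[ℝ] F)).aestronglyMeasurable_comp₂ hm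
        hω.aestronglyMeasurable) ?_
    filter_upwards [ae_restrict_mem measurableSet_Ioc] with t ht
    exact (ContinuousLinearMap.le_opNorm _ _).trans
      (mul_le_mul_of_nonneg_right (hC t (Ioc_subset_Icc_self ht)) (norm_nonneg _))
  refine ⟨hint, ?_⟩
  have hq : ∀ t ∈ Icc a b, IntervalIntegrable (fun s => f' (u s) (ω s)) volume a t := fun r hr =>
    hint.mono_set (by rw [uIcc_of_le hr.1, uIcc_of_le hab]; exact Icc_subset_Icc_right hr.2)
  -- `u` need not be differentiable at a given point, but this difference has derivative zero at
  -- every point: the linear parts cancel, since `f' (u t₀)` passes through the integral, and both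
  -- remainders are small multiples of `|t - t₀|` because `u` is Lipschitz and `ω` is bounded.
  have key : ∀ t ∈ Icc a b, HasDerivWithinAt
      (fun t => f (u t) - ∫ s in a..t, f' (u s) (ω s)) 0 (Icc a b) t := by
    intro t₀ ht₀
    rw [hasDerivWithinAt_iff_isLittleO, Asymptotics.isLittleO_iff]
    intro c hc
    -- Two remainders of size `d |K| |t - t₀|` have to fit into `c |t - t₀|`.
    set d : ℝ := c / (2 * (|K| + 1)) with hd
    have hd0 : 0 < d := by positivity
    have hlip : ∀ t ∈ Icc a b, ‖u t - u t₀‖ ≤ |K| * |t - t₀| := fun t ht =>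
      (norm_sub_le_of_primitive hω hK hu ht₀ ht).trans
        (mul_le_mul_of_nonneg_right (le_abs_self K) (abs_nonneg _))
    have hcont : Tendsto u (𝓝[Icc a b] t₀) (𝓝 (u t₀)) := by
      rw [tendsto_iff_norm_sub_tendsto_zero]
      refine squeeze_zero' (Eventually.of_forall fun _ => norm_nonneg _)
        (eventually_mem_nhdsWithin.mono hlip) ?_
      have : Tendsto (fun t => |K| * |t - t₀|) (𝓝 t₀) (𝓝 (|K| * |t₀ - t₀|)) :=
        Continuous.tendsto (by fun_prop) t₀
      simp only [sub_self, abs_zero, mul_zero] at this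
      exact this.mono_left nhdsWithin_le_nhds
    have h1 := hcont.eventually ((hasFDerivAt_iff_isLittleO.1 (hf t₀ ht₀)).def hd0)
    have h2 : ∀ᶠ t in 𝓝[Icc a b] t₀, ‖f' (u t) - f' (u t₀)‖ ≤ d := by
      have := (hf' t₀ ht₀)
      filter_upwards [this (Metric.closedBall_mem_nhds _ hd0)] with t ht
      simpa [dist_eq_norm] using ht
    obtain ⟨η, hη, h2⟩ := Metric.mem_nhdsWithin_iff.1 h2
    filter_upwards [h1, inter_mem_nhdsWithin (Icc a b) (Metric.ball_mem_nhds t₀ hη)]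
      with t h1 ht
    have hi := sub_eq_integral_of_primitive hω hu ht₀ ht.1
    have hq2 : IntervalIntegrable (fun s => f' (u s) (ω s)) volume t₀ t :=
      (hq _ ht₀).symm.trans (hq _ ht.1)
    have e1 : f' (u t₀) (u t - u t₀) = ∫ s in t₀..t, f' (u t₀) (ω s) := by
      rw [hi.2, ContinuousLinearMap.intervalIntegral_comp_comm _ hi.1]
    have e2 : (f (u t) - ∫ s in a..t, f' (u s) (ω s)) - (f (u t₀) - ∫ s in a..t₀, f' (u s) (ω s))
        = (f (u t) - f (u t₀) - f' (u t₀) (u t - u t₀))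
          - ∫ s in t₀..t, (f' (u s) - f' (u t₀)) (ω s) := by
      have : ∫ s in t₀..t, (f' (u s) - f' (u t₀)) (ω s)
          = (∫ s in t₀..t, f' (u s) (ω s)) - ∫ s in t₀..t, f' (u t₀) (ω s) := by
        rw [← intervalIntegral.integral_sub hq2 ⟨(f' (u t₀)).integrable_comp hi.1.1,
          (f' (u t₀)).integrable_comp hi.1.2⟩]
        rfl
      rw [this, e1, ← intervalIntegral.integral_interval_sub_left (hq _ ht.1) (hq _ ht₀)]
      abel
    have e3 : ‖∫ s in t₀..t, (f' (u s) - f' (u t₀)) (ω s)‖ ≤ d * |K| * |t - t₀| := by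
      apply intervalIntegral.norm_integral_le_of_norm_le_const_ae
      filter_upwards [hK] with r hr hr'
      have hrm : r ∈ Ioc a b ∧ |r - t₀| < η := by
        have h3 : |t - t₀| < η := ht.2
        rcases le_total t₀ t with h | h
        · rw [uIoc_of_le h] at hr'
          rw [abs_lt] at h3 ⊢
          exact ⟨⟨ht₀.1.trans_lt hr'.1, hr'.2.trans ht.1.2⟩, by linarith [hr'.1], by linarith [hr'.2]⟩
        · rw [uIoc_of_ge h] at hr'
          rw [abs_lt] at h3 ⊢
          exact ⟨⟨ht.1.1.trans_lt hr'.1, hr'.2.trans ht₀.2⟩, by linarith [hr'.1], by linarith [hr'.2]⟩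
      refine (ContinuousLinearMap.le_opNorm _ _).trans (mul_le_mul ?_ ((hr hrm.1).trans (le_abs_self K))
        (norm_nonneg _) hd0.le)
      exact h2 ⟨hrm.2, Ioc_subset_Icc_self hrm.1⟩
    simp only [smul_zero, sub_zero]
    rw [e2]
    have e4 : d * |K| * |t - t₀| ≤ c / 2 * |t - t₀| := by
      apply mul_le_mul_of_nonneg_right _ (abs_nonneg _)
      rw [hd, div_mul_eq_mul_div, div_le_iff₀ (by positivity)]
      nlinarith [abs_nonneg K]
    calc _ ≤ d * ‖u t - u t₀‖ + d * |K| * |t - t₀| := (norm_sub_le _ _).trans (add_le_add h1 e3)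
      _ ≤ d * (|K| * |t - t₀|) + d * |K| * |t - t₀| := by
        gcongr; exact hlip t ht.1
      _ ≤ c * ‖t - t₀‖ := by rw [Real.norm_eq_abs]; linarith
  intro t ht
  have hconst := constant_of_derivWithin_zero
    (f := fun t => f (u t) - ∫ s in a..t, f' (u s) (ω s)) (a := a) (b := b)
    (fun x hx => (key x hx).differentiableWithinAt)
    (fun x hx => (key x (Ico_subset_Icc_self hx)).derivWithin
      (uniqueDiffOn_Icc (hx.1.trans_lt hx.2) x (Ico_subset_Icc_self hx))) t ht
  simp only [intervalIntegral.integral_same, sub_zero] at hconst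
  rw [← hconst]; abel

end Primitives

theorem comp_eq_add_integral_of_hasDerivAt {f f' : ℂ → ℂ} {u ω : ℝ → ℂ}
    {a b K : ℝ} (hab : a ≤ b) (hω : IntervalIntegrable ω volume a b)
    (hK : ∀ᵐ t, t ∈ Ioc a b → ‖ω t‖ ≤ K)
    (hu : ∀ t ∈ Icc a b, u t = u a + ∫ s in a..t, ω s)
    (hf : ∀ t ∈ Icc a b, HasDerivAt f (f' (u t)) (u t))
    (hf' : ContinuousOn (fun t => f' (u t)) (Icc a b)) :
    IntervalIntegrable (fun s => f' (u s) * ω s) volume a b ∧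
    ∀ t ∈ Icc a b, f (u t) = f (u a) + ∫ s in a..t, f' (u s) * ω s := by
  have := comp_eq_add_integral_of_primitive (f := f)
    (f' := fun z => ContinuousLinearMap.mul ℝ ℂ (f' z)) hab hω hK hu (fun t ht => by
      convert (hf t ht).hasFDerivAt.restrictScalars ℝ using 1
      ext x; simp [mul_comm]) ((ContinuousLinearMap.mul ℝ ℂ).continuous.comp_continuousOn hf')
  simpa using this

/-- This is the Picard–Lindelöf fixed point, extended outside `[0, T]` by its end values, which is
why continuity and the ball bound hold for all times. -/
theorem exists_solution_on_Icc {f : ℂ → ℂ} {p : ℂ} {ρ T L : ℝ} {K : NNReal} (hρ : 0 ≤ ρ)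
    (hT : 0 ≤ T) (hL : 0 ≤ L) (hK : LipschitzOnWith K f (Metric.closedBall p ρ))
    (hb : ∀ z ∈ Metric.closedBall p ρ, ‖f z‖ ≤ L) (hLT : L * T ≤ ρ) :
    ∃ u : ℝ → ℂ, Continuous u ∧ u 0 = p ∧ (∀ t, u t ∈ Metric.closedBall p ρ) ∧
      ∀ t ∈ Icc 0 T, u t = p + ∫ s in (0 : ℝ)..t, f (u s) := by
  lift ρ to NNReal using hρ
  lift L to NNReal using hL
  obtain ⟨t₀, ht₀⟩ : ∃ t₀ : Icc (0 : ℝ) T, (t₀ : ℝ) = 0 := ⟨⟨0, le_rfl, hT⟩, rfl⟩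
  have hpl : IsPicardLindelof (fun _ : ℝ => f) t₀ p ρ 0 L K := by
    refine IsPicardLindelof.of_time_independent hb hK ?_
    simpa [hT, ht₀] using hLT
  have hx : p ∈ Metric.closedBall p ((0 : NNReal) : ℝ) := by simp
  obtain ⟨α, hα⟩ := ODE.FunSpace.exists_isFixedPt_next hpl hx
  refine ⟨(ODE.FunSpace.next hpl hx α).compProj, ODE.FunSpace.continuous_compProj _, ?_,
    fun t => ODE.FunSpace.compProj_mem_closedBall _ hpl.mul_max_le, ?_⟩
  · exact (congrArg _ ht₀.symm).trans ((ODE.FunSpace.compProj_val).trans (ODE.FunSpace.next_apply₀ hpl hx α))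
  · intro t ht
    conv_lhs => rw [ODE.FunSpace.compProj_apply, ODE.FunSpace.next_apply, projIcc_of_mem _ ht]
    rw [hα, ODE.picard_apply, ht₀]

/-! ### Families of maps of the form identity plus `ε m` plus `O(ε²)`. -/

section NearId

/-- `m` is bounded and Lipschitz on `(a, b)`. -/
def BddLip (m : ℝ → ℝ) (a b : ℝ) : Prop :=
  ∃ C, 0 ≤ C ∧ (∀ s ∈ Ioo a b, |m s| ≤ C) ∧
    ∀ s ∈ Ioo a b, ∀ t ∈ Ioo a b, |m s - m t| ≤ C * |s - t|

theorem BddLip.mono {m : ℝ → ℝ} {a b a' b' : ℝ} (h : BddLip m a b) (ha : a ≤ a') (hb : b' ≤ b) :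
    BddLip m a' b' := by
  obtain ⟨C, h0, h1, h2⟩ := h
  exact ⟨C, h0, fun s hs => h1 s (Ioo_subset_Ioo ha hb hs), fun s hs t ht =>
    h2 s (Ioo_subset_Ioo ha hb hs) t (Ioo_subset_Ioo ha hb ht)⟩

theorem BddLip.add {m n : ℝ → ℝ} {a b : ℝ} (h : BddLip m a b) (h' : BddLip n a b) :
    BddLip (fun s => m s + n s) a b := by
  obtain ⟨C, h0, h1, h2⟩ := h
  obtain ⟨D, k0, k1, k2⟩ := h'
  refine ⟨C + D, by positivity, fun s hs => (abs_add_le _ _).trans (add_le_add (h1 s hs) (k1 s hs)),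
    fun s hs t ht => ?_⟩
  have : m s + n s - (m t + n t) = (m s - m t) + (n s - n t) := by ring
  rw [this, add_mul]
  exact (abs_add_le _ _).trans (add_le_add (h2 s hs t ht) (k2 s hs t ht))

theorem BddLip.neg {m : ℝ → ℝ} {a b : ℝ} (h : BddLip m a b) : BddLip (fun s => - m s) a b := by
  obtain ⟨C, h0, h1, h2⟩ := h
  refine ⟨C, h0, fun s hs => by rw [abs_neg]; exact h1 s hs, fun s hs t ht => ?_⟩
  have : - m s - - m t = -(m s - m t) := by ring
  rw [this, abs_neg]; exact h2 s hs t ht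

theorem BddLip.sub {m n : ℝ → ℝ} {a b : ℝ} (h : BddLip m a b) (h' : BddLip n a b) :
    BddLip (fun s => m s - n s) a b := by
  simpa only [sub_eq_add_neg] using h.add h'.neg

/-- The family `T ε` of increasing analytic functions on `(a, b)` equals `id + ε m + O(ε ^ 2)`. -/
def NearId (T : ℝ → ℝ → ℝ) (m : ℝ → ℝ) (a b : ℝ) : Prop :=
  BddLip m a b ∧ ∃ C, 0 ≤ C ∧ ∀ᶠ ε in 𝓝 (0 : ℝ), ∀ s ∈ Ioo a b,
    |T ε s - s - ε * m s| ≤ C * ε ^ 2 ∧ AnalyticAt ℝ (T ε) s ∧ 0 < deriv (T ε) s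

theorem strictMonoOn_of_analytic_deriv_pos {f : ℝ → ℝ} {a b : ℝ}
    (h : ∀ s ∈ Ioo a b, AnalyticAt ℝ f s ∧ 0 < deriv f s) : StrictMonoOn f (Ioo a b) :=
  strictMonoOn_of_deriv_pos (convex_Ioo a b)
    (fun s hs => (h s hs).1.continuousAt.continuousWithinAt)
    (fun s hs => (h s (interior_subset hs)).2)

theorem NearId.strictMonoOn {T : ℝ → ℝ → ℝ} {m : ℝ → ℝ} {a b : ℝ} (h : NearId T m a b) :
    ∀ᶠ ε in 𝓝 (0 : ℝ), StrictMonoOn (T ε) (Ioo a b) := by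
  obtain ⟨-, C, -, h⟩ := h
  filter_upwards [h] with ε h
  exact strictMonoOn_of_analytic_deriv_pos fun s hs => (h s hs).2

theorem NearId.close {T : ℝ → ℝ → ℝ} {m : ℝ → ℝ} {a b : ℝ} (h : NearId T m a b) :
    ∃ C, 0 ≤ C ∧ ∀ᶠ ε in 𝓝 (0 : ℝ), ∀ s ∈ Ioo a b, |T ε s - s| ≤ C * |ε| := by
  obtain ⟨⟨D, hD, h1, -⟩, C, hC, h⟩ := h
  refine ⟨C + D, by positivity, ?_⟩
  filter_upwards [h, Metric.ball_mem_nhds (0 : ℝ) one_pos] with ε h hε s hs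
  have hε' : |ε| ≤ 1 := by simpa using (show dist ε 0 < 1 from hε).le
  have e : T ε s - s = (T ε s - s - ε * m s) + ε * m s := by ring
  rw [e]
  refine (abs_add_le _ _).trans ?_
  have := (h s hs).1
  rw [abs_mul]
  have h3 : ε ^ 2 ≤ |ε| := by rw [← sq_abs]; nlinarith [abs_nonneg ε]
  nlinarith [h1 s hs, abs_nonneg ε, mul_le_mul_of_nonneg_left h3 hC,
    mul_le_mul_of_nonneg_left (h1 s hs) (abs_nonneg ε)]

/-- First order terms add: `S ε s` is within `O(ε)` of `s` and `m` is Lipschitz, so replacing `m (S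
ε s)` by `m s` costs `O(ε²)`. The strictly smaller interval leaves room for this displacement. -/
theorem NearId.comp {T S : ℝ → ℝ → ℝ} {m n : ℝ → ℝ} {a b a' b' : ℝ} (hT : NearId T m a b)
    (hS : NearId S n a' b') (ha : a < a') (hb : b' < b) :
    NearId (fun ε s => T ε (S ε s)) (fun s => m s + n s) a' b' := by
  obtain ⟨D, hD, hD'⟩ := hS.close
  obtain ⟨hm, C, hC, hT⟩ := hT
  obtain ⟨hn, B, hB, hS⟩ := hS
  obtain ⟨E, hE, h1, h2⟩ := id hm
  refine ⟨(hm.mono ha.le hb.le).add hn, C + B + E * D, by positivity, ?_⟩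
  have hsm : ∀ᶠ ε in 𝓝 (0 : ℝ), D * |ε| < min (a' - a) (b - b') := by
    have : Tendsto (fun ε : ℝ => D * |ε|) (𝓝 0) (𝓝 (D * |(0 : ℝ)|)) :=
      Continuous.tendsto (by fun_prop) 0
    rw [abs_zero, mul_zero] at this
    exact this.eventually (gt_mem_nhds (lt_min (by linarith) (by linarith)))
  filter_upwards [hT, hS, hD', hsm] with ε hT hS hD' hsm s hs
  have hmem : S ε s ∈ Ioo a b := by
    have := abs_le.1 (hD' s hs)
    have h3 := lt_min_iff.1 hsm
    exact ⟨by linarith [hs.1, h3.1], by linarith [hs.2, h3.2]⟩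
  have hT := hT _ hmem
  have hS := hS s hs
  refine ⟨?_, ?_, ?_⟩
  · have e : T ε (S ε s) - s - ε * (m s + n s) = (T ε (S ε s) - S ε s - ε * m (S ε s))
        + (S ε s - s - ε * n s) + ε * (m (S ε s) - m s) := by ring
    rw [e]
    have h4 : |ε * (m (S ε s) - m s)| ≤ E * D * ε ^ 2 := by
      rw [abs_mul]
      calc |ε| * |m (S ε s) - m s| ≤ |ε| * (E * (D * |ε|)) := by
            gcongr
            exact (h2 _ hmem _ ⟨ha.trans hs.1, hs.2.trans hb⟩).trans (by gcongr; exact hD' s hs)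
        _ = E * D * ε ^ 2 := by rw [← sq_abs]; ring
    refine (abs_add_three _ _ _).trans ?_
    linarith [hT.1, hS.1]
  · exact hT.2.1.comp hS.2.1
  · have := deriv_comp s hT.2.1.differentiableAt hS.2.1.differentiableAt
    change 0 < deriv (T ε ∘ S ε) s
    rw [this]
    exact mul_pos hT.2.2 hS.2.2

/-- The map sending `s` to the point `t` of `(a, b)` with `B t = A s`. -/
noncomputable def transit (A B : ℝ → ℝ) (a b s : ℝ) : ℝ :=
  Function.invFunOn B (Ioo a b) (A s)

theorem transit_eq {A B : ℝ → ℝ} {a b s t : ℝ} (hB : InjOn B (Ioo a b)) (ht : t ∈ Ioo a b)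
    (h : B t = A s) : transit A B a b s = t := by
  have hex : ∃ t ∈ Ioo a b, B t = A s := ⟨t, ht, h⟩
  exact hB (Function.invFunOn_mem hex) ht ((Function.invFunOn_eq hex).trans h.symm)

/-- `A` and `B` move points by at most `C|ε|` and `D|ε|`, so the values of `B` at distance `(C +
D)|ε|` on either side of `s` enclose `A s`, and the intermediate value theorem applies. -/
theorem transit_spec {A B : ℝ → ℝ → ℝ} {m n : ℝ → ℝ} {a b a' b' : ℝ} (hA : NearId A m a b)
    (hB : NearId B n a b) (ha : a < a') (hb : b' < b) :
    ∃ C, 0 ≤ C ∧ ∀ᶠ ε in 𝓝 (0 : ℝ), ∀ s ∈ Ioo a' b',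
      transit (A ε) (B ε) a b s ∈ Ioo a b ∧ B ε (transit (A ε) (B ε) a b s) = A ε s ∧
      |transit (A ε) (B ε) a b s - s| ≤ C * |ε| := by
  obtain ⟨C, hC, hA⟩ := hA.close
  obtain ⟨D, hD, hB'⟩ := hB.close
  have hm := hB.strictMonoOn
  obtain ⟨-, B', -, hB⟩ := hB
  refine ⟨C + D, by positivity, ?_⟩
  have hsm : ∀ᶠ ε in 𝓝 (0 : ℝ), (C + D) * |ε| < min (a' - a) (b - b') := by
    have : Tendsto (fun ε : ℝ => (C + D) * |ε|) (𝓝 0) (𝓝 ((C + D) * |(0 : ℝ)|)) :=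
      Continuous.tendsto (by fun_prop) 0
    rw [abs_zero, mul_zero] at this
    exact this.eventually (gt_mem_nhds (lt_min (by linarith) (by linarith)))
  filter_upwards [hA, hB', hm, hB, hsm] with ε hA hB' hm hB hsm s hs
  have h3 := lt_min_iff.1 hsm
  set δ := (C + D) * |ε| with hδ
  have hδ0 : 0 ≤ δ := by positivity
  have hsub : Icc (s - δ) (s + δ) ⊆ Ioo a b := fun x hx =>
    ⟨by linarith [hs.1, hx.1], by linarith [hs.2, hx.2]⟩
  have hcont : ContinuousOn (B ε) (Icc (s - δ) (s + δ)) := fun x hx =>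
    (hB x (hsub hx)).2.1.continuousAt.continuousWithinAt
  have hA := abs_le.1 (hA s ⟨ha.trans hs.1, hs.2.trans hb⟩)
  have hl := abs_le.1 (hB' (s - δ) (hsub ⟨le_rfl, by linarith⟩))
  have hr := abs_le.1 (hB' (s + δ) (hsub ⟨by linarith, le_rfl⟩))
  have hCD : δ = C * |ε| + D * |ε| := by rw [hδ]; ring
  obtain ⟨t, ht, hts⟩ := intermediate_value_Icc (by linarith) hcont
    (show A ε s ∈ Icc (B ε (s - δ)) (B ε (s + δ)) from ⟨by linarith, by linarith⟩)
  rw [transit_eq hm.injOn (hsub ht) hts]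
  exact ⟨hsub ht, hts, abs_le.2 ⟨by linarith [ht.1], by linarith [ht.2]⟩⟩

theorem NearId.transit {A B : ℝ → ℝ → ℝ} {m n : ℝ → ℝ} {a b a' b' : ℝ} (hA : NearId A m a b)
    (hB : NearId B n a b) (ha : a < a') (hb : b' < b) :
    NearId (fun ε => transit (A ε) (B ε) a b) (fun s => m s - n s) a' b' := by
  obtain ⟨D, hD, hsp⟩ := transit_spec hA hB ha hb
  have hm := hB.strictMonoOn
  obtain ⟨hmA, C, hC, hA⟩ := hA
  obtain ⟨hmB, E, hE, hB⟩ := hB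
  obtain ⟨F, hF, h1, h2⟩ := id hmB
  refine ⟨(hmA.mono ha.le hb.le).sub (hmB.mono ha.le hb.le), C + E + F * D, by positivity, ?_⟩
  filter_upwards [hA, hB, hm, hsp] with ε hA hB hm hsp s hs
  have hs' : s ∈ Ioo a b := ⟨ha.trans hs.1, hs.2.trans hb⟩
  obtain ⟨hmem, heq, hclose⟩ := hsp s hs
  have hA := hA s hs'
  have hB := hB _ hmem
  -- The analytic local inverse of `B` composed with `A` solves the same equation as the chosen
  -- global inverse, and injectivity of `B` makes the two agree near `s`.
  have han : AnalyticAt ℝ (TangentCircles.transit (A ε) (B ε) a b) s := by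
    have hne := hB.2.2.ne'
    have h4 := hB.2.1.analyticAt_localInverse hne
    set r := hB.2.1.hasStrictDerivAt.localInverse _ _ _ hne with hr
    rw [heq] at h4
    have hrT : r (A ε s) = TangentCircles.transit (A ε) (B ε) a b s := by
      rw [← heq]; exact HasStrictFDerivAt.localInverse_apply_image ..
    have hrA := h4.comp hA.2.1
    refine hrA.congr ?_
    have hev : ∀ᶠ y in 𝓝 (A ε s), B ε (r y) = y := by
      rw [← heq]; exact HasStrictDerivAt.eventually_right_inverse ..
    have hev2 : ∀ᶠ x in 𝓝 s, r (A ε x) ∈ Ioo a b := by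
      refine hrA.continuousAt.eventually_mem ?_
      rw [Function.comp_apply, hrT]
      exact Ioo_mem_nhds hmem.1 hmem.2
    filter_upwards [hA.2.1.continuousAt.eventually hev, hev2] with x hx hx2
    exact (transit_eq hm.injOn hx2 hx).symm
  refine ⟨?_, han, ?_⟩
  · set t := TangentCircles.transit (A ε) (B ε) a b s
    have e : t - s - ε * (m s - n s) = (A ε s - s - ε * m s) - (B ε t - t - ε * n t)
        - ε * (n t - n s) := by rw [heq]; ring
    rw [e]
    have h4 : |ε * (n t - n s)| ≤ F * D * ε ^ 2 := by
      rw [abs_mul]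
      calc |ε| * |n t - n s| ≤ |ε| * (F * (D * |ε|)) := by
            gcongr
            exact (h2 _ hmem _ hs').trans (by gcongr)
        _ = F * D * ε ^ 2 := by rw [← sq_abs]; ring
    refine (abs_sub _ _).trans ((add_le_add_left (abs_sub _ _) _).trans ?_)
    linarith [hA.1, hB.1]
  · have hev : (B ε ∘ TangentCircles.transit (A ε) (B ε) a b) =ᶠ[𝓝 s] A ε := by
      filter_upwards [Ioo_mem_nhds hs.1 hs.2] with x hx
      exact (hsp x hx).2.1
    have h5 := deriv_comp s hB.2.1.differentiableAt han.differentiableAt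
    rw [hev.deriv_eq] at h5
    have h6 := hA.2.2
    rw [h5] at h6
    exact (pos_iff_pos_of_mul_pos h6).1 hB.2.2

end NearId

/-! ### Sign changes of analytic functions and interpolation. -/

section SignChange

/-- Take the supremum `y` of the points where `k` is positive. Positive values accumulate at `y`
from the left; to its right `k ≤ 0`, and strictly so close to `y`, because an analytic function that
is not identically zero has isolated zeros. -/
theorem exists_sign_change_pos {k : ℝ → ℝ} {p q : ℝ} (hpq : p < q)
    (hk : AnalyticOnNhd ℝ k (Icc p q)) (hp : 0 < k p) (hq : k q < 0) :
    ∃ y ∈ Ioo p q, k y = 0 ∧ ∀ δ > 0, ∃ p' ∈ Icc p q, ∃ q' ∈ Icc p q,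
      |p' - y| < δ ∧ |q' - y| < δ ∧ p' < q' ∧ k p' * k q' < 0 := by
  have hc : ContinuousOn k (Icc p q) := hk.continuousOn
  set S : Set ℝ := {t | t ∈ Icc p q ∧ 0 < k t} with hS
  have hpS : p ∈ S := ⟨⟨le_rfl, hpq.le⟩, hp⟩
  have hbdd : BddAbove S := ⟨q, fun t ht => ht.1.2⟩
  set y := sSup S with hy
  have hpy : p ≤ y := le_csSup hbdd hpS
  have hyq : y ≤ q := csSup_le ⟨p, hpS⟩ fun t ht => ht.1.2
  have hyI : y ∈ Icc p q := ⟨hpy, hyq⟩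
  have happ : ∀ δ > 0, ∃ t ∈ S, y - δ < t ∧ t ≤ y := fun δ hδ => by
    obtain ⟨t, ht, h⟩ := exists_lt_of_lt_csSup ⟨p, hpS⟩ (show y - δ < sSup S by linarith)
    exact ⟨t, ht, h, le_csSup hbdd ht⟩
  have hge : 0 ≤ k y := by
    by_contra! hneg
    obtain ⟨η, hη, h⟩ := Metric.mem_nhdsWithin_iff.1 (hc y hyI (gt_mem_nhds hneg))
    obtain ⟨t, ht, h1, h2⟩ := happ η hη
    have : k t < 0 := h ⟨by rw [Metric.mem_ball, Real.dist_eq, abs_lt]; constructor <;> linarith, ht.1⟩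
    exact absurd ht.2 this.not_gt
  have hle : k y ≤ 0 := by
    by_contra! hpos
    have hyq' : y < q := lt_of_le_of_ne hyq (by rintro h; rw [h] at hpos; linarith)
    obtain ⟨η, hη, h⟩ := Metric.mem_nhdsWithin_iff.1 (hc y hyI (lt_mem_nhds hpos))
    have hmin : 0 < min (η / 2) (q - y) := lt_min (by linarith) (by linarith)
    have hmem : y + min (η / 2) (q - y) ∈ S := by
      have h1 := min_le_left (η / 2) (q - y)
      have h2 := min_le_right (η / 2) (q - y)
      refine ⟨⟨by linarith, by linarith⟩, h ⟨?_, ⟨by linarith, by linarith⟩⟩⟩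
      rw [Metric.mem_ball, Real.dist_eq, abs_lt]; constructor <;> linarith
    have := le_csSup hbdd hmem
    linarith
  have hzero : k y = 0 := le_antisymm hle hge
  have hpy' : p < y := lt_of_le_of_ne hpy (by rintro h; rw [h] at hp; linarith)
  have hyq' : y < q := lt_of_le_of_ne hyq (by rintro h; rw [← h] at hq; linarith)
  refine ⟨y, ⟨hpy', hyq'⟩, hzero, fun δ hδ => ?_⟩
  have hne : ∀ᶠ z in 𝓝[≠] y, k z ≠ 0 := by
    rcases (hk y hyI).eventually_eq_zero_or_eventually_ne_zero with h | h
    · have := hk.eqOn_zero_of_preconnected_of_eventuallyEq_zero isPreconnected_Icc hyI h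
        ⟨le_rfl, hpq.le⟩
      exact absurd this hp.ne'
    · exact h
  obtain ⟨η, hη, hne⟩ := Metric.mem_nhdsWithin_iff.1 hne
  obtain ⟨p', hp', h1, h2⟩ := happ δ hδ
  have hp'y : p' < y := lt_of_le_of_ne h2 (by rintro h; have := hp'.2; rw [h] at this; linarith)
  set d := min (min δ η) (q - y) with hd
  have hd0 : 0 < d := lt_min (lt_min hδ hη) (by linarith)
  have hd1 : d ≤ δ := (min_le_left _ _).trans (min_le_left _ _)
  have hd2 : d ≤ η := (min_le_left _ _).trans (min_le_right _ _)
  have hd3 : d ≤ q - y := min_le_right _ _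
  have hq'I : y + d / 2 ∈ Icc p q := ⟨by linarith, by linarith⟩
  refine ⟨p', hp'.1, y + d / 2, hq'I, by rw [abs_lt]; constructor <;> linarith,
    by rw [abs_lt]; constructor <;> linarith, by linarith, ?_⟩
  refine mul_neg_of_pos_of_neg hp'.2 (lt_of_le_of_ne ?_ ?_)
  · by_contra! h
    have := le_csSup hbdd (show y + d / 2 ∈ S from ⟨hq'I, h⟩)
    linarith
  · refine hne ⟨?_, ?_⟩
    · rw [Metric.mem_ball, Real.dist_eq, abs_lt]; constructor <;> linarith
    · simp [hd0.ne']

/-- An analytic function with values of opposite signs at the ends of an interval changes sign at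
one of its zeros. -/
theorem exists_sign_change {k : ℝ → ℝ} {p q : ℝ} (hpq : p < q)
    (hk : AnalyticOnNhd ℝ k (Icc p q)) (h : k p * k q < 0) :
    ∃ y ∈ Ioo p q, k y = 0 ∧ ∀ δ > 0, ∃ p' ∈ Icc p q, ∃ q' ∈ Icc p q,
      |p' - y| < δ ∧ |q' - y| < δ ∧ p' < q' ∧ k p' * k q' < 0 := by
  rcases mul_neg_iff.1 h with ⟨h1, h2⟩ | ⟨h1, h2⟩
  · exact exists_sign_change_pos hpq hk h1 h2
  · have := exists_sign_change_pos (k := -k) hpq hk.neg (by simpa using h1) (by simpa using h2)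
    simpa using this

end SignChange

/-- Independent functions can be interpolated at suitable points. -/
theorem exists_interpolation {n : ℕ} (f : Fin n → ℝ → ℝ) (I : Set ℝ)
    (hf : ∀ c : Fin n → ℝ, (∀ s ∈ I, ∑ i, c i * f i s = 0) → c = 0) :
    ∃ s : Fin n → ℝ, StrictMono s ∧ (∀ j, s j ∈ I) ∧
      ∀ v : Fin n → ℝ, ∃ c : Fin n → ℝ, ∀ j, ∑ i, c i * f i (s j) = v j := by
  classical
  set V : ℝ → Fin n → ℝ := fun s i => f i s with hV
  -- If the vectors `(fᵢ(s))ᵢ` failed to span, a nonzero functional vanishing on all of them would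
  -- be a linear relation between the `fᵢ`. A basis extracted from them provides the interpolation
  -- points.
  have hspan : Submodule.span ℝ (V '' I) = ⊤ := by
    by_contra hne
    obtain ⟨φ, hφ, hle⟩ := Submodule.exists_le_ker_of_lt_top _ (lt_top_iff_ne_top.2 hne)
    apply hφ
    have hval : ∀ w, φ w = ∑ i, φ (Pi.single i 1) * w i := fun w => by
      conv_lhs => rw [← Finset.univ_sum_single w, map_sum]
      refine Finset.sum_congr rfl fun i _ => ?_
      rw [mul_comm, ← smul_eq_mul, ← map_smul, ← Pi.single_smul]; simp
    have hc := hf (fun i => φ (Pi.single i 1)) fun s hs => by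
      rw [← hval (V s)]
      exact hle (Submodule.subset_span ⟨s, hs, rfl⟩)
    ext i
    simpa using congrFun hc i
  obtain ⟨b, hb, hbs, hli⟩ := exists_linearIndependent ℝ (V '' I)
  rw [hspan] at hbs
  have hfin : b.Finite := hli.setFinite
  have := hfin.fintype
  have hcard : b.toFinset.card = n := by
    have := finrank_span_set_eq_card (s := b) hli
    rw [hbs, finrank_top, Module.finrank_fin_fun] at this
    exact this.symm
  choose! pre hpre using fun w (hw : w ∈ b) => hb hw
  set P : Finset ℝ := b.toFinset.image pre with hP
  have hPc : P.card = n := by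
    rw [hP, Finset.card_image_of_injOn, hcard]
    intro w hw w' hw' h
    rw [← (hpre w (by simpa using hw)).2, ← (hpre w' (by simpa using hw')).2, h]
  set e := P.orderEmbOfFin hPc
  refine ⟨e, e.strictMono, fun j => ?_, ?_⟩
  · obtain ⟨w, hw, h⟩ := Finset.mem_image.1 (P.orderEmbOfFin_mem hPc j)
    rw [← h]; exact (hpre w (by simpa using hw)).1
  · let Λ : (Fin n → ℝ) →ₗ[ℝ] (Fin n → ℝ) :=
      { toFun := fun c j => ∑ i, c i * f i (e j)
        map_add' := fun c d => by
          ext j; simp [add_mul, Finset.sum_add_distrib]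
        map_smul' := fun r c => by
          ext j; simp [Finset.mul_sum, mul_assoc] }
    have hinj : Function.Injective Λ := by
      rw [← LinearMap.ker_eq_bot, LinearMap.ker_eq_bot']
      intro c hc
      let ψ : (Fin n → ℝ) →ₗ[ℝ] ℝ := Fintype.linearCombination ℝ c
      have hψ : ∀ w, ψ w = ∑ i, c i * w i := fun w => by
        simp [ψ, Fintype.linearCombination_apply, mul_comm]
      have hker : (⊤ : Submodule ℝ (Fin n → ℝ)) ≤ LinearMap.ker ψ := by
        rw [← hbs, Submodule.span_le]
        intro w hw
        have hmem : pre w ∈ P := Finset.mem_image_of_mem _ (by simpa using hw)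
        have : pre w ∈ range e := by rw [Finset.range_orderEmbOfFin]; exact hmem
        obtain ⟨j, hj⟩ := this
        have h1 := congrFun hc j
        change ψ w = 0
        rw [hψ, ← (hpre w hw).2, ← hj]
        exact h1
      exact hf c fun s _ => by rw [← hψ (V s)]; exact hker trivial
    have hsurj := LinearMap.injective_iff_surjective.1 hinj
    intro v
    obtain ⟨c, hc⟩ := hsurj v
    exact ⟨c, fun j => congrFun hc j⟩

/-! ### The coordinate `W`, the field in it, and the time-reversing symmetry. -/

open Complex (I exp)

/-- The coordinate `W` on the plane punctured at the center, `z = 1 + e⁻ᵂ`. -/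
noncomputable def toPlane (W : ℂ) : ℂ := 1 + exp (-W)

/-- The perturbation of the constant field `i` in the coordinate `W`. -/
noncomputable def drift (a : Fin 4 → ℝ) (W : ℂ) : ℂ :=
  a 0 * exp W + a 1 + a 2 * exp (-W) + a 3 * exp (-(2 * W))

/-- The primitive of `drift a` vanishing at `0`. -/
noncomputable def driftPrim (a : Fin 4 → ℝ) (W : ℂ) : ℂ :=
  a 0 * (exp W - 1) + a 1 * W - a 2 * (exp (-W) - 1) - a 3 / 2 * (exp (-(2 * W)) - 1)

/-- The coefficients of the cubics `-∑ a σ j (z - 1) ^ j`. -/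
noncomputable def perturbation (a : Zone → Fin 4 → ℝ) (σ : Zone) : Fin 4 → ℂ :=
  ![-(a σ 0 - a σ 1 + a σ 2 - a σ 3), -(a σ 1 - 2 * a σ 2 + 3 * a σ 3), -(a σ 2 - 3 * a σ 3),
    -(a σ 3)]

theorem field_perturbation (a : Zone → Fin 4 → ℝ) (ε : ℝ) (σ : Zone) (z : ℂ) :
    field (perturbation a) ε σ z = -I * (z - 1) - ε * (a σ 0 + a σ 1 * (z - 1)
      + a σ 2 * (z - 1) ^ 2 + a σ 3 * (z - 1) ^ 3) := by
  simp only [field, perturbation, Fin.sum_univ_four]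
  simp
  ring

/-- As `z' = -W' e⁻ᵂ`, this is the equation `W' = i + ε drift`. -/
theorem field_toPlane (a : Zone → Fin 4 → ℝ) (ε : ℝ) (σ : Zone) (W : ℂ) :
    field (perturbation a) ε σ (toPlane W) = -(I + ε * drift (a σ) W) * exp (-W) := by
  rw [field_perturbation, toPlane, drift]
  have h1 : exp W * exp (-W) = 1 := by rw [← Complex.exp_add]; simp
  have h2 : exp (-(2 * W)) = exp (-W) ^ 2 := by rw [sq, ← Complex.exp_add]; ring_nf
  rw [h2]
  linear_combination (-ε * a σ 0 : ℂ) * (-h1)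

/-- The reason for restricting to real coefficients in powers of `z - 1`: reflecting the plane and
reversing time turns the system for `ε` into the system for `-ε`. -/
theorem field_conj (a : Zone → Fin 4 → ℝ) (ε : ℝ) (σ : Zone) (z : ℂ) :
    field (perturbation a) (-ε) σ (starRingEnd ℂ z)
      = - starRingEnd ℂ (field (perturbation a) ε σ z) := by
  rw [field_perturbation, field_perturbation]
  simp
  ring

theorem differentiable_drift (a : Fin 4 → ℝ) : Differentiable ℂ (drift a) := by
  unfold drift; fun_prop

theorem hasDerivAt_driftPrim (a : Fin 4 → ℝ) (W : ℂ) :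
    HasDerivAt (driftPrim a) (drift a W) W := by
  unfold driftPrim drift
  have h1 := (Complex.hasDerivAt_exp W).sub_const (1 : ℂ)
  have h2 := ((hasDerivAt_id W).neg.cexp).sub_const (1 : ℂ)
  have h3 := (((hasDerivAt_id W).const_mul (2 : ℂ)).neg.cexp).sub_const (1 : ℂ)
  refine ((((h1.const_mul (a 0 : ℂ)).add ((hasDerivAt_id W).const_mul (a 1 : ℂ))).sub
    (h2.const_mul (a 2 : ℂ))).sub (h3.const_mul (a 3 / 2 : ℂ))).congr_deriv ?_
  simp only [id, Pi.neg_apply]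
  ring

theorem norm_drift_le (a : Fin 4 → ℝ) {R : ℝ} {W : ℂ} (hW : |W.re| ≤ R) :
    ‖drift a W‖ ≤ (∑ j, |a j|) * Real.exp (2 * R) := by
  have hR : 0 ≤ R := (abs_nonneg _).trans hW
  have h := abs_le.1 hW
  have e1 : Real.exp W.re ≤ Real.exp (2 * R) := Real.exp_le_exp.2 (by linarith)
  have e2 : Real.exp (-W.re) ≤ Real.exp (2 * R) := Real.exp_le_exp.2 (by linarith)
  have e3 : Real.exp (-(2 * W.re)) ≤ Real.exp (2 * R) := Real.exp_le_exp.2 (by linarith)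
  have e4 : (1 : ℝ) ≤ Real.exp (2 * R) := Real.one_le_exp (by linarith)
  have n0 : ‖(a 0 : ℂ) * exp W‖ ≤ |a 0| * Real.exp (2 * R) := by
    rw [norm_mul, Complex.norm_exp, Complex.norm_real]; exact mul_le_mul_of_nonneg_left e1 (abs_nonneg _)
  have n1 : ‖(a 1 : ℂ)‖ ≤ |a 1| * Real.exp (2 * R) := by
    rw [Complex.norm_real]; exact le_mul_of_one_le_right (abs_nonneg _) e4
  have n2 : ‖(a 2 : ℂ) * exp (-W)‖ ≤ |a 2| * Real.exp (2 * R) := by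
    rw [norm_mul, Complex.norm_exp, Complex.norm_real]; exact mul_le_mul_of_nonneg_left e2 (abs_nonneg _)
  have n3 : ‖(a 3 : ℂ) * exp (-(2 * W))‖ ≤ |a 3| * Real.exp (2 * R) := by
    rw [norm_mul, Complex.norm_exp, Complex.norm_real]
    refine mul_le_mul_of_nonneg_left ?_ (abs_nonneg _)
    simpa using e3
  rw [Fin.sum_univ_four, drift]
  refine (norm_add_le _ _).trans ?_
  refine (add_le_add_left ((norm_add_le _ _).trans (add_le_add_left (norm_add_le _ _) _)) _).trans ?_
  linarith

theorem closure_region_plus : closure (region .plus) ⊆ {z | ‖z - 2 / 3‖ ≤ 1 / 3} :=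
  closure_minimal (fun z hz => by
    rw [region, mem_ofPred_eq] at hz; exact hz.le)
    (isClosed_le (f := fun z : ℂ => ‖z - 2 / 3‖) (by fun_prop) continuous_const)

theorem closure_region_central :
    closure (region .central) ⊆ {z | 1 / 3 ≤ ‖z - 2 / 3‖ ∧ ‖z‖ ≤ 1} :=
  closure_minimal (fun z hz => by
    rw [region, mem_ofPred_eq] at hz; exact ⟨hz.1.le, hz.2.le⟩)
    ((isClosed_le (g := fun z : ℂ => ‖z - 2 / 3‖) continuous_const (by fun_prop)).inter
      (isClosed_le (f := fun z : ℂ => ‖z‖) (by fun_prop) continuous_const))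

theorem closure_region_minus : closure (region .minus) ⊆ {z | 1 ≤ ‖z‖} :=
  closure_minimal (fun z hz => by
    rw [region, mem_ofPred_eq] at hz; exact hz.le)
    (isClosed_le (g := fun z : ℂ => ‖z‖) continuous_const (by fun_prop))

/-- The internal tangency enters through `‖z‖ ≤ ‖z - 2/3‖ + 2/3`, which keeps the closed small disc
inside the closed unit disc. -/
theorem eq_of_mem_region {σ τ : Zone} {z : ℂ} (h : z ∈ region σ) (h' : z ∈ closure (region τ)) :
    τ = σ := by
  have key : ‖z‖ ≤ ‖z - 2 / 3‖ + 2 / 3 := by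
    have := norm_add_le (z - 2 / 3) (2 / 3 : ℂ)
    rw [sub_add_cancel] at this
    simpa using this
  have cp : z ∈ closure (region .plus) → ‖z - 2 / 3‖ ≤ 1 / 3 := fun h => closure_region_plus h
  have cc : z ∈ closure (region .central) → 1 / 3 ≤ ‖z - 2 / 3‖ ∧ ‖z‖ ≤ 1 :=
    fun h => closure_region_central h
  have cm : z ∈ closure (region .minus) → 1 ≤ ‖z‖ := fun h => closure_region_minus h
  cases σ <;> cases τ <;> try rfl
  · have h1 : ‖z - 2 / 3‖ < 1 / 3 := h
    linarith [(cc h').1]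
  · have h1 : ‖z - 2 / 3‖ < 1 / 3 := h
    linarith [cm h']
  · have h1 : 1 / 3 < ‖z - 2 / 3‖ ∧ ‖z‖ < 1 := h
    linarith [cp h']
  · have h1 : 1 / 3 < ‖z - 2 / 3‖ ∧ ‖z‖ < 1 := h
    linarith [cm h']
  · have h1 : 1 < ‖z‖ := h
    linarith [cp h']
  · have h1 : 1 < ‖z‖ := h
    linarith [(cc h').2]

theorem filippov_of_mem_region {X : Zone → ℂ → ℂ} {σ : Zone} {z : ℂ} (h : z ∈ region σ) :
    filippov X z = {X σ z} := by
  have : {v | ∃ τ, z ∈ closure (region τ) ∧ v = X τ z} = {X σ z} := by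
    ext v
    constructor
    · rintro ⟨τ, hτ, rfl⟩
      rw [eq_of_mem_region h hτ]; rfl
    · rintro rfl
      exact ⟨σ, subset_closure h, rfl⟩
  rw [filippov, this, convexHull_singleton]

theorem region_conj {σ : Zone} {z : ℂ} : starRingEnd ℂ z ∈ region σ ↔ z ∈ region σ := by
  have h1 : ‖starRingEnd ℂ z‖ = ‖z‖ := Complex.norm_conj z
  have h2 : ‖starRingEnd ℂ z - 2 / 3‖ = ‖z - 2 / 3‖ := by
    have h4 : (starRingEnd ℂ) (2 / 3 : ℂ) = 2 / 3 := by
      rw [map_div₀, Complex.conj_ofNat, Complex.conj_ofNat]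
    rw [← Complex.norm_conj (z - 2 / 3), map_sub, h4]
  cases σ <;> simp only [region, mem_ofPred_eq, h1, h2]

theorem closure_region_conj {σ : Zone} {z : ℂ} (h : z ∈ closure (region σ)) :
    starRingEnd ℂ z ∈ closure (region σ) :=
  map_mem_closure Complex.continuous_conj h fun _ hw => region_conj.2 hw

theorem filippov_conj {a : Zone → Fin 4 → ℝ} {ε : ℝ} {z v : ℂ}
    (h : v ∈ filippov (field (perturbation a) ε) z) :
    - starRingEnd ℂ v ∈ filippov (field (perturbation a) (-ε)) (starRingEnd ℂ z) := by
  let Λ : ℂ →ₗ[ℝ] ℂ := -(Complex.conjLIE.toLinearEquiv : ℂ →ₗ[ℝ] ℂ)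
  have hΛ : ∀ v, Λ v = - starRingEnd ℂ v := fun v => rfl
  rw [← hΛ]
  have : filippov (field (perturbation a) ε) z ⊆
      Λ ⁻¹' filippov (field (perturbation a) (-ε)) (starRingEnd ℂ z) := by
    refine convexHull_min ?_ ((convex_convexHull ℝ _).linear_preimage Λ)
    rintro _ ⟨σ, hσ, rfl⟩
    refine subset_convexHull ℝ _ ⟨σ, closure_region_conj hσ, ?_⟩
    rw [field_conj, hΛ]
  exact this h

/-- Filippov's field in the coordinate `W`. -/
def liftedField (a : Zone → Fin 4 → ℝ) (ε : ℝ) (W : ℂ) : Set ℂ :=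
  {ω | -ω * exp (-W) ∈ filippov (field (perturbation a) ε) (toPlane W)}

theorem liftedField_conj {a : Zone → Fin 4 → ℝ} {ε : ℝ} {W ω : ℂ} (h : ω ∈ liftedField a ε W) :
    - starRingEnd ℂ ω ∈ liftedField a (-ε) (starRingEnd ℂ W) := by
  have := filippov_conj h
  rw [liftedField, mem_ofPred_eq]
  have e : starRingEnd ℂ (toPlane W) = toPlane (starRingEnd ℂ W) := by
    simp [toPlane, ← Complex.exp_conj]
  rw [← e]
  convert this using 1
  simp [← Complex.exp_conj]

theorem toPlane_add_two_pi (W : ℂ) (n : ℤ) : toPlane (W + n * (2 * Real.pi * I)) = toPlane W := by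
  have : -(W + n * (2 * Real.pi * I)) = -W + (-n : ℤ) * (2 * Real.pi * I) := by push_cast; ring
  rw [toPlane, toPlane, this, Complex.exp_add, Complex.exp_int_mul_two_pi_mul_I, mul_one]

theorem liftedField_add_two_pi (a : Zone → Fin 4 → ℝ) (ε : ℝ) (W : ℂ) (n : ℤ) :
    liftedField a ε (W + n * (2 * Real.pi * I)) = liftedField a ε W := by
  have h := toPlane_add_two_pi W n
  have h' : exp (-(W + n * (2 * Real.pi * I))) = exp (-W) := by
    simpa [toPlane] using h
  rw [liftedField, liftedField, h, h']

theorem liftedField_of_mem_region {a : Zone → Fin 4 → ℝ} {ε : ℝ} {W : ℂ} {σ : Zone}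
    (h : toPlane W ∈ region σ) : liftedField a ε W = {I + ε * drift (a σ) W} := by
  ext ω
  rw [liftedField, mem_ofPred_eq, filippov_of_mem_region h, field_toPlane, mem_singleton_iff,
    mem_singleton_iff]
  rw [neg_mul, neg_mul, neg_inj, mul_left_inj' (Complex.exp_ne_zero _)]

/-- The velocities of all zones lie in one disc around `i`, and discs are convex; so the bound holds
for every Filippov velocity, also on the switching curves. This is what rules out sliding. -/
theorem norm_sub_le_of_mem_liftedField {a : Zone → Fin 4 → ℝ} {ε δ : ℝ} {W ω : ℂ}
    (hδ : ∀ σ, ‖ε * drift (a σ) W‖ ≤ δ) (h : ω ∈ liftedField a ε W) : ‖ω - I‖ ≤ δ := by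
  let Λ : ℂ →ₗ[ℝ] ℂ := LinearMap.mulRight ℝ (-exp W)
  have : filippov (field (perturbation a) ε) (toPlane W) ⊆ Λ ⁻¹' Metric.closedBall I δ := by
    refine convexHull_min ?_ ((convex_closedBall I δ).linear_preimage Λ)
    rintro _ ⟨σ, -, rfl⟩
    have e : Λ (field (perturbation a) ε σ (toPlane W)) = I + ε * drift (a σ) W := by
      change field (perturbation a) ε σ (toPlane W) * (-exp W) = _
      rw [field_toPlane]
      have h1 : exp (-W) * exp W = 1 := by rw [← Complex.exp_add]; simp
      linear_combination (I + ε * drift (a σ) W) * h1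
    rw [mem_preimage, e, Metric.mem_closedBall, dist_eq_norm, add_sub_cancel_left]
    exact hδ σ
  have := this h
  have e : Λ (-ω * exp (-W)) = ω := by
    change -ω * exp (-W) * (-exp W) = _
    have h1 : exp (-W) * exp W = 1 := by rw [← Complex.exp_add]; simp
    linear_combination ω * h1
  rwa [mem_preimage, e, Metric.mem_closedBall, dist_eq_norm] at this

theorem eventually_norm_mul_drift_le (a : Zone → Fin 4 → ℝ) (R : ℝ) {δ : ℝ} (hδ : 0 < δ) :
    ∀ᶠ ε : ℝ in 𝓝 0, ∀ σ, ∀ W : ℂ, |W.re| ≤ R → ‖ε * drift (a σ) W‖ ≤ δ := by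
  have key : ∀ σ, ∀ᶠ ε : ℝ in 𝓝 0, ∀ W : ℂ, |W.re| ≤ R → ‖ε * drift (a σ) W‖ ≤ δ := by
    intro σ
    have : Tendsto (fun ε : ℝ => |ε| * ((∑ j, |a σ j|) * Real.exp (2 * R))) (𝓝 0)
        (𝓝 (|(0 : ℝ)| * ((∑ j, |a σ j|) * Real.exp (2 * R)))) :=
      Continuous.tendsto (by fun_prop) 0
    rw [abs_zero, zero_mul] at this
    refine (this.eventually (gt_mem_nhds hδ)).mono fun ε hε W hW => ?_
    rw [norm_mul, Complex.norm_real, Real.norm_eq_abs]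
    exact (mul_le_mul_of_nonneg_left (norm_drift_le _ hW) (abs_nonneg _)).trans hε.le
  filter_upwards [key .plus, key .central, key .minus] with ε h1 h2 h3 σ
  cases σ
  exacts [h1, h2, h3]

/-! ### Complex time along the flow of one zone, and its real part as a first integral. -/

/-- `Φ` measures the time along the flow of `i + ε drift a`, up to the factor `i`. -/
def IsTime (a : Fin 4 → ℝ) (R ε : ℝ) (Φ : ℂ → ℂ) : Prop :=
  Φ 0 = 0 ∧ ∀ W ∈ Metric.ball (0 : ℂ) R, HasDerivAt Φ (1 / (1 - I * (ε * drift a W))) W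

/-- The primitive of `1 / (1 - i ε drift a)` on the ball of radius `R` that vanishes at `0`. -/
noncomputable def timeMap (a : Fin 4 → ℝ) (R ε : ℝ) : ℂ → ℂ :=
  Classical.epsilon (IsTime a R ε)

theorem one_sub_ne_zero {q : ℂ} (hq : ‖q‖ ≤ 1 / 8) : 1 - I * q ≠ 0 := by
  intro h
  have : ‖(1 : ℂ)‖ = ‖I * q‖ := by rw [sub_eq_zero.1 h]
  rw [norm_mul, Complex.norm_I, norm_one, one_mul] at this
  linarith

theorem norm_one_sub_ge {q : ℂ} (hq : ‖q‖ ≤ 1 / 8) : 1 / 2 ≤ ‖1 - I * q‖ := by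
  have := norm_sub_norm_le (1 : ℂ) (I * q)
  rw [norm_mul, Complex.norm_I, norm_one, one_mul] at this
  linarith

theorem norm_inv_sub_one_le {q : ℂ} (hq : ‖q‖ ≤ 1 / 8) : ‖1 / (1 - I * q) - 1‖ ≤ 2 * ‖q‖ := by
  have h := one_sub_ne_zero hq
  have e : 1 / (1 - I * q) - 1 = I * q / (1 - I * q) := by field_simp; ring
  have h2 := norm_one_sub_ge hq
  rw [e, norm_div, norm_mul, Complex.norm_I, one_mul, div_le_iff₀ (by linarith)]
  nlinarith [norm_nonneg q]

theorem norm_inv_sub_le {q : ℂ} (hq : ‖q‖ ≤ 1 / 8) :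
    ‖1 / (1 - I * q) - (1 + I * q)‖ ≤ 2 * ‖q‖ ^ 2 := by
  have h := one_sub_ne_zero hq
  have e : 1 / (1 - I * q) - (1 + I * q) = (I * q) ^ 2 / (1 - I * q) := by field_simp; ring
  have h2 := norm_one_sub_ge hq
  rw [e, norm_div, norm_pow, norm_mul, Complex.norm_I, one_mul, div_le_iff₀ (by linarith)]
  nlinarith [norm_nonneg q, sq_nonneg ‖q‖]

theorem isTime_timeMap {a : Fin 4 → ℝ} {R ε : ℝ}
    (h : ∀ W ∈ Metric.ball (0 : ℂ) R, ‖ε * drift a W‖ ≤ 1 / 8) :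
    IsTime a R ε (timeMap a R ε) := by
  apply Classical.epsilon_spec (p := IsTime a R ε)
  have hd : DifferentiableOn ℂ (fun W => 1 / (1 - I * (ε * drift a W))) (Metric.ball 0 R) :=
    fun W hW => by
      have h1 : DifferentiableAt ℂ (fun W => 1 - I * (ε * drift a W)) W :=
        (((differentiable_drift a W).const_mul _).const_mul _).const_sub _
      exact ((differentiableAt_const _).div h1 (one_sub_ne_zero (h W hW))).differentiableWithinAt
  obtain ⟨Φ, hΦ⟩ := hd.isExactOn_ball
  exact ⟨fun W => Φ W - Φ 0, by simp, fun W hW => (hΦ W hW).sub_const _⟩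

theorem re_le_of_mem_ball {W : ℂ} {R : ℝ} (hW : W ∈ Metric.ball (0 : ℂ) R) : |W.re| ≤ R :=
  (Complex.abs_re_le_norm W).trans (by simpa using (Metric.mem_ball.1 hW).le)

/-- `Φ - id` is `1/4`-Lipschitz on the convex ball. -/
theorem IsTime.injOn {a : Fin 4 → ℝ} {R ε : ℝ} {Φ : ℂ → ℂ} (hΦ : IsTime a R ε Φ)
    (h : ∀ W ∈ Metric.ball (0 : ℂ) R, ‖ε * drift a W‖ ≤ 1 / 8) :
    InjOn Φ (Metric.ball 0 R) := by
  intro W hW V hV hWV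
  have := (convex_ball (0 : ℂ) R).norm_image_sub_le_of_norm_hasDerivWithin_le
    (f := fun W => Φ W - W) (f' := fun W => 1 / (1 - I * (ε * drift a W)) - 1) (C := 1 / 4)
    (fun W hW => ((hΦ.2 W hW).sub (hasDerivAt_id W)).hasDerivWithinAt)
    (fun W hW => (norm_inv_sub_one_le (h W hW)).trans (by linarith [h W hW])) hW hV
  rw [hWV, sub_sub_sub_cancel_left, norm_sub_rev W V] at this
  by_contra hne
  have hpos : 0 < ‖V - W‖ := norm_pos_iff.2 (sub_ne_zero.2 (Ne.symm hne))
  linarith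

/-- Integrate `1/(1 - iq) = 1 + iq + O(q²)` with `q = ε drift`, starting from `0`, where both sides
vanish. -/
theorem IsTime.norm_sub_le {a : Fin 4 → ℝ} {R ε D : ℝ} {Φ : ℂ → ℂ} (hΦ : IsTime a R ε Φ)
    (hR : 0 < R) (h : ∀ W ∈ Metric.ball (0 : ℂ) R, ‖ε * drift a W‖ ≤ 1 / 8)
    (hD : ∀ W ∈ Metric.ball (0 : ℂ) R, ‖drift a W‖ ≤ D) {W : ℂ} (hW : W ∈ Metric.ball (0 : ℂ) R) :
    ‖Φ W - W - I * (ε * driftPrim a W)‖ ≤ 2 * D ^ 2 * R * ε ^ 2 := by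
  have h0 : (0 : ℂ) ∈ Metric.ball (0 : ℂ) R := Metric.mem_ball_self hR
  have hD0 : 0 ≤ D := (norm_nonneg _).trans (hD 0 h0)
  have := (convex_ball (0 : ℂ) R).norm_image_sub_le_of_norm_hasDerivWithin_le
    (f := fun W => Φ W - (W + I * (ε * driftPrim a W)))
    (f' := fun W => 1 / (1 - I * (ε * drift a W)) - (1 + I * (ε * drift a W)))
    (C := 2 * D ^ 2 * ε ^ 2)
    (fun W hW => ((hΦ.2 W hW).sub ((hasDerivAt_id W).add
      (((hasDerivAt_driftPrim a W).const_mul _).const_mul _))).hasDerivWithinAt)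
    (fun W hW => (norm_inv_sub_le (h W hW)).trans (by
      rw [norm_mul, Complex.norm_real, mul_pow, Real.norm_eq_abs, sq_abs]
      nlinarith [pow_le_pow_left₀ (norm_nonneg _) (hD W hW) 2, sq_nonneg ε])) h0 hW
  have e : driftPrim a 0 = 0 := by simp [driftPrim]
  rw [hΦ.1, e] at this
  simp only [mul_zero, add_zero, sub_zero] at this
  rw [sub_sub]
  refine this.trans ?_
  have hW' : ‖W‖ ≤ R := by simpa using (Metric.mem_ball.1 hW).le
  nlinarith [mul_le_mul_of_nonneg_left hW' (show 0 ≤ 2 * D ^ 2 * ε ^ 2 by positivity)]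

/-! ### Switching curves and the first integral restricted to them. -/

/-- The graph `Im W = ψ (Re W)` is an analytic `L`-Lipschitz curve in the closed upper half of the
fundamental strip. -/
structure IsCurve (lo hi L : ℝ) (ψ : ℝ → ℝ) : Prop where
  analyticAt : ∀ s ∈ Ioo lo hi, AnalyticAt ℝ ψ s
  lip : ∀ s ∈ Ioo lo hi, ∀ t ∈ Ioo lo hi, |ψ s - ψ t| ≤ L * |s - t|
  nonneg : ∀ s ∈ Ioo lo hi, 0 ≤ ψ s
  le_pi : ∀ s ∈ Ioo lo hi, ψ s ≤ Real.pi

/-- The point with abscissa `s` of the curve `ψ`. -/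
noncomputable def curvePt (ψ : ℝ → ℝ) (s : ℝ) : ℂ := s + ψ s * I

@[simp] theorem curvePt_re (ψ : ℝ → ℝ) (s : ℝ) : (curvePt ψ s).re = s := by simp [curvePt]

@[simp] theorem curvePt_im (ψ : ℝ → ℝ) (s : ℝ) : (curvePt ψ s).im = ψ s := by simp [curvePt]

theorem eq_curvePt {ψ : ℝ → ℝ} {W : ℂ} (h : W.im = ψ W.re) : W = curvePt ψ W.re := by
  apply Complex.ext <;> simp [h]

/-- The first integral of the perturbed flow, on the curve `ψ`. -/
noncomputable def levelMap (a : Fin 4 → ℝ) (R : ℝ) (ψ : ℝ → ℝ) (ε s : ℝ) : ℝ :=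
  (timeMap a R ε (curvePt ψ s)).re

theorem mem_ball_of_strip {lo hi R : ℝ} (hR : |lo| + |hi| + 4 ≤ R) {W : ℂ}
    (h : W.re ∈ Ioo lo hi) (h0 : 0 ≤ W.im) (h1 : W.im ≤ Real.pi) : W ∈ Metric.ball (0 : ℂ) R := by
  rw [Metric.mem_ball, dist_zero_right]
  refine (Complex.norm_le_abs_re_add_abs_im W).trans_lt ?_
  have : |W.re| ≤ |lo| + |hi| := by
    rw [abs_le]
    constructor
    · linarith [h.1, neg_abs_le lo, abs_nonneg hi]
    · linarith [h.2, le_abs_self hi, abs_nonneg lo]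
  rw [abs_of_nonneg h0]
  linarith [Real.pi_lt_four]

/-- The real part of the expansion `Φ = W + iε G + O(ε²)`, where `G` is `driftPrim`, has first order
term `-Im G`. -/
theorem nearId_levelMap {a : Fin 4 → ℝ} {lo hi L R : ℝ} {ψ : ℝ → ℝ} (hL : 0 ≤ L)
    (hψ : IsCurve lo hi L ψ) (hR : |lo| + |hi| + 4 ≤ R) :
    NearId (levelMap a R ψ) (fun s => -(driftPrim a (curvePt ψ s)).im) lo hi := by
  have hR0 : 0 < R := by linarith [abs_nonneg lo, abs_nonneg hi]
  set D := (∑ j, |a j|) * Real.exp (2 * R) with hDdef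
  have hD0 : 0 ≤ D := by positivity
  have hD : ∀ W ∈ Metric.ball (0 : ℂ) R, ‖drift a W‖ ≤ D := fun W hW =>
    norm_drift_le a (re_le_of_mem_ball hW)
  have hball : ∀ s ∈ Ioo lo hi, curvePt ψ s ∈ Metric.ball (0 : ℂ) R := fun s hs =>
    mem_ball_of_strip hR (by simpa using hs) (by simpa using hψ.nonneg s hs)
      (by simpa using hψ.le_pi s hs)
  have hG : ∀ V ∈ Metric.ball (0 : ℂ) R, ∀ W ∈ Metric.ball (0 : ℂ) R,
      ‖driftPrim a W - driftPrim a V‖ ≤ D * ‖W - V‖ := fun V hV W hW =>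
    (convex_ball (0 : ℂ) R).norm_image_sub_le_of_norm_hasDerivWithin_le
      (fun W _ => (hasDerivAt_driftPrim a W).hasDerivWithinAt) hD hV hW
  refine ⟨⟨D * R + D * (1 + L), by positivity, fun s hs => ?_, fun s hs t ht => ?_⟩,
    2 * D ^ 2 * R, by positivity, ?_⟩
  · have h1 := hG 0 (Metric.mem_ball_self hR0) _ (hball s hs)
    have e : driftPrim a 0 = 0 := by simp [driftPrim]
    rw [e, sub_zero, sub_zero] at h1
    rw [abs_neg]
    refine (Complex.abs_im_le_norm _).trans (h1.trans ?_)
    have h2 : ‖curvePt ψ s‖ ≤ R := by simpa using (Metric.mem_ball.1 (hball s hs)).le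
    nlinarith [mul_le_mul_of_nonneg_left h2 hD0]
  · have h1 := hG _ (hball t ht) _ (hball s hs)
    have e : -(driftPrim a (curvePt ψ s)).im - -(driftPrim a (curvePt ψ t)).im
        = -(driftPrim a (curvePt ψ s) - driftPrim a (curvePt ψ t)).im := by
      rw [Complex.sub_im]; ring
    rw [e, abs_neg]
    refine (Complex.abs_im_le_norm _).trans (h1.trans ?_)
    have h2 : ‖curvePt ψ s - curvePt ψ t‖ ≤ (1 + L) * |s - t| := by
      refine (Complex.norm_le_abs_re_add_abs_im _).trans ?_
      rw [Complex.sub_re, Complex.sub_im, curvePt_re, curvePt_re, curvePt_im, curvePt_im]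
      linarith [hψ.lip s hs t ht]
    have h3 := mul_le_mul_of_nonneg_left h2 hD0
    have h4 : 0 ≤ D * R * |s - t| := by positivity
    linarith
  -- With `d = Φ'` within `2δ` of `1` and `|ψ'| ≤ L`, the derivative `Re d - ψ' Im d` is at least `1
  -- - 2δ(1 + L) = 3/4`.
  · set δ : ℝ := 1 / (8 * (1 + L)) with hδ
    have hδ0 : 0 < δ := by positivity
    have hδ1 : δ ≤ 1 / 8 := by
      rw [hδ]; apply one_div_le_one_div_of_le <;> linarith
    have hδL : δ * (1 + L) = 1 / 8 := by rw [hδ]; field_simp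
    filter_upwards [eventually_norm_mul_drift_le (fun _ => a) R hδ0] with ε hε s hs
    have hε' : ∀ W ∈ Metric.ball (0 : ℂ) R, ‖ε * drift a W‖ ≤ δ := fun W hW =>
      hε .plus W (re_le_of_mem_ball hW)
    have hε8 : ∀ W ∈ Metric.ball (0 : ℂ) R, ‖ε * drift a W‖ ≤ 1 / 8 := fun W hW =>
      (hε' W hW).trans hδ1
    have hT := isTime_timeMap hε8
    have hψd := (hψ.analyticAt s hs).differentiableAt.hasDerivAt
    have hψL : |deriv ψ s| ≤ L := by
      rw [← Real.norm_eq_abs]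
      refine hψd.le_of_lip' hL ?_
      filter_upwards [Ioo_mem_nhds hs.1 hs.2] with t ht
      simpa using hψ.lip t ht s hs
    have hcd : HasDerivAt (curvePt ψ) (1 + deriv ψ s * I) s :=
      (hasDerivAt_id s).ofReal_comp.add (hψd.ofReal_comp.mul_const I)
    have hca : AnalyticAt ℝ (curvePt ψ) s :=
      (Complex.ofRealCLM.analyticAt s).add
        (((Complex.ofRealCLM.analyticAt _).comp (hψ.analyticAt s hs)).mul analyticAt_const)
    have hΦa : AnalyticAt ℝ (timeMap a R ε) (curvePt ψ s) := by
      have : DifferentiableOn ℂ (timeMap a R ε) (Metric.ball 0 R) := fun W hW =>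
        (hT.2 W hW).differentiableAt.differentiableWithinAt
      exact (this.analyticAt (Metric.isOpen_ball.mem_nhds (hball s hs))).restrictScalars
    refine ⟨?_, ?_, ?_⟩
    · have h1 := hT.norm_sub_le hR0 hε8 hD (hball s hs)
      refine le_trans ?_ h1
      refine le_trans (le_of_eq ?_) (Complex.abs_re_le_norm _)
      congr 1
      simp [levelMap]
    · exact (Complex.reCLM.analyticAt _).comp (hΦa.comp hca)
    · set d := 1 / (1 - I * (ε * drift a (curvePt ψ s))) with hd
      have h1 : HasDerivAt (levelMap a R ψ ε) (d * (1 + deriv ψ s * I)).re s := by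
        have h2 := (hT.2 _ (hball s hs)).comp_of_eq s hcd rfl
        have h3 := Complex.reCLM.hasFDerivAt.comp_hasDerivAt s h2
        exact h3
      rw [h1.deriv]
      have h4 : ‖d - 1‖ ≤ 2 * δ :=
        (norm_inv_sub_one_le (hε8 _ (hball s hs))).trans (by linarith [hε' _ (hball s hs)])
      have h5 := (abs_le.1 ((Complex.abs_re_le_norm (d - 1)).trans h4)).1
      have h6 := (Complex.abs_im_le_norm (d - 1)).trans h4
      simp only [Complex.sub_re, Complex.one_re, Complex.sub_im, Complex.one_im, sub_zero] at h5 h6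
      have h7 : |deriv ψ s * d.im| ≤ L * (2 * δ) := by
        rw [abs_mul]; exact mul_le_mul hψL h6 (abs_nonneg _) hL
      have h8 := (abs_le.1 h7).2
      have e : (d * (1 + deriv ψ s * I)).re = d.re - deriv ψ s * d.im := by
        simp; ring
      rw [e]
      nlinarith

/-! ### Filippov solutions in the coordinate `W` and their passage through a sector. -/

/-- `W` is a solution on `[t₀, t₁]` of the differential inclusion `W' ∈ liftedField a ε W`, with
derivative `ω`. -/
def IsLift (a : Zone → Fin 4 → ℝ) (ε : ℝ) (W ω : ℝ → ℂ) (t₀ t₁ : ℝ) : Prop :=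
  IntervalIntegrable ω volume t₀ t₁ ∧ (∀ᵐ t, t ∈ Ioc t₀ t₁ → ω t ∈ liftedField a ε (W t)) ∧
    ∀ t ∈ Icc t₀ t₁, W t = W t₀ + ∫ s in t₀..t, ω s

theorem IsLift.mono {a : Zone → Fin 4 → ℝ} {ε : ℝ} {W ω : ℝ → ℂ} {t₀ t₁ s₀ s₁ : ℝ}
    (h : IsLift a ε W ω t₀ t₁) (h0 : t₀ ≤ s₀) (h01 : s₀ ≤ s₁) (h1 : s₁ ≤ t₁) :
    IsLift a ε W ω s₀ s₁ := by
  have hm : ∀ t ∈ Icc s₀ s₁, t ∈ Icc t₀ t₁ := fun t ht => ⟨h0.trans ht.1, ht.2.trans h1⟩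
  refine ⟨(sub_eq_integral_of_primitive h.1 h.2.2 (hm s₀ ⟨le_rfl, h01⟩) (hm s₁ ⟨h01, le_rfl⟩)).1,
    ?_, fun t ht => ?_⟩
  · filter_upwards [h.2.1] with t h ht
    exact h ⟨h0.trans_lt ht.1, ht.2.trans h1⟩
  · have := (sub_eq_integral_of_primitive h.1 h.2.2 (hm s₀ ⟨le_rfl, h01⟩) (hm t ht)).2
    rw [← this]; ring

theorem IsLift.norm_sub_le {a : Zone → Fin 4 → ℝ} {ε δ lo hi : ℝ} {W ω : ℝ → ℂ} {t₀ t₁ : ℝ}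
    (h : IsLift a ε W ω t₀ t₁) (hδ : ∀ σ, ∀ V : ℂ, V.re ∈ Ioo lo hi → ‖ε * drift (a σ) V‖ ≤ δ)
    (hs : ∀ t ∈ Icc t₀ t₁, (W t).re ∈ Ioo lo hi) {s t : ℝ} (h0 : t₀ ≤ s) (hst : s ≤ t)
    (h1 : t ≤ t₁) : ‖W t - W s - (t - s : ℝ) * I‖ ≤ δ * (t - s) := by
  have := norm_sub_le_of_primitive (u := fun t => W t - (t : ℂ) * I) (ω := fun t => ω t - I)
    (a := t₀) (b := t₁) (K := δ)
    (h.1.sub intervalIntegrable_const) (by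
      filter_upwards [h.2.1] with t h ht
      exact norm_sub_le_of_mem_liftedField (fun σ => hδ σ _ (hs t (Ioc_subset_Icc_self ht))) (h ht))
    (fun t ht => by
      have hi := (sub_eq_integral_of_primitive h.1 h.2.2 ⟨le_rfl, ht.1.trans ht.2⟩ ht).1
      rw [intervalIntegral.integral_sub hi intervalIntegrable_const,
        intervalIntegral.integral_const, h.2.2 t ht]
      simp; ring)
    (s := s) (t := t) ⟨h0, hst.trans h1⟩ ⟨h0.trans hst, h1⟩
  rw [abs_of_nonneg (by linarith)] at this
  refine le_trans (le_of_eq ?_) this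
  congr 1
  push_cast; ring

theorem IsLift.continuousOn {a : Zone → Fin 4 → ℝ} {ε : ℝ} {W ω : ℝ → ℂ} {t₀ t₁ : ℝ}
    (h : IsLift a ε W ω t₀ t₁) : ContinuousOn W (Icc t₀ t₁) := by
  rcases lt_or_ge t₁ t₀ with hlt | hle
  · rw [Icc_eq_empty (not_le.2 hlt)]; exact continuousOn_empty _
  · have : ContinuousOn (fun t => W t₀ + ∫ s in t₀..t, ω s) (Icc t₀ t₁) := by
      refine continuousOn_const.add ?_
      have hi : IntegrableOn ω (uIcc t₀ t₁) := (intervalIntegrable_iff' (by simp)).1 h.1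
      have := intervalIntegral.continuousOn_primitive_interval hi
      rwa [uIcc_of_le hle] at this
    exact this.congr h.2.2

/-- Along a solution the height over a Lipschitz curve increases. -/
theorem IsLift.gap {a : Zone → Fin 4 → ℝ} {ε δ lo hi L : ℝ} {W ω : ℝ → ℂ} {t₀ t₁ : ℝ}
    {ψ : ℝ → ℝ} (hψ : IsCurve lo hi L ψ) (hL : 0 ≤ L) (hLδ : (1 + L) * δ ≤ 1 / 2)
    (h : IsLift a ε W ω t₀ t₁) (hδ : ∀ σ, ∀ V : ℂ, V.re ∈ Ioo lo hi → ‖ε * drift (a σ) V‖ ≤ δ)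
    (hs : ∀ t ∈ Icc t₀ t₁, (W t).re ∈ Ioo lo hi) {s t : ℝ} (h0 : t₀ ≤ s) (hst : s ≤ t)
    (h1 : t ≤ t₁) :
    (W s).im - ψ (W s).re + (t - s) / 2 ≤ (W t).im - ψ (W t).re := by
  have hn := h.norm_sub_le hδ hs h0 hst h1
  have hre := (Complex.abs_re_le_norm _).trans hn
  have him := (abs_le.1 ((Complex.abs_im_le_norm _).trans hn)).1
  simp only [Complex.sub_re, Complex.sub_im, Complex.mul_re, Complex.mul_im, Complex.ofReal_re,
    Complex.ofReal_im, Complex.I_re, Complex.I_im, mul_zero, mul_one, sub_zero,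
    add_zero] at hre him
  -- The solution rises at rate at least `1 - δ` and the curve below it at rate at most `Lδ`, so the
  -- gap grows at rate at least `1 - (1 + L)δ ≥ 1/2`.
  have hl := (abs_le.1 (hψ.lip _ (hs t ⟨h0.trans hst, h1⟩) _ (hs s ⟨h0, hst.trans h1⟩))).2
  have := mul_le_mul_of_nonneg_left hre hL
  nlinarith

/-- A sector of the upper half strip, between the curves `ψ₀` and `ψ₁`, on which the field is
given by the coefficients `b`. -/
structure Sector (a : Zone → Fin 4 → ℝ) (lo hi L : ℝ) (b : Fin 4 → ℝ) (ψ₀ ψ₁ : ℝ → ℝ) :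
    Prop where
  curve₀ : IsCurve lo hi L ψ₀
  curve₁ : IsCurve lo hi L ψ₁
  lt : ∀ s ∈ Ioo lo hi, ψ₀ s < ψ₁ s
  exists_zone : ∃ σ, a σ = b
  zone : ∀ W : ℂ, W.re ∈ Ioo lo hi → ψ₀ W.re < W.im → W.im < ψ₁ W.re →
    ∃ σ, a σ = b ∧ toPlane W ∈ region σ

/-- The orbit arc of the field `i + ε drift b` between two of its points. -/
def arcSet (b : Fin 4 → ℝ) (R ε : ℝ) (p q : ℂ) : Set ℂ :=
  {W | W ∈ Metric.ball (0 : ℂ) R ∧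
    timeMap b R ε W ∈ segment ℝ (timeMap b R ε p) (timeMap b R ε q)}

/-- The parameters used throughout: `ε` is so small that the perturbation is at most `δ`. -/
structure Small (a : Zone → Fin 4 → ℝ) (lo hi L R δ ε : ℝ) : Prop where
  L_nonneg : 0 ≤ L
  R_large : |lo| + |hi| + 30 ≤ R
  δ_le : δ ≤ 1 / 8
  lip_le : (1 + L) * δ ≤ 1 / 2
  bound : ∀ σ, ∀ W : ℂ, |W.re| ≤ R → ‖ε * drift (a σ) W‖ ≤ δ

theorem Small.strip {a : Zone → Fin 4 → ℝ} {lo hi L R δ ε : ℝ} (h : Small a lo hi L R δ ε) :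
    ∀ σ, ∀ V : ℂ, V.re ∈ Ioo lo hi → ‖ε * drift (a σ) V‖ ≤ δ := fun σ V hV =>
  h.bound σ V (by
    have := h.R_large
    rw [abs_le]
    constructor
    · linarith [hV.1, neg_abs_le lo, abs_nonneg hi]
    · linarith [hV.2, le_abs_self hi, abs_nonneg lo])

theorem Small.ball {a : Zone → Fin 4 → ℝ} {lo hi L R δ ε : ℝ} (h : Small a lo hi L R δ ε)
    (σ : Zone) : ∀ W ∈ Metric.ball (0 : ℂ) R, ‖ε * drift (a σ) W‖ ≤ 1 / 8 := fun W hW =>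
  (h.bound σ W (re_le_of_mem_ball hW)).trans h.δ_le

theorem Small.isTime {a : Zone → Fin 4 → ℝ} {lo hi L R δ ε : ℝ} (h : Small a lo hi L R δ ε)
    (σ : Zone) : IsTime (a σ) R ε (timeMap (a σ) R ε) :=
  isTime_timeMap (h.ball σ)

/-- The heights over both boundary curves increase strictly, so between entry and exit the solution
is in the open sector, where the field is single valued. There `Φ` has derivative `i` along the
solution, by the chain rule. -/
theorem Sector.timeMap_eq {a : Zone → Fin 4 → ℝ} {lo hi L R δ ε : ℝ} {b : Fin 4 → ℝ}
    {ψ₀ ψ₁ : ℝ → ℝ} (S : Sector a lo hi L b ψ₀ ψ₁) (hε : Small a lo hi L R δ ε)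
    {W ω : ℝ → ℂ} {t₀ t₁ : ℝ} (h : IsLift a ε W ω t₀ t₁) (h01 : t₀ ≤ t₁)
    (hs : ∀ t ∈ Icc t₀ t₁, (W t).re ∈ Ioo lo hi) (h0 : (W t₀).im = ψ₀ (W t₀).re)
    (h1 : (W t₁).im = ψ₁ (W t₁).re) :
    (∀ t ∈ Icc t₀ t₁, W t ∈ Metric.ball (0 : ℂ) R) ∧
    ∀ t ∈ Icc t₀ t₁, timeMap b R ε (W t) = timeMap b R ε (W t₀) + (t - t₀ : ℝ) * I := by
  have g0 := fun t (ht : t ∈ Icc t₀ t₁) =>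
    h.gap S.curve₀ hε.L_nonneg hε.lip_le hε.strip hs le_rfl ht.1 ht.2
  have g1 := fun t (ht : t ∈ Icc t₀ t₁) =>
    h.gap S.curve₁ hε.L_nonneg hε.lip_le hε.strip hs ht.1 ht.2 le_rfl
  have hball : ∀ t ∈ Icc t₀ t₁, W t ∈ Metric.ball (0 : ℂ) R := fun t ht => by
    refine mem_ball_of_strip (by linarith [hε.R_large]) (hs t ht) ?_ ?_
    · linarith [g0 t ht, S.curve₀.nonneg _ (hs t ht), ht.1]
    · linarith [g1 t ht, S.curve₁.le_pi _ (hs t ht), ht.2]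
  refine ⟨hball, ?_⟩
  obtain ⟨σ₀, hσ₀⟩ := S.exists_zone
  have hT := hε.isTime σ₀
  have hB := hε.ball σ₀
  rw [hσ₀] at hT hB
  have hne1 : ∀ᵐ t : ℝ, t ≠ t₁ := by simp [ae_iff]
  have hω : ∀ᵐ t, t ∈ Ioc t₀ t₁ → ω t = I + ε * drift b (W t) := by
    filter_upwards [h.2.1, hne1] with t h2 h3 ht
    have ht' := Ioc_subset_Icc_self ht
    have h4 : t < t₁ := lt_of_le_of_ne ht.2 h3
    obtain ⟨σ, rfl, hσ⟩ := S.zone (W t) (hs t ht') (by linarith [g0 t ht', ht.1])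
      (by linarith [g1 t ht'])
    have := h2 ht
    rw [liftedField_of_mem_region hσ] at this
    exact this
  have hcont : ContinuousOn (fun t => 1 / (1 - I * (ε * drift b (W t)))) (Icc t₀ t₁) := by
    refine ContinuousOn.div continuousOn_const ?_ fun t ht => one_sub_ne_zero (hB _ (hball t ht))
    exact continuousOn_const.sub (continuousOn_const.mul (continuousOn_const.mul
      ((differentiable_drift b).continuous.comp_continuousOn h.continuousOn)))
  have := (comp_eq_add_integral_of_hasDerivAt (f := timeMap b R ε)
    (f' := fun W => 1 / (1 - I * (ε * drift b W))) (K := 2) h01 h.1 (by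
      filter_upwards [hω] with t h2 ht
      rw [h2 ht]
      refine (norm_add_le _ _).trans ?_
      rw [Complex.norm_I]
      linarith [hB _ (hball t (Ioc_subset_Icc_self ht))]) h.2.2
    (fun t ht => hT.2 _ (hball t ht)) hcont).2
  intro t ht
  rw [this t ht]
  congr 1
  have : ∫ s in t₀..t, 1 / (1 - I * (ε * drift b (W s))) * ω s = ∫ s in t₀..t, I := by
    apply intervalIntegral.integral_congr_ae
    filter_upwards [hω] with r hr hr'
    rw [uIoc_of_le ht.1] at hr'
    have hr'' : r ∈ Ioc t₀ t₁ := ⟨hr'.1, hr'.2.trans ht.2⟩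
    rw [hr hr'']
    have hne := one_sub_ne_zero (hB _ (hball r (Ioc_subset_Icc_self hr'')))
    rw [one_div, inv_mul_eq_iff_eq_mul₀ hne]
    linear_combination (ε * drift b (W r)) * Complex.I_sq
  rw [this, intervalIntegral.integral_const]
  simp

/-- Along the passage `Φ` runs through a vertical segment. Equality of real parts is the level
equation, and injectivity of `Φ` recovers the arc from its end points alone. -/
theorem Sector.arc {a : Zone → Fin 4 → ℝ} {lo hi L R δ ε : ℝ} {b : Fin 4 → ℝ}
    {ψ₀ ψ₁ : ℝ → ℝ} (S : Sector a lo hi L b ψ₀ ψ₁) (hε : Small a lo hi L R δ ε)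
    {W ω : ℝ → ℂ} {t₀ t₁ : ℝ} (h : IsLift a ε W ω t₀ t₁) (h01 : t₀ ≤ t₁)
    (hs : ∀ t ∈ Icc t₀ t₁, (W t).re ∈ Ioo lo hi) (h0 : (W t₀).im = ψ₀ (W t₀).re)
    (h1 : (W t₁).im = ψ₁ (W t₁).re) :
    levelMap b R ψ₁ ε (W t₁).re = levelMap b R ψ₀ ε (W t₀).re ∧
      W '' Icc t₀ t₁ = arcSet b R ε (W t₀) (W t₁) := by
  obtain ⟨hball, ht⟩ := S.timeMap_eq hε h h01 hs h0 h1
  have hlast := ht t₁ ⟨h01, le_rfl⟩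
  refine ⟨?_, ?_⟩
  · rw [levelMap, levelMap, ← eq_curvePt h0, ← eq_curvePt h1, hlast]
    simp
  · obtain ⟨σ₀, hσ₀⟩ := S.exists_zone
    have hT := hε.isTime σ₀
    have hB := hε.ball σ₀
    rw [hσ₀] at hT hB
    ext V
    constructor
    · rintro ⟨t, htI, rfl⟩
      refine ⟨hball t htI, ?_⟩
      rw [ht t htI, hlast, segment_eq_image']
      rcases h01.eq_or_lt with rfl | hlt
      · refine ⟨0, by simp, ?_⟩
        have : t = t₀ := le_antisymm htI.2 htI.1
        simp [this]
      · refine ⟨(t - t₀) / (t₁ - t₀), ⟨div_nonneg (by linarith [htI.1]) (by linarith),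
          (div_le_one (by linarith)).2 (by linarith [htI.2])⟩, ?_⟩
        have : (t₁ - t₀ : ℂ) ≠ 0 := by exact_mod_cast (sub_pos.2 hlt).ne'
        simp only [add_sub_cancel_left, Complex.real_smul]
        push_cast
        field_simp
    · rintro ⟨hV, hseg⟩
      rw [hlast, segment_eq_image'] at hseg
      obtain ⟨θ, hθ, hθ'⟩ := hseg
      have hm : t₀ + θ * (t₁ - t₀) ∈ Icc t₀ t₁ :=
        ⟨by nlinarith [mul_nonneg hθ.1 (sub_nonneg.2 h01)],
          by nlinarith [mul_nonneg (sub_nonneg.2 hθ.2) (sub_nonneg.2 h01)]⟩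
      refine ⟨_, hm, hT.injOn hB (hball _ hm) hV ?_⟩
      rw [ht _ hm, ← hθ']
      simp only [add_sub_cancel_left, Complex.real_smul]
      push_cast; ring

/-! ### Operations on lifted solutions, and existence of passages. -/

section Paths

variable {a : Zone → Fin 4 → ℝ} {ε : ℝ}

theorem IsLift.congr {W W' ω ω' : ℝ → ℂ} {t₀ t₁ : ℝ} (h : IsLift a ε W ω t₀ t₁) (h01 : t₀ ≤ t₁)
    (hW : ∀ t ∈ Icc t₀ t₁, W' t = W t) (hω : ∀ t ∈ Ioc t₀ t₁, ω' t = ω t) :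
    IsLift a ε W' ω' t₀ t₁ := by
  refine ⟨h.1.congr fun t ht => ?_, ?_, fun t ht => ?_⟩
  · rw [uIoc_of_le h01] at ht; exact (hω t ht).symm
  · filter_upwards [h.2.1] with t h ht
    rw [hω t ht, hW t (Ioc_subset_Icc_self ht)]; exact h ht
  · rw [hW t ht, hW t₀ ⟨le_rfl, h01⟩, h.2.2 t ht]
    congr 1
    refine intervalIntegral.integral_congr_ae (Eventually.of_forall fun s hs => ?_)
    rw [uIoc_of_le ht.1] at hs
    exact (hω s ⟨hs.1, hs.2.trans ht.2⟩).symm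

theorem IsLift.append {W ω : ℝ → ℂ} {t₀ t₁ t₂ : ℝ} (h : IsLift a ε W ω t₀ t₁)
    (h' : IsLift a ε W ω t₁ t₂) (h01 : t₀ ≤ t₁) (h12 : t₁ ≤ t₂) : IsLift a ε W ω t₀ t₂ := by
  refine ⟨h.1.trans h'.1, ?_, fun t ht => ?_⟩
  · filter_upwards [h.2.1, h'.2.1] with t h h' ht
    rcases le_or_gt t t₁ with hle | hlt
    · exact h ⟨ht.1, hle⟩
    · exact h' ⟨hlt, ht.2⟩
  · rcases le_or_gt t t₁ with hle | hlt
    · exact h.2.2 t ⟨ht.1, hle⟩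
    · have hm : t ∈ Icc t₁ t₂ := ⟨hlt.le, ht.2⟩
      have hi := (sub_eq_integral_of_primitive h'.1 h'.2.2 ⟨le_rfl, h12⟩ hm).1
      rw [← intervalIntegral.integral_add_adjacent_intervals h.1 hi, h'.2.2 t hm,
        h.2.2 t₁ ⟨h01, le_rfl⟩, add_assoc]

theorem IsLift.shift {W ω : ℝ → ℂ} {t₀ t₁ : ℝ} (h : IsLift a ε W ω t₀ t₁) (c : ℝ) :
    IsLift a ε (fun t => W (t + c)) (fun t => ω (t + c)) (t₀ - c) (t₁ - c) := by
  refine ⟨by simpa using h.1.comp_add_right c, ?_, fun t ht => ?_⟩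
  · have hq := (measurePreserving_add_right volume c).quasiMeasurePreserving.ae h.2.1
    filter_upwards [hq] with t h2 ht
    exact h2 ⟨by linarith [ht.1], by linarith [ht.2]⟩
  · have := h.2.2 (t + c) ⟨by linarith [ht.1], by linarith [ht.2]⟩
    rw [intervalIntegral.integral_comp_add_right (f := ω)]
    simpa using this

theorem IsLift.add_two_pi {W ω : ℝ → ℂ} {t₀ t₁ : ℝ} (h : IsLift a ε W ω t₀ t₁) (n : ℤ) :
    IsLift a ε (fun t => W t + n * (2 * Real.pi * I)) ω t₀ t₁ := by
  refine ⟨h.1, ?_, fun t ht => ?_⟩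
  · filter_upwards [h.2.1] with t h ht
    rw [liftedField_add_two_pi]; exact h ht
  · simp only [h.2.2 t ht]; ring

/-- The time-reversing symmetry. -/
theorem IsLift.conj {W ω : ℝ → ℂ} {t₀ t₁ : ℝ} (h : IsLift a ε W ω t₀ t₁) (h01 : t₀ ≤ t₁) :
    IsLift a (-ε) (fun t => starRingEnd ℂ (W (-t))) (fun t => - starRingEnd ℂ (ω (-t)))
      (-t₁) (-t₀) := by
  have hint : IntervalIntegrable (fun t => - starRingEnd ℂ (ω (-t))) volume (-t₁) (-t₀) := by
    have h1 : IntervalIntegrable (fun t => ω (-t)) volume (-t₁) (-t₀) := by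
      have := h.1.comp_mul_left (c := -1)
      simpa [neg_mul, div_neg] using this.symm
    exact IntervalIntegrable.neg ⟨Complex.conjCLE.toContinuousLinearMap.integrable_comp h1.1,
      Complex.conjCLE.toContinuousLinearMap.integrable_comp h1.2⟩
  refine ⟨hint, ?_, fun t ht => ?_⟩
  · have hq := (Measure.measurePreserving_neg (volume : Measure ℝ)).quasiMeasurePreserving.ae h.2.1
    have hne1 : ∀ᵐ t : ℝ, t ≠ -t₀ := by simp [ae_iff]
    filter_upwards [hq, hne1] with t h2 h3 ht
    exact liftedField_conj (h2 ⟨by linarith [lt_of_le_of_ne ht.2 h3], by linarith [ht.1]⟩)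
  · have ht' : -t ∈ Icc t₀ t₁ := ⟨by linarith [ht.2], by linarith [ht.1]⟩
    have hs := (sub_eq_integral_of_primitive h.1 h.2.2 ht' ⟨h01, le_rfl⟩).2
    have e : ∫ s in (-t₁)..t, - starRingEnd ℂ (ω (-s)) = - starRingEnd ℂ (∫ s in (-t)..t₁, ω s) := by
      rw [intervalIntegral.integral_neg, intervalIntegral.integral_comp_neg
        (f := fun s => starRingEnd ℂ (ω s)), neg_neg]
      congr 1
      exact Complex.conjCLE.toContinuousLinearMap.intervalIntegral_comp_comm
        (sub_eq_integral_of_primitive h.1 h.2.2 ht' ⟨h01, le_rfl⟩).1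
    rw [e, ← hs]
    simp

/-- There is a solution from `p` to `q` that stays in the strip `lo < Re W < hi`. -/
def Reach (a : Zone → Fin 4 → ℝ) (ε lo hi : ℝ) (p q : ℂ) : Prop :=
  ∃ τ : ℝ, 0 ≤ τ ∧ ∃ W ω : ℝ → ℂ, IsLift a ε W ω 0 τ ∧ W 0 = p ∧ W τ = q ∧
    ∀ t ∈ Icc 0 τ, (W t).re ∈ Ioo lo hi

theorem Reach.trans {lo hi : ℝ} {p q r : ℂ} (h : Reach a ε lo hi p q)
    (h' : Reach a ε lo hi q r) : Reach a ε lo hi p r := by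
  obtain ⟨τ, hτ, W, ω, hW, h0, h1, hs⟩ := h
  obtain ⟨τ', hτ', W', ω', hW', h0', h1', hs'⟩ := h'
  have hW'' := hW'.shift (-τ)
  rw [zero_sub, neg_neg, sub_neg_eq_add] at hW''
  have e : ∀ t ∈ Icc τ (τ' + τ),
      (if t ≤ τ then W t else W' (t + -τ)) = W' (t + -τ) := fun t ht => by
    split_ifs with hle
    · have : t = τ := le_antisymm hle ht.1
      rw [this, h1, add_neg_cancel, h0']
    · rfl
  refine ⟨τ' + τ, by linarith, fun t => if t ≤ τ then W t else W' (t + -τ),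
    fun t => if t ≤ τ then ω t else ω' (t + -τ), IsLift.append (t₁ := τ)
      (hW.congr hτ (fun t ht => if_pos ht.2) (fun t ht => if_pos ht.2))
      (hW''.congr (by linarith) e (fun t ht => if_neg (not_le.2 ht.1)))
      hτ (by linarith), ?_, ?_, fun t ht => ?_⟩
  · simp [hτ, h0]
  · refine (e _ ⟨by linarith, le_rfl⟩).trans ?_
    rw [add_neg_cancel_right, h1']
  · rcases le_or_gt t τ with hle | hlt
    · simp only [if_pos hle]; exact hs t ⟨ht.1, hle⟩
    · simp only [if_neg (not_le.2 hlt)]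
      exact hs' _ ⟨by linarith, by linarith [ht.2]⟩

theorem Reach.conj {lo hi : ℝ} {p q : ℂ} (h : Reach a ε lo hi p q) :
    Reach a (-ε) lo hi (starRingEnd ℂ q) (starRingEnd ℂ p) := by
  obtain ⟨τ, hτ, W, ω, hW, h0, h1, hs⟩ := h
  have h2 := (hW.conj hτ).shift (-τ)
  rw [sub_neg_eq_add, neg_add_cancel, sub_neg_eq_add, neg_zero, zero_add] at h2
  refine ⟨τ, hτ, _, _, h2, ?_, ?_, fun t ht => ?_⟩
  · simp [h1]
  · simp [h0]
  · simpa using hs (-(t + -τ)) ⟨by linarith [ht.2], by linarith [ht.1]⟩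

/-- Inside a sector, the flow takes a point of the lower curve to the point of the upper curve on
the same level. -/
theorem Sector.reach {lo hi L R δ η : ℝ} {b : Fin 4 → ℝ}
    {ψ₀ ψ₁ : ℝ → ℝ} (S : Sector a lo hi L b ψ₀ ψ₁) (hε : Small a lo hi L R δ ε) (hδ0 : 0 ≤ δ)
    (hδ : 8 * δ < η) {s₀ s₁ : ℝ} (h0 : s₀ ∈ Ioo (lo + η) (hi - η)) (h1 : s₁ ∈ Ioo lo hi)
    (hinj : InjOn (levelMap b R ψ₁ ε) (Ioo lo hi))
    (hlev : levelMap b R ψ₁ ε s₁ = levelMap b R ψ₀ ε s₀) :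
    Reach a ε lo hi (curvePt ψ₀ s₀) (curvePt ψ₁ s₁) := by
  have hη : 0 < η := by linarith
  have h0' : s₀ ∈ Ioo lo hi := ⟨by linarith [h0.1], by linarith [h0.2]⟩
  set p := curvePt ψ₀ s₀ with hp
  have hpn : ‖p‖ ≤ |lo| + |hi| + 4 := by
    have := mem_ball_of_strip (le_refl (|lo| + |hi| + 4)) (W := p) (by simpa [hp] using h0')
      (by simpa [hp] using S.curve₀.nonneg s₀ h0') (by simpa [hp] using S.curve₀.le_pi s₀ h0')
    simpa using (Metric.mem_ball.1 this).le
  -- `‖p‖ + 20 ≤ |lo| + |hi| + 24 < R`; this is the source of the `30` in `R_large`.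
  have hsub : ∀ W ∈ Metric.closedBall p 20, W ∈ Metric.ball (0 : ℂ) R := fun W hW => by
    rw [Metric.mem_closedBall, dist_eq_norm] at hW
    rw [Metric.mem_ball, dist_zero_right]
    have := norm_add_le (W - p) p
    rw [sub_add_cancel] at this
    linarith [hε.R_large]
  obtain ⟨σ₀, hσ₀⟩ := S.exists_zone
  have hδb : ∀ W ∈ Metric.closedBall p 20, ‖ε * drift b W‖ ≤ δ := fun W hW => by
    rw [← hσ₀]; exact hε.bound σ₀ W (re_le_of_mem_ball (hsub W hW))
  obtain ⟨K, hK⟩ : ∃ K, LipschitzOnWith K (fun W => I + ε * drift b W) (Metric.closedBall p 20) := by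
    have : ContDiff ℂ 1 (fun W => I + ε * drift b W) :=
      (contDiff_const.add (contDiff_const.mul (differentiable_drift b).contDiff))
    obtain ⟨K, hK⟩ := ((this.restrict_scalars ℝ).contDiffOn (s := Metric.closedBall p 20)).exists_lipschitzOnWith
      one_ne_zero (convex_closedBall p 20) (isCompact_closedBall p 20)
    exact ⟨K, hK⟩
  -- Speed at most `2` during time `8` stays within distance `20`. Time `8` suffices to rise above
  -- height `π`, and the sideways motion is at most `8δ < η`, which keeps the solution in the strip.
  obtain ⟨u, huc, hu0, hub, hu⟩ := exists_solution_on_Icc (f := fun W => I + ε * drift b W) (p := p)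
    (ρ := 20) (T := 8) (L := 2) (K := K) (by norm_num) (by norm_num) (by norm_num) hK
    (fun W hW => (norm_add_le _ _).trans (by
      rw [Complex.norm_I]; linarith [hδb W hW, hε.δ_le])) (by norm_num)
  have hfc : Continuous (fun t => I + ε * drift b (u t)) :=
    continuous_const.add (continuous_const.mul ((differentiable_drift b).continuous.comp huc))
  have hdist : ∀ s ∈ Icc (0 : ℝ) 8, ∀ t ∈ Icc s 8, ‖u t - u s - (t - s : ℝ) * I‖ ≤ δ * (t - s) := by
    intro s hs t ht
    have hi := fun x y => hfc.intervalIntegrable (μ := volume) x y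
    have e : u t - u s - (t - s : ℝ) * I = ∫ r in s..t, ε * drift b (u r) := by
      have e1 : u t - u s = ∫ r in s..t, (I + ε * drift b (u r)) := by
        rw [hu t ⟨hs.1.trans ht.1, ht.2⟩, hu s hs,
          ← intervalIntegral.integral_interval_sub_left (hi 0 t) (hi 0 s)]
        abel
      rw [e1, intervalIntegral.integral_add intervalIntegrable_const
        (by simpa using (hi s t).sub (intervalIntegrable_const (c := I))),
        intervalIntegral.integral_const]
      simp
    rw [e]
    refine (intervalIntegral.norm_integral_le_of_norm_le_const fun r _ => hδb _ (hub r)).trans ?_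
    rw [abs_of_nonneg (by linarith [ht.1])]
  have hstrip : ∀ t ∈ Icc (0 : ℝ) 8, (u t).re ∈ Ioo lo hi := fun t ht => by
    have h2 := hdist 0 ⟨le_rfl, by norm_num⟩ t ht
    have h3 := abs_le.1 ((Complex.abs_re_le_norm _).trans h2)
    rw [hu0, hp] at h3
    simp at h3
    constructor <;> nlinarith [h0.1, h0.2, ht.1, ht.2]
  set f : ℝ → ℝ := fun t => (u t).im - ψ₁ (u t).re with hf
  have hgap : ∀ ψ : ℝ → ℝ, IsCurve lo hi L ψ → ∀ s ∈ Icc (0 : ℝ) 8, ∀ t ∈ Icc s 8,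
      (u s).im - ψ (u s).re + (t - s) / 2 ≤ (u t).im - ψ (u t).re := by
    intro ψ hψ s hs t ht
    have hn := hdist s hs t ht
    have hre := (Complex.abs_re_le_norm _).trans hn
    have him := (abs_le.1 ((Complex.abs_im_le_norm _).trans hn)).1
    simp only [Complex.sub_re, Complex.sub_im, Complex.mul_re, Complex.mul_im, Complex.ofReal_re,
      Complex.ofReal_im, Complex.I_re, Complex.I_im, mul_zero, mul_one, sub_zero,
      add_zero] at hre him
    have hl := (abs_le.1 (hψ.lip _ (hstrip t ⟨hs.1.trans ht.1, ht.2⟩) _ (hstrip s hs))).2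
    have := mul_le_mul_of_nonneg_left hre hε.L_nonneg
    nlinarith [hε.lip_le, ht.1]
  have hfcont : ContinuousOn f (Icc 0 8) := by
    refine (Complex.continuous_im.comp huc).continuousOn.sub ?_
    have : ContinuousOn ψ₁ (Ioo lo hi) := fun s hs =>
      (S.curve₁.analyticAt s hs).continuousAt.continuousWithinAt
    exact this.comp (Complex.continuous_re.comp huc).continuousOn hstrip
  have hf0 : f 0 < 0 := by
    simp only [hf, hu0, hp, curvePt_im, curvePt_re]
    linarith [S.lt s₀ h0']
  have hf8 : 0 < f 8 := by
    have h2 := hdist 0 ⟨le_rfl, by norm_num⟩ 8 ⟨by norm_num, le_rfl⟩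
    have h3 := (abs_le.1 ((Complex.abs_im_le_norm _).trans h2)).1
    rw [hu0, hp] at h3
    simp at h3
    have h8 := hstrip 8 ⟨by norm_num, le_rfl⟩
    have := S.curve₁.le_pi _ h8
    have := S.curve₀.nonneg s₀ h0'
    simp only [hf]
    linarith [Real.pi_lt_four, hε.δ_le]
  obtain ⟨τ, hτ, hfτ⟩ := intermediate_value_Icc (by norm_num : (0 : ℝ) ≤ 8) hfcont
    (show (0 : ℝ) ∈ Icc (f 0) (f 8) from ⟨hf0.le, hf8.le⟩)
  -- `u` was built from the field of this sector alone; up to the crossing time `τ` it lies between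
  -- the two curves, so it solves the piecewise system too.
  have hlift : IsLift a ε u (fun t => I + ε * drift b (u t)) 0 τ := by
    refine ⟨hfc.intervalIntegrable _ _, ?_, fun t ht => ?_⟩
    · have hne1 : ∀ᵐ t : ℝ, t ≠ τ := by simp [ae_iff]
      filter_upwards [hne1] with t h3 ht
      have ht8 : t ∈ Icc (0 : ℝ) 8 := ⟨ht.1.le, ht.2.trans hτ.2⟩
      have hlt : t < τ := lt_of_le_of_ne ht.2 h3
      have g0 := hgap ψ₀ S.curve₀ 0 ⟨le_rfl, by norm_num⟩ t ht8
      have g1 := hgap ψ₁ S.curve₁ t ht8 τ ⟨ht.2, hτ.2⟩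
      rw [hu0, hp, curvePt_im, curvePt_re] at g0
      obtain ⟨σ, rfl, hσ⟩ := S.zone (u t) (hstrip t ht8) (by linarith [ht.1])
        (by simp only [hf] at hfτ; linarith)
      rw [liftedField_of_mem_region hσ]
      rfl
    · rw [hu0]; exact hu t ⟨ht.1, ht.2.trans hτ.2⟩
  have hsτ : ∀ t ∈ Icc 0 τ, (u t).re ∈ Ioo lo hi := fun t ht => hstrip t ⟨ht.1, ht.2.trans hτ.2⟩
  have him : (u τ).im = ψ₁ (u τ).re := sub_eq_zero.1 hfτ
  have harc := (S.arc hε hlift hτ.1 hsτ (by rw [hu0, hp]; simp) him).1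
  have hre0 : (u 0).re = s₀ := by rw [hu0, hp]; simp
  have hre : (u τ).re = s₁ := by
    refine hinj (hsτ τ ⟨hτ.1, le_rfl⟩) h1 ?_
    rw [harc, hlev, hre0]
  refine ⟨τ, hτ.1, u, _, hlift, hu0, ?_, hsτ⟩
  rw [eq_curvePt him, hre]

end Paths

/-! ### The half-return map and its first order term. -/

/-- A perturbed center together with a strip of the upper half plane that the switching curves
`φ₁ < φ₂` divide into three sectors. -/
structure Model where
  coef : Zone → Fin 4 → ℝ
  lo : ℝ
  hi : ℝ
  L : ℝ
  η : ℝ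
  φ₁ : ℝ → ℝ
  φ₂ : ℝ → ℝ
  η_pos : 0 < η
  L_nonneg : 0 ≤ L
  sec₁ : Sector coef lo hi L (coef .minus) (fun _ => 0) φ₁
  sec₂ : Sector coef lo hi L (coef .central) φ₁ φ₂
  sec₃ : Sector coef lo hi L (coef .plus) φ₂ (fun _ => Real.pi)

namespace Model

variable (M : Model)

/-- Radius of the ball on which the time maps are defined. -/
noncomputable def R : ℝ := |M.lo| + |M.hi| + 30

/-- Bound for the perturbation. -/
noncomputable def δ : ℝ := min (M.η / 16) (1 / (8 * (1 + M.L)))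

/-- The core of the strip. -/
def core : Set ℝ := Ioo (M.lo + 2 * M.η) (M.hi - 2 * M.η)

/-- Sectors are traversed backward, from the upper curve to the lower one. In this way the half map
for `ε` and its mirror image for `-ε` both start on the section `Im W ≡ π` and end on the real line.
-/
noncomputable def step₁ (ε : ℝ) : ℝ → ℝ :=
  transit (levelMap (M.coef .minus) M.R M.φ₁ ε) (levelMap (M.coef .minus) M.R (fun _ => 0) ε)
    M.lo M.hi

noncomputable def step₂ (ε : ℝ) : ℝ → ℝ :=
  transit (levelMap (M.coef .central) M.R M.φ₂ ε) (levelMap (M.coef .central) M.R M.φ₁ ε)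
    M.lo M.hi

noncomputable def step₃ (ε : ℝ) : ℝ → ℝ :=
  transit (levelMap (M.coef .plus) M.R (fun _ => Real.pi) ε)
    (levelMap (M.coef .plus) M.R M.φ₂ ε) M.lo M.hi

/-- The backward half-return map, from the line `Im W = π` to the line `Im W = 0`. -/
noncomputable def half (ε y : ℝ) : ℝ := M.step₁ ε (M.step₂ ε (M.step₃ ε y))

/-- The first order term of `half`. -/
noncomputable def melnikov (s : ℝ) : ℝ :=
  (driftPrim (M.coef .minus) (curvePt (fun _ => 0) s)).im
    - (driftPrim (M.coef .minus) (curvePt M.φ₁ s)).im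
    + ((driftPrim (M.coef .central) (curvePt M.φ₁ s)).im
      - (driftPrim (M.coef .central) (curvePt M.φ₂ s)).im
    + ((driftPrim (M.coef .plus) (curvePt M.φ₂ s)).im
      - (driftPrim (M.coef .plus) (curvePt (fun _ => Real.pi) s)).im))

/-- The orbit of the upper half strip that ends at `y + iπ`. -/
noncomputable def arc (ε y : ℝ) : Set ℂ :=
  arcSet (M.coef .minus) M.R ε (curvePt (fun _ => 0) (M.half ε y))
      (curvePt M.φ₁ (M.step₂ ε (M.step₃ ε y))) ∪
    (arcSet (M.coef .central) M.R ε (curvePt M.φ₁ (M.step₂ ε (M.step₃ ε y)))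
      (curvePt M.φ₂ (M.step₃ ε y)) ∪
    arcSet (M.coef .plus) M.R ε (curvePt M.φ₂ (M.step₃ ε y)) (curvePt (fun _ => Real.pi) y))

/-- `ε` is small enough for the half-return map to behave as expected. -/
structure Good (C ε : ℝ) : Prop where
  small : Small M.coef M.lo M.hi M.L M.R M.δ ε
  mono₁₀ : StrictMonoOn (levelMap (M.coef .minus) M.R (fun _ => 0) ε) (Ioo M.lo M.hi)
  mono₁₁ : StrictMonoOn (levelMap (M.coef .minus) M.R M.φ₁ ε) (Ioo M.lo M.hi)
  mono₂₁ : StrictMonoOn (levelMap (M.coef .central) M.R M.φ₁ ε) (Ioo M.lo M.hi)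
  mono₂₂ : StrictMonoOn (levelMap (M.coef .central) M.R M.φ₂ ε) (Ioo M.lo M.hi)
  mono₃₂ : StrictMonoOn (levelMap (M.coef .plus) M.R M.φ₂ ε) (Ioo M.lo M.hi)
  mono₃₃ : StrictMonoOn (levelMap (M.coef .plus) M.R (fun _ => Real.pi) ε) (Ioo M.lo M.hi)
  step₃_mem : ∀ y ∈ M.core, M.step₃ ε y ∈ Ioo (M.lo + M.η) (M.hi - M.η)
  step₂_mem : ∀ y ∈ M.core, M.step₂ ε (M.step₃ ε y) ∈ Ioo (M.lo + M.η) (M.hi - M.η)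
  half_mem : ∀ y ∈ M.core, M.half ε y ∈ Ioo (M.lo + M.η) (M.hi - M.η)
  level₃ : ∀ y ∈ M.core, levelMap (M.coef .plus) M.R M.φ₂ ε (M.step₃ ε y)
    = levelMap (M.coef .plus) M.R (fun _ => Real.pi) ε y
  level₂ : ∀ y ∈ M.core, levelMap (M.coef .central) M.R M.φ₁ ε (M.step₂ ε (M.step₃ ε y))
    = levelMap (M.coef .central) M.R M.φ₂ ε (M.step₃ ε y)
  level₁ : ∀ y ∈ M.core, levelMap (M.coef .minus) M.R (fun _ => 0) ε (M.half ε y)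
    = levelMap (M.coef .minus) M.R M.φ₁ ε (M.step₂ ε (M.step₃ ε y))
  half_approx : ∀ y ∈ M.core, |M.half ε y - y - ε * M.melnikov y| ≤ C * ε ^ 2
  half_analytic : ∀ y ∈ M.core, AnalyticAt ℝ (M.half ε) y
  half_mono : StrictMonoOn (M.half ε) M.core

theorem δ_pos : 0 < M.δ := by
  have := M.L_nonneg
  exact lt_min (by linarith [M.η_pos]) (by positivity)

theorem δ_lt : 8 * M.δ < M.η := by
  have h1 : M.δ ≤ M.η / 16 := min_le_left _ _
  linarith [M.η_pos]

theorem eventually_small : ∀ᶠ ε in 𝓝 (0 : ℝ), Small M.coef M.lo M.hi M.L M.R M.δ ε := by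
  have hL := M.L_nonneg
  have h1 : M.δ ≤ 1 / (8 * (1 + M.L)) := min_le_right _ _
  have h2 : (1 + M.L) * (1 / (8 * (1 + M.L))) = 1 / 8 := by field_simp
  have h3 : (1 + M.L) * M.δ ≤ 1 / 8 := by
    rw [← h2]; exact mul_le_mul_of_nonneg_left h1 (by linarith)
  have h4 := M.δ_pos
  filter_upwards [eventually_norm_mul_drift_le M.coef M.R M.δ_pos] with ε hε
  exact ⟨hL, le_rfl, by nlinarith, by linarith, hε⟩

theorem nearId {b : Fin 4 → ℝ} {ψ : ℝ → ℝ} (hψ : IsCurve M.lo M.hi M.L ψ) :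
    NearId (levelMap b M.R ψ) (fun s => -(driftPrim b (curvePt ψ s)).im) M.lo M.hi :=
  nearId_levelMap M.L_nonneg hψ (by rw [R]; linarith)

theorem _root_.TangentCircles.NearId.mono {T : ℝ → ℝ → ℝ} {m : ℝ → ℝ} {a b a' b' : ℝ}
    (h : NearId T m a b) (ha : a ≤ a') (hb : b' ≤ b) : NearId T m a' b' := by
  obtain ⟨hm, C, hC, h⟩ := h
  exact ⟨hm.mono ha hb, C, hC, h.mono fun ε h s hs => h s (Ioo_subset_Ioo ha hb hs)⟩

theorem eventually_mul_abs_lt (C : ℝ) {η : ℝ} (hη : 0 < η) : ∀ᶠ ε in 𝓝 (0 : ℝ), C * |ε| < η := by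
  have : Tendsto (fun ε : ℝ => C * |ε|) (𝓝 0) (𝓝 (C * |(0 : ℝ)|)) :=
    Continuous.tendsto (by fun_prop) 0
  rw [abs_zero, mul_zero] at this
  exact this.eventually (gt_mem_nhds hη)

/-- Each step is a transit between near-identity level maps, so it is near the identity itself, and
first order terms add under composition. One margin `η` is used to define the transits, the second
one to compose them. -/
theorem eventually_good : ∃ C, 0 ≤ C ∧ ∀ᶠ ε in 𝓝 (0 : ℝ), M.Good C ε := by
  have hη := M.η_pos
  have n10 := M.nearId (b := M.coef .minus) M.sec₁.curve₀
  have n11 := M.nearId (b := M.coef .minus) M.sec₁.curve₁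
  have n21 := M.nearId (b := M.coef .central) M.sec₂.curve₀
  have n22 := M.nearId (b := M.coef .central) M.sec₂.curve₁
  have n32 := M.nearId (b := M.coef .plus) M.sec₃.curve₀
  have n33 := M.nearId (b := M.coef .plus) M.sec₃.curve₁
  have l0 : M.lo < M.lo + M.η := by linarith
  have l1 : M.hi - M.η < M.hi := by linarith
  have l2 : M.lo + M.η < M.lo + 2 * M.η := by linarith
  have l3 : M.hi - 2 * M.η < M.hi - M.η := by linarith
  have t1 := n11.transit n10 l0 l1
  have t2 := n22.transit n21 l0 l1
  have t3 := n33.transit n32 l0 l1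
  obtain ⟨C1, hC1, s1⟩ := transit_spec n11 n10 l0 l1
  obtain ⟨C2, hC2, s2⟩ := transit_spec n22 n21 l0 l1
  obtain ⟨C3, hC3, s3⟩ := transit_spec n33 n32 l0 l1
  have t23 := t2.comp (t3.mono l2.le l3.le) l2 l3
  have t123 := t1.comp t23 l2 l3
  have hm := t123.strictMonoOn
  obtain ⟨-, D, hD, t123⟩ := t123
  refine ⟨D, hD, ?_⟩
  filter_upwards [M.eventually_small, n10.strictMonoOn, n11.strictMonoOn, n21.strictMonoOn,
    n22.strictMonoOn, n32.strictMonoOn, n33.strictMonoOn, s1, s2, s3, hm, t123,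
    eventually_mul_abs_lt (C1 + C2 + C3) hη] with ε h0 h10 h11 h21 h22 h32 h33 s1 s2 s3 hm t hη'
  have e3 : ∀ y ∈ M.core, y ∈ Ioo (M.lo + M.η) (M.hi - M.η) := fun y hy =>
    ⟨by linarith [hy.1], by linarith [hy.2]⟩
  have b1 : 0 ≤ C1 * |ε| := by positivity
  have b2 : 0 ≤ C2 * |ε| := by positivity
  have b3 : 0 ≤ C3 * |ε| := by positivity
  have b4 : C1 * |ε| + C2 * |ε| + C3 * |ε| < M.η := by linarith
  have m3 : ∀ y ∈ M.core, |M.step₃ ε y - y| ≤ C3 * |ε| := fun y hy => (s3 y (e3 y hy)).2.2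
  have e2 : ∀ y ∈ M.core, M.step₃ ε y ∈ Ioo (M.lo + M.η) (M.hi - M.η) := fun y hy => by
    have := abs_le.1 (m3 y hy)
    exact ⟨by linarith [hy.1], by linarith [hy.2]⟩
  have m2 : ∀ y ∈ M.core, |M.step₂ ε (M.step₃ ε y) - M.step₃ ε y| ≤ C2 * |ε| := fun y hy =>
    (s2 _ (e2 y hy)).2.2
  have e1 : ∀ y ∈ M.core, M.step₂ ε (M.step₃ ε y) ∈ Ioo (M.lo + M.η) (M.hi - M.η) := fun y hy => by
    have := abs_le.1 (m3 y hy)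
    have := abs_le.1 (m2 y hy)
    exact ⟨by linarith [hy.1], by linarith [hy.2]⟩
  have m1 : ∀ y ∈ M.core, |M.half ε y - M.step₂ ε (M.step₃ ε y)| ≤ C1 * |ε| := fun y hy =>
    (s1 _ (e1 y hy)).2.2
  have mm : ∀ y ∈ M.core, |M.half ε y - y| ≤ (C1 + C2 + C3) * |ε| := fun y hy => by
    have h3 := abs_le.1 (m3 y hy)
    have h2 := abs_le.1 (m2 y hy)
    have h1 := abs_le.1 (m1 y hy)
    exact abs_le.2 ⟨by linarith, by linarith⟩
  refine ⟨h0, h10, h11, h21, h22, h32, h33, e2, e1, fun y hy => ?_, fun y hy => (s3 _ (e3 y hy)).2.1,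
    fun y hy => (s2 _ (e2 y hy)).2.1, fun y hy => (s1 _ (e1 y hy)).2.1,
    fun y hy => ?_, fun y hy => (t y hy).2.1, hm⟩
  · have := abs_le.1 (mm y hy)
    exact ⟨by linarith [hy.1], by linarith [hy.2]⟩
  · refine le_trans (le_of_eq ?_) (t y hy).1
    congr 1
    rw [melnikov, half, step₁, step₂, step₃]
    ring

variable {M}

theorem Good.reach {C ε : ℝ} (h : M.Good C ε) {y : ℝ} (hy : y ∈ M.core) :
    Reach M.coef ε M.lo M.hi (M.half ε y) (y + Real.pi * I) := by
  have hη := M.η_pos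
  have hy' : y ∈ Ioo M.lo M.hi := ⟨by linarith [hy.1], by linarith [hy.2]⟩
  have hsub : Ioo (M.lo + M.η) (M.hi - M.η) ⊆ Ioo M.lo M.hi :=
    Ioo_subset_Ioo (by linarith) (by linarith)
  have r1 := M.sec₁.reach h.small M.δ_pos.le M.δ_lt (h.half_mem y hy) (hsub (h.step₂_mem y hy))
    h.mono₁₁.injOn (h.level₁ y hy).symm
  have r2 := M.sec₂.reach h.small M.δ_pos.le M.δ_lt (h.step₂_mem y hy) (hsub (h.step₃_mem y hy))
    h.mono₂₂.injOn (h.level₂ y hy).symm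
  have r3 := M.sec₃.reach h.small M.δ_pos.le M.δ_lt (h.step₃_mem y hy) hy'
    h.mono₃₃.injOn (h.level₃ y hy).symm
  have := (r1.trans r2).trans r3
  simpa [curvePt] using this

/-- A solution that crosses the upper half strip. -/
theorem Good.upper {C ε : ℝ} (h : M.Good C ε) {W ω : ℝ → ℂ} {t₀ t₁ : ℝ}
    (hW : IsLift M.coef ε W ω t₀ t₁) (h01 : t₀ ≤ t₁)
    (hs : ∀ t ∈ Icc t₀ t₁, (W t).re ∈ Ioo M.lo M.hi) (h0 : (W t₀).im = 0)
    (h1 : (W t₁).im = Real.pi) :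
    (W t₀).re = M.half ε (W t₁).re ∧ W '' Icc t₀ t₁ = M.arc ε (W t₁).re := by
  have hL := M.L_nonneg
  have hcont : ∀ ψ, IsCurve M.lo M.hi M.L ψ →
      ContinuousOn (fun t => (W t).im - ψ (W t).re) (Icc t₀ t₁) := fun ψ hψ => by
    refine (Complex.continuous_im.comp_continuousOn hW.continuousOn).sub ?_
    have : ContinuousOn ψ (Ioo M.lo M.hi) := fun s hs =>
      (hψ.analyticAt s hs).continuousAt.continuousWithinAt
    exact this.comp (Complex.continuous_re.comp_continuousOn hW.continuousOn) hs
  have m0 : t₀ ∈ Icc t₀ t₁ := ⟨le_rfl, h01⟩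
  have m1 : t₁ ∈ Icc t₀ t₁ := ⟨h01, le_rfl⟩
  have c1 := hcont _ M.sec₁.curve₁
  have c2 := hcont _ M.sec₃.curve₀
  have a0 := M.sec₁.lt _ (hs t₀ m0)
  have a1 := M.sec₂.lt _ (hs t₀ m0)
  have b0 := M.sec₂.lt _ (hs t₁ m1)
  have b1 := M.sec₃.lt _ (hs t₁ m1)
  -- Crossing times are found from the top: first a time on `φ₂`, then, before it, a time on `φ₁`.
  -- The level equations of the three pieces then identify the abscissae.
  obtain ⟨τ₂, hτ₂, e2⟩ := intermediate_value_Icc h01 c2 (show (0 : ℝ) ∈ _ from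
    ⟨by rw [h0]; linarith, by rw [h1]; linarith⟩)
  have d0 := M.sec₂.lt _ (hs τ₂ hτ₂)
  simp only at e2
  obtain ⟨τ₁, hτ₁, e1⟩ := intermediate_value_Icc hτ₂.1 (c1.mono (Icc_subset_Icc_right hτ₂.2))
    (show (0 : ℝ) ∈ _ from ⟨by rw [h0]; linarith, by linarith⟩)
  simp only at e1
  have hi2 : (W τ₂).im = M.φ₂ (W τ₂).re := sub_eq_zero.1 e2
  have hi1 : (W τ₁).im = M.φ₁ (W τ₁).re := sub_eq_zero.1 e1
  have hτ₁₁ : τ₁ ≤ t₁ := hτ₁.2.trans hτ₂.2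
  have A1 := M.sec₁.arc h.small (hW.mono le_rfl hτ₁.1 hτ₁₁) hτ₁.1
    (fun t ht => hs t ⟨ht.1, ht.2.trans hτ₁₁⟩) h0 hi1
  have A2 := M.sec₂.arc h.small (hW.mono hτ₁.1 hτ₁.2 hτ₂.2) hτ₁.2
    (fun t ht => hs t ⟨hτ₁.1.trans ht.1, ht.2.trans hτ₂.2⟩) hi1 hi2
  have A3 := M.sec₃.arc h.small (hW.mono hτ₂.1 hτ₂.2 le_rfl) hτ₂.2
    (fun t ht => hs t ⟨hτ₂.1.trans ht.1, ht.2⟩) hi2 h1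
  have x3 : M.step₃ ε (W t₁).re = (W τ₂).re :=
    transit_eq h.mono₃₂.injOn (hs τ₂ hτ₂) A3.1.symm
  have x2 : M.step₂ ε (W τ₂).re = (W τ₁).re :=
    transit_eq h.mono₂₁.injOn (hs τ₁ ⟨hτ₁.1, hτ₁₁⟩) A2.1.symm
  have x1 : M.step₁ ε (W τ₁).re = (W t₀).re :=
    transit_eq h.mono₁₀.injOn (hs t₀ m0) A1.1.symm
  have xh : M.half ε (W t₁).re = (W t₀).re := by rw [half, x3, x2, x1]
  refine ⟨xh.symm, ?_⟩
  rw [arc, xh, x3, x2, ← eq_curvePt hi1, ← eq_curvePt hi2, ← eq_curvePt (ψ := fun _ => 0) h0,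
    ← eq_curvePt (ψ := fun _ => Real.pi) h1, ← A1.2, ← A2.2, ← A3.2, ← image_union, ← image_union,
    Icc_union_Icc_eq_Icc hτ₁.2 hτ₂.2, Icc_union_Icc_eq_Icc hτ₁.1 hτ₁₁]

/-- A solution that crosses the lower half strip. -/
theorem Good.lower {C ε : ℝ} (h : M.Good C (-ε)) {W ω : ℝ → ℂ} {t₀ t₁ : ℝ}
    (hW : IsLift M.coef ε W ω t₀ t₁) (h01 : t₀ ≤ t₁)
    (hs : ∀ t ∈ Icc t₀ t₁, (W t).re ∈ Ioo M.lo M.hi) (h0 : (W t₀).im = -Real.pi)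
    (h1 : (W t₁).im = 0) :
    (W t₁).re = M.half (-ε) (W t₀).re ∧
      W '' Icc t₀ t₁ = starRingEnd ℂ '' M.arc (-ε) (W t₀).re := by
  have := h.upper (hW.conj h01) (by linarith) (fun t ht => by
    simpa using hs (-t) ⟨by linarith [ht.2], by linarith [ht.1]⟩) (by simpa using h1)
    (by simpa using congrArg Neg.neg h0)
  simp only [neg_neg, Complex.conj_re] at this
  refine ⟨this.1, ?_⟩
  rw [← this.2, image_image]
  simp only [Complex.conj_conj]
  ext V
  constructor
  · rintro ⟨t, ht, rfl⟩
    exact ⟨-t, ⟨by linarith [ht.2], by linarith [ht.1]⟩, by simp⟩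
  · rintro ⟨t, ht, rfl⟩
    exact ⟨-t, ⟨by linarith [ht.2], by linarith [ht.1]⟩, rfl⟩

/-- The orbit through `y + iπ`, in the coordinate `W`. -/
noncomputable def loop (M : Model) (ε y : ℝ) : Set ℂ :=
  starRingEnd ℂ '' M.arc (-ε) y ∪ M.arc ε y

/-- The orbit through `y + iπ`, in the plane. -/
noncomputable def orbit (M : Model) (ε y : ℝ) : Set ℂ := toPlane '' M.loop ε y

end Model

/-! ### Closed orbits from solutions that gain one turn. -/

theorem ae_of_periodic {P : ℝ → Prop} {T : ℝ} (hT : 0 < T) (hP : ∀ t, ∀ n : ℤ, P (t - n * T) → P t)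
    (h : ∀ᵐ t, t ∈ Ioc 0 T → P t) : ∀ᵐ t, P t := by
  have key : ∀ n : ℤ, ∀ᵐ t : ℝ, t - n * T ∈ Ioc 0 T → P t := fun n => by
    have hq := (measurePreserving_sub_right volume ((n : ℝ) * T)).quasiMeasurePreserving.ae h
    filter_upwards [hq] with t ht hm
    exact hP t n (ht hm)
  filter_upwards [ae_all_iff.2 key] with t ht
  refine ht (toIocDiv hT 0 t) ?_
  have := sub_toIocDiv_zsmul_mem_Ioc hT 0 t
  simpa using this

/-- Periodic extension of a closed primitive. -/
theorem exists_periodic_extension {γ₀ v₀ : ℝ → ℂ} {T : ℝ} (hT : 0 < T)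
    (hint : IntervalIntegrable v₀ volume 0 T)
    (hγ : ∀ t ∈ Icc 0 T, γ₀ t = γ₀ 0 + ∫ s in (0 : ℝ)..t, v₀ s) (hper : γ₀ T = γ₀ 0) :
    ∃ γ v : ℝ → ℂ, (∀ a b : ℝ, IntervalIntegrable v volume a b) ∧
      (∀ t, γ t = γ 0 + ∫ s in (0 : ℝ)..t, v s) ∧ Function.Periodic γ T ∧
      Function.Periodic v T ∧ EqOn γ γ₀ (Icc 0 T) ∧ EqOn v v₀ (Ioc 0 T) := by
  set v : ℝ → ℂ := fun t => v₀ (toIocMod hT 0 t) with hv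
  have hvp : Function.Periodic v T := fun t => by simp only [hv, toIocMod_add_right]
  have hve : EqOn v v₀ (Ioc 0 T) := fun t ht => by
    simp only [hv]
    rw [(toIocMod_eq_self hT).2 (by simpa using ht)]
  have hvi : IntervalIntegrable v volume 0 T := hint.congr fun t ht => by
    rw [uIoc_of_le hT.le] at ht; exact (hve ht).symm
  have hvi' : ∀ a b : ℝ, IntervalIntegrable v volume a b := fun a b =>
    hvp.intervalIntegrable₀ hT.ne' hvi a b
  have hEq : ∀ t ∈ Icc 0 T, γ₀ 0 + ∫ s in (0 : ℝ)..t, v s = γ₀ t := fun t ht => by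
    rw [hγ t ht]
    congr 1
    refine intervalIntegral.integral_congr_ae (Eventually.of_forall fun s hs => ?_)
    rw [uIoc_of_le ht.1] at hs
    exact hve ⟨hs.1, hs.2.trans ht.2⟩
  refine ⟨fun t => γ₀ 0 + ∫ s in (0 : ℝ)..t, v s, v, hvi', fun t => by simp, fun t => ?_, hvp,
    hEq, hve⟩
  have h0 : ∫ s in (0 : ℝ)..T, v s = 0 := by
    have := hEq T ⟨hT.le, le_rfl⟩
    rw [hper] at this
    simpa using this
  have h1 : ∫ s in t..(t + T), v s = 0 := by
    rw [hvp.intervalIntegral_add_eq t 0, zero_add, h0]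
  simp only
  rw [← intervalIntegral.integral_add_adjacent_intervals (hvi' 0 t) (hvi' t (t + T)), h1, add_zero]

theorem toPlane_eq_iff {V W : ℂ} :
    toPlane V = toPlane W ↔ ∃ n : ℤ, V = W + n * (2 * Real.pi * I) := by
  constructor
  · intro h
    have h' : exp (-V) = exp (-W) := by simpa [toPlane] using h
    obtain ⟨n, hn⟩ := Complex.exp_eq_exp_iff_exists_int.1 h'
    refine ⟨-n, ?_⟩
    push_cast
    linear_combination -hn
  · rintro ⟨n, rfl⟩
    exact toPlane_add_two_pi W n

/-- A solution that gains exactly one turn describes a periodic orbit. -/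
theorem isPeriodicOrbit_of_isLift {a : Zone → Fin 4 → ℝ} {ε lo hi δ : ℝ} {W ω : ℝ → ℂ} {T : ℝ}
    (hT : 0 < T) (h : IsLift a ε W ω 0 T)
    (hδ : ∀ σ, ∀ V : ℂ, V.re ∈ Ioo lo hi → ‖ε * drift (a σ) V‖ ≤ δ)
    (hs : ∀ t ∈ Icc 0 T, (W t).re ∈ Ioo lo hi)
    (hmono : StrictMonoOn (fun t => (W t).im) (Icc 0 T))
    (hend : W T = W 0 + 2 * Real.pi * I) :
    IsPeriodicOrbit (field (perturbation a) ε) (toPlane '' (W '' Icc 0 T)) := by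
  obtain ⟨hi1, hi2⟩ := comp_eq_add_integral_of_hasDerivAt (f := toPlane)
    (f' := fun V => -exp (-V)) (K := δ + 1) hT.le h.1 (by
      filter_upwards [h.2.1] with t h2 ht
      have := norm_sub_le_of_mem_liftedField
        (fun σ => hδ σ _ (hs t (Ioc_subset_Icc_self ht))) (h2 ht)
      have h3 := norm_add_le (ω t - I) I
      rw [sub_add_cancel, Complex.norm_I] at h3
      linarith) h.2.2
    (fun t _ => by
      have h1 : HasDerivAt toPlane (exp (-W t) * (-1)) (W t) :=
        ((hasDerivAt_id (W t)).neg.cexp).const_add (1 : ℂ)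
      rwa [mul_neg_one] at h1)
    (by have := h.continuousOn; fun_prop)
  have hper : toPlane (W T) = toPlane (W 0) := toPlane_eq_iff.2 ⟨1, by rw [hend]; simp⟩
  -- For the injectivity below: two lifts of one point differ by `2πi n`, while `Im W` increases
  -- strictly by `2π` in total over `[0, T]`, so `n = 0` on the half-open interval.
  obtain ⟨γ, v, hv, hγ, hγp, hvp, hγe, hve⟩ :=
    exists_periodic_extension (γ₀ := fun t => toPlane (W t)) hT hi1 hi2 hper
  have hinj : InjOn γ (Ico 0 T) := fun s hsI t htI hst => by
    have hs' := Ico_subset_Icc_self hsI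
    have ht' := Ico_subset_Icc_self htI
    rw [hγe hs', hγe ht'] at hst
    obtain ⟨n, hn⟩ := toPlane_eq_iff.1 hst
    have him : (W s).im = (W t).im + n * (2 * Real.pi) := by rw [hn]; simp
    have hT0 : (W T).im = (W 0).im + 2 * Real.pi := by rw [hend]; simp
    have m0 : (0 : ℝ) ∈ Icc 0 T := ⟨le_rfl, hT.le⟩
    have mT : T ∈ Icc 0 T := ⟨hT.le, le_rfl⟩
    have a1 := hmono.monotoneOn m0 hs' hsI.1
    have a2 := hmono hs' mT hsI.2
    have b1 := hmono.monotoneOn m0 ht' htI.1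
    have b2 := hmono ht' mT htI.2
    simp only at a1 a2 b1 b2
    have hpi := Real.pi_pos
    have hn1 : (n : ℝ) < 1 := by
      by_contra! hge
      nlinarith
    have hn2 : (-1 : ℝ) < n := by
      by_contra! hge
      nlinarith
    have hn0 : n = 0 := by
      have h1 : n < 1 := by exact_mod_cast hn1
      have h2 : -1 < n := by exact_mod_cast hn2
      omega
    rw [hn0] at him
    exact hmono.injOn hs' ht' (by simpa using him)
  have hT2 : T / 2 ∈ Ico 0 T := ⟨by linarith, by linarith⟩
  refine ⟨γ, T, ⟨hT, ⟨v, hv, ?_, hγ⟩, hγp, T / 2, fun heq => ?_⟩, hinj, ?_⟩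
  · refine ae_of_periodic hT (fun t n => ?_) ?_
    · rw [hvp.sub_int_mul_eq, hγp.sub_int_mul_eq]; exact id
    · filter_upwards [h.2.1] with t h2 ht
      rw [hve ht, hγe (Ioc_subset_Icc_self ht)]
      have := h2 ht
      rw [liftedField, mem_ofPred_eq] at this
      convert this using 1
      ring
  · have := hinj hT2 ⟨le_rfl, hT⟩ heq
    linarith
  · have := hγp.image_Icc hT 0
    rw [zero_add] at this
    rw [← this, image_image]
    exact image_congr hγe

namespace Model

variable {M : Model}

/-- Split the turn at a time when `Im W = 0`: both half maps compute the abscissa there. -/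
theorem Good.turn {C ε : ℝ} (h : M.Good C ε) (h' : M.Good C (-ε)) {W ω : ℝ → ℂ} {t₀ t₁ : ℝ}
    (hW : IsLift M.coef ε W ω t₀ t₁) (h01 : t₀ ≤ t₁)
    (hs : ∀ t ∈ Icc t₀ t₁, (W t).re ∈ Ioo M.lo M.hi) (h0 : (W t₀).im = -Real.pi)
    (h1 : (W t₁).im = Real.pi) :
    M.half (-ε) (W t₀).re = M.half ε (W t₁).re ∧
      W '' Icc t₀ t₁ = starRingEnd ℂ '' M.arc (-ε) (W t₀).re ∪ M.arc ε (W t₁).re := by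
  obtain ⟨τ, hτ, e⟩ := intermediate_value_Icc h01
    (Complex.continuous_im.comp_continuousOn hW.continuousOn)
    (show (0 : ℝ) ∈ _ from ⟨by simp [h0, Real.pi_pos.le], by simp [h1, Real.pi_pos.le]⟩)
  have e' : (W τ).im = 0 := e
  have A := h'.lower (hW.mono le_rfl hτ.1 hτ.2) hτ.1 (fun t ht => hs t ⟨ht.1, ht.2.trans hτ.2⟩) h0 e'
  have B := h.upper (hW.mono hτ.1 hτ.2 le_rfl) hτ.2 (fun t ht => hs t ⟨hτ.1.trans ht.1, ht.2⟩) e' h1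
  refine ⟨A.1.symm.trans B.1, ?_⟩
  rw [← A.2, ← B.2, ← image_union, Icc_union_Icc_eq_Icc hτ.1 hτ.2]

theorem _root_.TangentCircles.IsLift.im_mono {a : Zone → Fin 4 → ℝ} {ε lo hi δ : ℝ}
    {W ω : ℝ → ℂ} {t₀ t₁ : ℝ} (h : IsLift a ε W ω t₀ t₁)
    (hδ : ∀ σ, ∀ V : ℂ, V.re ∈ Ioo lo hi → ‖ε * drift (a σ) V‖ ≤ δ) (hδ2 : δ ≤ 1 / 2)
    (hs : ∀ t ∈ Icc t₀ t₁, (W t).re ∈ Ioo lo hi) {s t : ℝ} (h0 : t₀ ≤ s) (hst : s ≤ t)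
    (h1 : t ≤ t₁) : (W s).im + (t - s) / 2 ≤ (W t).im := by
  have h2 := (abs_le.1 ((Complex.abs_im_le_norm _).trans (h.norm_sub_le hδ hs h0 hst h1))).1
  simp at h2
  nlinarith

/-- Closed orbits correspond to the zeros of `half ε - half (-ε)`. -/
theorem Good.exists_lift {C ε : ℝ} (h : M.Good C ε) (h' : M.Good C (-ε)) {y : ℝ}
    (hy : y ∈ M.core) (heq : M.half ε y = M.half (-ε) y) :
    ∃ T > 0, ∃ W ω : ℝ → ℂ, IsLift M.coef ε W ω 0 T ∧ W 0 = y - Real.pi * I ∧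
      W T = y + Real.pi * I ∧ (∀ t ∈ Icc 0 T, (W t).re ∈ Ioo M.lo M.hi) ∧
      W '' Icc 0 T = M.loop ε y := by
  have r := h.reach hy
  have r' := (h'.reach hy).conj
  rw [neg_neg, ← heq] at r'
  have e1 : starRingEnd ℂ (M.half ε y : ℂ) = M.half ε y := Complex.conj_ofReal _
  rw [e1] at r'
  obtain ⟨T, hT, W, ω, hW, h0, h1, hs⟩ := r'.trans r
  have h0' : W 0 = y - Real.pi * I := by rw [h0]; simp [sub_eq_add_neg]
  have hT0 : 0 < T := by
    refine lt_of_le_of_ne hT ?_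
    rintro rfl
    rw [h0'] at h1
    have := congrArg Complex.im h1
    simp at this
    linarith [Real.pi_pos]
  have ht := h.turn h' hW hT hs (by rw [h0']; simp) (by rw [h1]; simp)
  refine ⟨T, hT0, W, ω, hW, h0', h1, hs, ?_⟩
  rw [ht.2, h0', h1]
  simp [loop]

theorem exists_norm_drift_le (M : Model) : ∃ D, 0 ≤ D ∧ ∀ σ, ∀ W : ℂ, W.re ∈ Ioo M.lo M.hi →
    ‖drift (M.coef σ) W‖ ≤ D := by
  have key : ∀ σ, ∀ W : ℂ, W.re ∈ Ioo M.lo M.hi →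
      ‖drift (M.coef σ) W‖ ≤ (∑ j, |M.coef σ j|) * Real.exp (2 * M.R) := fun σ W hW => by
    refine norm_drift_le _ ?_
    rw [R, abs_le]
    constructor
    · linarith [hW.1, neg_abs_le M.lo, abs_nonneg M.hi]
    · linarith [hW.2, le_abs_self M.hi, abs_nonneg M.lo]
  have hnn : ∀ σ, 0 ≤ (∑ j, |M.coef σ j|) * Real.exp (2 * M.R) := fun σ => by positivity
  refine ⟨(∑ j, |M.coef .plus j|) * Real.exp (2 * M.R)
    + (∑ j, |M.coef .central j|) * Real.exp (2 * M.R)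
    + (∑ j, |M.coef .minus j|) * Real.exp (2 * M.R), by positivity, fun σ W hW => ?_⟩
  have h1 := key σ W hW
  have h2 := hnn .plus
  have h3 := hnn .central
  have h4 := hnn .minus
  cases σ <;> linarith

theorem Good.isPeriodicOrbit {C ε : ℝ} (h : M.Good C ε) (h' : M.Good C (-ε)) {y : ℝ}
    (hy : y ∈ M.core) (heq : M.half ε y = M.half (-ε) y) :
    IsPeriodicOrbit (field (perturbation M.coef) ε) (M.orbit ε y) := by
  obtain ⟨T, hT, W, ω, hW, h0, h1, hs, him⟩ := h.exists_lift h' hy heq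
  rw [orbit, ← him]
  refine isPeriodicOrbit_of_isLift hT hW h.small.strip hs (fun s hsI t htI hst => ?_) ?_
  · have := hW.im_mono h.small.strip (by linarith [h.small.δ_le]) hs hsI.1 hst.le htI.2
    simp only
    linarith
  · rw [h0, h1]; ring

/-- The closed orbit through `y + iπ` is close to the line `Re W = y`, and meets each horizontal
line. -/
theorem loop_spec (M : Model) : ∃ D, 0 ≤ D ∧ ∀ C ε, M.Good C ε → M.Good C (-ε) → ∀ y ∈ M.core,
    M.half ε y = M.half (-ε) y →
    (∀ V ∈ M.loop ε y, V.re ∈ Ioo M.lo M.hi ∧ |V.re - y| ≤ D * |ε| ∧ |V.im| ≤ Real.pi ∧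
      (|V.im| = Real.pi → V.re = y)) ∧
    ∀ θ, |θ| ≤ Real.pi → ∃ V ∈ M.loop ε y, V.im = θ := by
  obtain ⟨D, hD, hDb⟩ := M.exists_norm_drift_le
  refine ⟨20 * D, by positivity, fun C ε h h' y hy heq => ?_⟩
  obtain ⟨T, hT, W, ω, hW, h0, h1, hs, him⟩ := h.exists_lift h' hy heq
  rw [← him]
  have hi := fun s t (a : 0 ≤ s) (b : s ≤ t) (c : t ≤ T) =>
    hW.im_mono h.small.strip (by linarith [h.small.δ_le]) hs a b c
  have i0 : (W 0).im = -Real.pi := by rw [h0]; simp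
  have iT : (W T).im = Real.pi := by rw [h1]; simp
  -- `Im W` gains `2π` at rate at least `1/2`, so `T ≤ 4π`.
  have hT20 : T ≤ 20 := by
    have := hi 0 T le_rfl hT.le le_rfl
    rw [i0, iT] at this
    linarith [Real.pi_lt_four]
  refine ⟨?_, fun θ hθ => ?_⟩
  · rintro _ ⟨t, ht, rfl⟩
    have a1 := hi 0 t le_rfl ht.1 ht.2
    have a2 := hi t T ht.1 ht.2 le_rfl
    rw [i0] at a1
    rw [iT] at a2
    refine ⟨hs t ht, ?_, abs_le.2 ⟨by linarith [ht.1], by linarith [ht.2]⟩, fun habs => ?_⟩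
    · have h2 := hW.norm_sub_le (δ := |ε| * D) (fun σ V hV => by
        rw [norm_mul, Complex.norm_real, Real.norm_eq_abs]
        exact mul_le_mul_of_nonneg_left (hDb σ V hV) (abs_nonneg _)) hs le_rfl ht.1 ht.2
      have h3 := (Complex.abs_re_le_norm _).trans h2
      rw [h0] at h3
      simp at h3
      refine h3.trans ?_
      have : 0 ≤ |ε| * D := by positivity
      nlinarith [ht.1, ht.2]
    · rcases (abs_eq Real.pi_pos.le).1 habs with h4 | h4
      · have : t = T := by linarith [ht.2]
        rw [this, h1]; simp
      · have : t = 0 := by linarith [ht.1]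
        rw [this, h0]; simp
  · obtain ⟨t, ht, e⟩ := intermediate_value_Icc hT.le
      (Complex.continuous_im.comp_continuousOn hW.continuousOn)
      (show θ ∈ _ from ⟨by simpa [i0] using (abs_le.1 hθ).1, by simpa [iT] using (abs_le.1 hθ).2⟩)
    exact ⟨W t, ⟨t, ht, rfl⟩, e⟩

end Model

/-! ### Lifting arbitrary solutions, and uniqueness of periodic ones. -/

theorem isLift_of_forall {a : Zone → Fin 4 → ℝ} {ε : ℝ} {W ω : ℝ → ℂ}
    (hω : ∀ s t : ℝ, IntervalIntegrable ω volume s t)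
    (hf : ∀ᵐ t, ω t ∈ liftedField a ε (W t)) (hW : ∀ t, W t = W 0 + ∫ s in (0 : ℝ)..t, ω s)
    (t₀ t₁ : ℝ) : IsLift a ε W ω t₀ t₁ := by
  refine ⟨hω _ _, hf.mono fun t h _ => h, fun t _ => ?_⟩
  rw [hW t, hW t₀, add_assoc, intervalIntegral.integral_add_adjacent_intervals (hω _ _) (hω _ _)]

/-- Solutions that stay in the annulus lift to the coordinate `W`. -/
theorem exists_lift_of_isSolution {a : Zone → Fin 4 → ℝ} {ε lo hi δ : ℝ} {γ : ℝ → ℂ}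
    (hδ : ∀ σ, ∀ V : ℂ, V.re ∈ Ioo lo hi → ‖ε * drift (a σ) V‖ ≤ δ)
    (hγ : IsSolution (field (perturbation a) ε) γ)
    (hs : ∀ t, ‖γ t - 1‖ ∈ Ioo (Real.exp (-hi)) (Real.exp (-lo))) :
    ∃ W ω : ℝ → ℂ, (∀ t₀ t₁, IsLift a ε W ω t₀ t₁) ∧ (∀ t, toPlane (W t) = γ t) ∧
      (∀ t, (W t).re ∈ Ioo lo hi) ∧ Continuous W := by
  obtain ⟨v, hv, hvf, hγi⟩ := hγ
  have hne : ∀ t, γ t - 1 ≠ 0 := fun t => norm_pos_iff.1 ((Real.exp_pos _).trans (hs t).1)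
  have hγc : Continuous γ := by
    have : Continuous (fun t => γ 0 + ∫ s in (0 : ℝ)..t, v s) :=
      continuous_const.add (intervalIntegral.continuous_primitive hv 0)
    exact this.congr fun t => (hγi t).symm
  set ω : ℝ → ℂ := fun t => -v t / (γ t - 1) with hω
  have hωi : ∀ s t : ℝ, IntervalIntegrable ω volume s t := fun s t => by
    have h1 : ContinuousOn (fun t => (γ t - 1)⁻¹) (uIcc s t) :=
      ((hγc.sub continuous_const).inv₀ hne).continuousOn
    exact (hv s t).neg.mul_continuousOn h1
  -- A continuous branch of `-log (γ - 1)` obtained by integrating minus the logarithmic derivative.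
  -- That `e^W (γ - 1)` stays equal to `1` follows from the chain rule for the pair `(W, γ)`.
  set W : ℝ → ℂ := fun t => -Complex.log (γ 0 - 1) + ∫ s in (0 : ℝ)..t, ω s with hW
  have hWc : Continuous W := continuous_const.add (intervalIntegral.continuous_primitive hωi 0)
  have hW0 : W 0 = -Complex.log (γ 0 - 1) := by simp [hW]
  have hWi : ∀ t, W t = W 0 + ∫ s in (0 : ℝ)..t, ω s := fun t => by rw [hW0]
  clear_value W
  have hre : ∀ t, ∀ V : ℂ, exp (-V) = γ t - 1 → V.re ∈ Ioo lo hi := fun t V hV => by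
    have h1 := hs t
    rw [← hV, Complex.norm_exp] at h1
    have h2 := Real.exp_lt_exp.1 h1.1
    have h3 := Real.exp_lt_exp.1 h1.2
    simp at h2 h3
    exact ⟨h3, h2⟩
  have hmem : ∀ t, ∀ V : ℂ, exp (-V) = γ t - 1 → v t ∈ filippov (field (perturbation a) ε) (γ t) →
      ω t ∈ liftedField a ε V := fun t V hV h => by
    rw [liftedField, mem_ofPred_eq, toPlane, hV, add_sub_cancel]
    convert h using 1
    simp only [hω]
    have := hne t
    field_simp
  have hωb : ∀ᵐ t, ‖ω t‖ ≤ δ + 1 := by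
    filter_upwards [hvf] with t ht
    have e : exp (-(-Complex.log (γ t - 1))) = γ t - 1 := by rw [neg_neg, Complex.exp_log (hne t)]
    have h1 := norm_sub_le_of_mem_liftedField (fun σ => hδ σ _ (hre t _ e)) (hmem t _ e ht)
    have h3 := norm_add_le (ω t - I) I
    rw [sub_add_cancel, Complex.norm_I] at h3
    linarith
  have hvb : ∀ᵐ t, ‖v t‖ ≤ (δ + 1) * Real.exp (-lo) := by
    filter_upwards [hωb] with t ht
    have e : v t = -(ω t * (γ t - 1)) := by
      simp only [hω]
      have := hne t
      field_simp
    rw [e, norm_neg, norm_mul]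
    exact mul_le_mul ht (hs t).2.le (norm_nonneg _) ((norm_nonneg _).trans ht)
  have hpair : ∀ s t : ℝ, IntervalIntegrable (fun r => (ω r, v r)) volume s t := fun s t =>
    ⟨(hωi s t).1.prodMk (hv s t).1, (hωi s t).2.prodMk (hv s t).2⟩
  have hpi : ∀ s t : ℝ, (W t, γ t) = (W s, γ s) + ∫ r in s..t, (ω r, v r) := fun s t => by
    apply Prod.ext
    · have := (ContinuousLinearMap.fst ℝ ℂ ℂ).intervalIntegral_comp_comm (hpair s t)
      simp only [ContinuousLinearMap.coe_fst'] at this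
      rw [Prod.fst_add, ← this]
      change W t = W s + _
      rw [hWi t, hWi s, add_assoc,
        intervalIntegral.integral_add_adjacent_intervals (hωi _ _) (hωi _ _)]
    · have := (ContinuousLinearMap.snd ℝ ℂ ℂ).intervalIntegral_comp_comm (hpair s t)
      simp only [ContinuousLinearMap.coe_snd'] at this
      rw [Prod.snd_add, ← this]
      change γ t = γ s + _
      rw [hγi t, hγi s, add_assoc,
        intervalIntegral.integral_add_adjacent_intervals (hv _ _) (hv _ _)]
  let D : ℂ × ℂ → (ℂ × ℂ →L[ℝ] ℂ) := fun p =>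
    exp p.1 • ContinuousLinearMap.snd ℝ ℂ ℂ + (p.2 - 1) • exp p.1 • ContinuousLinearMap.fst ℝ ℂ ℂ
  have hD : ∀ p : ℂ × ℂ, HasFDerivAt (fun p : ℂ × ℂ => exp p.1 * (p.2 - 1)) (D p) p := fun p =>
    (hasFDerivAt_fst.cexp).mul (hasFDerivAt_snd.sub_const 1)
  have hDc : Continuous (fun t => D (W t, γ t)) :=
    ((Complex.continuous_exp.comp hWc).smul continuous_const).add
      ((hγc.sub continuous_const).smul ((Complex.continuous_exp.comp hWc).smul continuous_const))
  have hconst : ∀ s t : ℝ, s ≤ t → exp (W t) * (γ t - 1) = exp (W s) * (γ s - 1) := by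
    intro s t hst
    have := (comp_eq_add_integral_of_primitive (f := fun p : ℂ × ℂ => exp p.1 * (p.2 - 1)) (f' := D)
      (u := fun t => (W t, γ t)) (ω := fun t => (ω t, v t))
      (K := max (δ + 1) ((δ + 1) * Real.exp (-lo))) hst (hpair s t) (by
        filter_upwards [hωb, hvb] with r h1 h2 _
        exact max_le_max h1 h2) (fun t _ => hpi s t) (fun t _ => hD _) hDc.continuousOn).2 t
        ⟨hst, le_rfl⟩
    simp only at this
    rw [this, add_eq_left]
    have h0 : ∀ r, D (W r, γ r) (ω r, v r) = 0 := fun r => by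
      simp only [D, hω, add_apply, smul_apply, ContinuousLinearMap.coe_fst',
        ContinuousLinearMap.coe_snd', smul_eq_mul]
      have := hne r
      field_simp
      ring
    simp only [h0, intervalIntegral.integral_zero]
  have h1 : exp (W 0) * (γ 0 - 1) = 1 := by
    rw [hW0, Complex.exp_neg, Complex.exp_log (hne 0), inv_mul_cancel₀ (hne 0)]
  have hexp : ∀ t, exp (-W t) = γ t - 1 := fun t => by
    have h2 : exp (W t) * (γ t - 1) = 1 := by
      rcases le_total 0 t with h | h
      · rw [hconst 0 t h, h1]
      · rw [← hconst t 0 h, h1]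
    rw [Complex.exp_neg]
    rw [inv_eq_iff_eq_inv]
    exact eq_inv_of_mul_eq_one_left h2
  refine ⟨W, ω, isLift_of_forall hωi ?_ hWi, fun t => by rw [toPlane, hexp]; ring,
    fun t => hre t _ (hexp t), hWc⟩
  filter_upwards [hvf] with t ht
  exact hmem t _ (hexp t) ht

namespace Model

variable {M : Model}

/-- The only periodic solution in the annulus whose sections avoid all zeros of
`half ε - half (-ε)` other than `y₀` is the closed orbit through `y₀ + iπ`. -/
theorem Good.range_eq_orbit {C ε : ℝ} (h : M.Good C ε) (h' : M.Good C (-ε)) {γ : ℝ → ℂ} {T : ℝ}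
    (hγ : IsPeriodicSolution (field (perturbation M.coef) ε) γ T)
    (hs : ∀ t, ‖γ t - 1‖ ∈ Ioo (Real.exp (-M.hi)) (Real.exp (-M.lo))) {y₀ : ℝ}
    (hsec : ∀ t, ∀ y : ℝ, γ t = toPlane (y + Real.pi * I) →
      y ∈ M.core ∧ (M.half ε y = M.half (-ε) y → y = y₀)) :
    range γ = M.orbit ε y₀ := by
  obtain ⟨hT, hsol, hper, -⟩ := hγ
  obtain ⟨W, ω, hW, hWγ, hre, hWc⟩ := exists_lift_of_isSolution h.small.strip hsol hs
  have hpi := Real.pi_pos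
  have hmono : ∀ s t : ℝ, s ≤ t → (W s).im + (t - s) / 2 ≤ (W t).im := fun s t hst =>
    (hW s t).im_mono h.small.strip (by linarith [h.small.δ_le]) (fun t _ => hre t) le_rfl hst le_rfl
  have hsm : StrictMono (fun t => (W t).im) := fun s t hst => by
    have := hmono s t hst.le
    simp only
    linarith
  have hsurj : Function.Surjective (fun t => (W t).im) := by
    refine (Complex.continuous_im.comp hWc).surjective ?_ ?_
    · refine tendsto_atTop_mono' atTop (f₁ := fun t => (W 0).im + (t - 0) / 2) ?_ ?_
      · filter_upwards [eventually_ge_atTop 0] with t ht using hmono 0 t ht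
      · exact tendsto_atTop_add_const_left _ _ (by
          simpa using tendsto_id.atTop_div_const (two_pos : (0 : ℝ) < 2))
    · refine tendsto_atBot_mono' atBot (f₁ := fun t => (W 0).im + (t - 0) / 2) ?_ ?_
      · filter_upwards [eventually_le_atBot 0] with t ht
        have := hmono t 0 ht
        simp only [Function.comp_apply]
        linarith
      · exact tendsto_atBot_add_const_left _ _ (by
          simpa using tendsto_id.atBot_div_const (two_pos : (0 : ℝ) < 2))
  choose τ hτ using fun n : ℤ => hsurj ((2 * n + 1) * Real.pi)
  simp only at hτ
  set y : ℤ → ℝ := fun n => (W (τ n)).re with hy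
  have hWτ : ∀ n, W (τ n) = y n + Real.pi * I + n * (2 * Real.pi * I) := fun n => by
    apply Complex.ext
    · simp [hy]
    · simp [hτ n]; ring
  have hcore : ∀ n, y n ∈ M.core ∧ (M.half ε (y n) = M.half (-ε) (y n) → y n = y₀) := fun n =>
    hsec (τ n) (y n) (by rw [← hWγ, hWτ, toPlane_add_two_pi])
  have hτlt : ∀ n, τ n ≤ τ (n + 1) := fun n => by
    refine (hsm.lt_iff_lt.1 ?_).le
    simp only [hτ]
    push_cast
    nlinarith
  have hturn : ∀ n : ℤ, M.half (-ε) (y n) = M.half ε (y (n + 1)) ∧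
      (fun t => W t + (-(n + 1) : ℤ) * (2 * Real.pi * I)) '' Icc (τ n) (τ (n + 1))
        = starRingEnd ℂ '' M.arc (-ε) (y n) ∪ M.arc ε (y (n + 1)) := fun n => by
    have := h.turn h' ((hW (τ n) (τ (n + 1))).add_two_pi (-(n + 1))) (hτlt n)
      (fun t _ => by simpa using hre t) (by simp [hτ n]; ring) (by simp [hτ (n + 1)]; ring)
    simpa [hy] using this
  -- A period of `γ` may contain several turns, `m` of them; so a priori the sequence of section
  -- abscissae is only periodic.
  have hperiod : ∀ n : ℤ, ∃ m : ℕ, 0 < m ∧ y (n + m) = y n := fun n => by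
    obtain ⟨m, hm⟩ := toPlane_eq_iff.1 ((hWγ (τ n + T)).trans ((hper (τ n)).trans (hWγ (τ n)).symm))
    have him : (W (τ n + T)).im = (2 * (n + m : ℤ) + 1) * Real.pi := by
      rw [hm]
      simp [hτ n]; ring
    have hmpos : 0 < m := by
      have h1 := hsm (show τ n < τ n + T by linarith)
      simp only [him, hτ n] at h1
      have h2 : (0 : ℝ) < m := by
        push_cast at h1
        by_contra! hle
        nlinarith
      exact_mod_cast h2
    have heq : τ n + T = τ (n + m) := hsm.injective (show (W (τ n + T)).im = (W (τ (n + m))).im by rw [him, hτ])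
    refine ⟨m.toNat, by omega, ?_⟩
    rw [Int.toNat_of_nonneg hmpos.le]
    simp only [hy]
    rw [← heq, hm]
    simp
  -- Both half maps are increasing, so a strict inequality between consecutive abscissae propagates
  -- with the same direction. A periodic sequence of this kind must be constant.
  have hstep : ∀ n : ℤ, y n < y (n + 1) → y (n + 1) < y (n + 1 + 1) := fun n hn => by
    rw [← h.half_mono.lt_iff_lt (hcore _).1 (hcore _).1, ← (hturn n).1, ← (hturn (n + 1)).1]
    exact h'.half_mono (hcore _).1 (hcore _).1 hn
  have hstep' : ∀ n : ℤ, y (n + 1) < y n → y (n + 1 + 1) < y (n + 1) := fun n hn => by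
    rw [← h.half_mono.lt_iff_lt (hcore _).1 (hcore _).1, ← (hturn n).1, ← (hturn (n + 1)).1]
    exact h'.half_mono (hcore _).1 (hcore _).1 hn
  have hfix : ∀ n : ℤ, y (n + 1) = y n := fun n => by
    obtain ⟨m, hm, hmn⟩ := hperiod n
    rcases lt_trichotomy (y n) (y (n + 1)) with hlt | heq | hgt
    · have hk : ∀ k : ℕ, y (n + k) < y (n + k + 1) := fun k => by
        induction k with
        | zero => simpa using hlt
        | succ k ih =>
          have := hstep _ ih
          push_cast
          rwa [← add_assoc]
      have hmon : StrictMono (fun k : ℕ => y (n + k)) := strictMono_nat_of_lt_succ fun k => by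
        have := hk k
        push_cast
        rwa [← add_assoc]
      have := hmon hm
      simp only [hmn, Nat.cast_zero, add_zero, lt_irrefl] at this
    · exact heq.symm
    · have hk : ∀ k : ℕ, y (n + k + 1) < y (n + k) := fun k => by
        induction k with
        | zero => simpa using hgt
        | succ k ih =>
          have := hstep' _ ih
          push_cast
          rwa [← add_assoc]
      have hmon : StrictAnti (fun k : ℕ => y (n + k)) := strictAnti_nat_of_succ_lt fun k => by
        have := hk k
        push_cast
        rwa [← add_assoc]
      have := hmon hm
      simp only [hmn, Nat.cast_zero, add_zero, lt_irrefl] at this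
  have hy₀ : ∀ n, y n = y₀ := fun n => (hcore n).2 (by rw [(hturn n).1, hfix n])
  have himg : ∀ n : ℤ, (fun t => W t + (-(n + 1) : ℤ) * (2 * Real.pi * I)) '' Icc (τ n) (τ (n + 1))
      = M.loop ε y₀ := fun n => by rw [(hturn n).2, hy₀, hy₀, loop]
  apply Subset.antisymm
  · rintro _ ⟨t, rfl⟩
    set n : ℤ := ⌊((W t).im / Real.pi - 1) / 2⌋ with hn
    have h1 := Int.floor_le (((W t).im / Real.pi - 1) / 2)
    have h2 := Int.lt_floor_add_one (((W t).im / Real.pi - 1) / 2)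
    rw [← hn] at h1 h2
    have e : (W t).im = (W t).im / Real.pi * Real.pi := by field_simp
    have ht : t ∈ Icc (τ n) (τ (n + 1)) := by
      constructor
      · rw [← hsm.le_iff_le]
        rw [hτ, e]
        exact mul_le_mul_of_nonneg_right (by linarith) hpi.le
      · rw [← hsm.le_iff_le]
        rw [hτ, e]
        push_cast
        exact mul_le_mul_of_nonneg_right (by linarith) hpi.le
    refine ⟨W t + (-(n + 1) : ℤ) * (2 * Real.pi * I), ?_, ?_⟩
    · rw [← himg n]; exact ⟨t, ht, rfl⟩
    · rw [toPlane_add_two_pi, hWγ]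
  · rintro _ ⟨V, hV, rfl⟩
    rw [← himg 0] at hV
    obtain ⟨t, -, rfl⟩ := hV
    exact ⟨t, by rw [toPlane_add_two_pi, hWγ]⟩

end Model

/-! ### The displacement function, isolation of orbits, and bifurcation. -/

theorem mul_pos_of_abs_sub_lt {x y : ℝ} (h : |x - y| < |y|) : 0 < x * y := by
  rcases lt_trichotomy y 0 with hy | hy | hy
  · rw [abs_of_neg hy, abs_lt] at h
    exact mul_pos_of_neg_of_neg (by linarith) hy
  · rw [hy, abs_zero] at h
    exact absurd h (abs_nonneg _).not_gt
  · rw [abs_of_pos hy, abs_lt] at h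
    exact mul_pos (by linarith) hy

theorem dist_toPlane_le {lo hi : ℝ} {V W : ℂ} (hV : V.re ∈ Ioo lo hi) (hW : W.re ∈ Ioo lo hi) :
    dist (toPlane V) (toPlane W) ≤ Real.exp (-lo) * ‖V - W‖ := by
  have hconv : Convex ℝ {W : ℂ | W.re ∈ Ioo lo hi} :=
    (convex_Ioo lo hi).linear_preimage Complex.reLm
  have := hconv.norm_image_sub_le_of_norm_hasDerivWithin_le (f := toPlane)
    (f' := fun W => -exp (-W)) (C := Real.exp (-lo)) (fun W _ => by
      have h1 : HasDerivAt toPlane (exp (-W) * (-1)) W :=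
        ((hasDerivAt_id W).neg.cexp).const_add (1 : ℂ)
      rw [mul_neg_one] at h1
      exact h1.hasDerivWithinAt) (fun W hW => by
      rw [norm_neg, Complex.norm_exp]
      exact Real.exp_le_exp.2 (by simpa using (show W.re ∈ Ioo lo hi from hW).1.le)) hW hV
  rwa [dist_eq_norm]

theorem toPlane_add_pi (y : ℝ) : toPlane (y + Real.pi * I) = 1 - Real.exp (-y) := by
  have : -((y : ℂ) + Real.pi * I) = -y + -(Real.pi * I) := by ring
  rw [toPlane, this, Complex.exp_add, Complex.exp_neg (Real.pi * I), Complex.exp_pi_mul_I]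
  push_cast
  norm_num
  ring

theorem norm_toPlane_sub_one (V : ℂ) : ‖toPlane V - 1‖ = Real.exp (-V.re) := by
  rw [toPlane, add_sub_cancel_left, Complex.norm_exp, Complex.neg_re]

namespace Model

variable {M : Model}

/-- The displacement function. -/
noncomputable def disp (M : Model) (ε y : ℝ) : ℝ := M.half ε y - M.half (-ε) y

theorem disp_eq_zero {ε y : ℝ} : M.disp ε y = 0 ↔ M.half ε y = M.half (-ε) y := sub_eq_zero

theorem disp_zero_left (y : ℝ) : M.disp 0 y = 0 := by simp [disp]

theorem Good.disp_analytic {C ε : ℝ} (h : M.Good C ε) (h' : M.Good C (-ε)) :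
    AnalyticOnNhd ℝ (M.disp ε) M.core := fun y hy =>
  (h.half_analytic y hy).sub (h'.half_analytic y hy)

/-- The displacement differs from `2ε M(y)` by at most `2Cε²`, which the main term dominates. -/
theorem Good.disp_mul_pos {C ε : ℝ} (h : M.Good C ε) (h' : M.Good C (-ε)) {y : ℝ} (hy : y ∈ M.core)
    (hε : ε ≠ 0) (hlt : C * |ε| < |M.melnikov y|) : 0 < M.disp ε y * (2 * ε * M.melnikov y) := by
  apply mul_pos_of_abs_sub_lt
  have h1 := h.half_approx y hy
  have h2 := h'.half_approx y hy
  rw [neg_sq] at h2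
  have e : M.disp ε y - 2 * ε * M.melnikov y = (M.half ε y - y - ε * M.melnikov y)
      - (M.half (-ε) y - y - -ε * M.melnikov y) := by rw [disp]; ring
  rw [e]
  have hpos : 0 < |ε| := abs_pos.2 hε
  have e2 : |2 * ε * M.melnikov y| = 2 * |ε| * |M.melnikov y| := by
    rw [abs_mul, abs_mul, abs_two]
  rw [e2]
  refine (abs_sub _ _).trans_lt ?_
  rw [← sq_abs] at h1 h2
  nlinarith

/-- For small `ε` the displacement changes sign where the Melnikov function does. -/
theorem disp_mul_neg {C ε : ℝ} (h : M.Good C ε) (h' : M.Good C (-ε)) {p q : ℝ} (hp : p ∈ M.core)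
    (hq : q ∈ M.core) (hε : ε ≠ 0) (hlp : C * |ε| < |M.melnikov p|)
    (hlq : C * |ε| < |M.melnikov q|) (hpq : M.melnikov p * M.melnikov q < 0) :
    M.disp ε p * M.disp ε q < 0 := by
  have h1 := mul_pos (h.disp_mul_pos h' hp hε hlp) (h.disp_mul_pos h' hq hε hlq)
  have e : M.disp ε p * (2 * ε * M.melnikov p) * (M.disp ε q * (2 * ε * M.melnikov q))
      = (M.disp ε p * M.disp ε q) * ((4 * ε ^ 2) * (M.melnikov p * M.melnikov q)) := by ring
  rw [e] at h1
  have h2 : (4 * ε ^ 2) * (M.melnikov p * M.melnikov q) < 0 :=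
    mul_neg_of_pos_of_neg (by positivity) hpq
  by_contra! hge
  exact absurd h1 (mul_nonpos_of_nonneg_of_nonpos hge h2.le).not_gt

theorem core_subset : M.core ⊆ Ioo M.lo M.hi :=
  Ioo_subset_Ioo (by linarith [M.η_pos]) (by linarith [M.η_pos])

/-- A closed orbit meets the ray `Im W ≡ π` once, so different zeros give different orbits. -/
theorem Good.mem_orbit {C ε : ℝ} (h : M.Good C ε) (h' : M.Good C (-ε)) {y y' : ℝ}
    (hy : y ∈ M.core) (h0 : M.disp ε y = 0) : toPlane (y' + Real.pi * I) ∈ M.orbit ε y ↔ y' = y := by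
  obtain ⟨D, -, hD⟩ := M.loop_spec
  obtain ⟨h1, h2⟩ := hD C ε h h' y hy (disp_eq_zero.1 h0)
  have hpi := Real.pi_pos
  constructor
  · rintro ⟨V, hV, hVy⟩
    obtain ⟨n, hn⟩ := toPlane_eq_iff.1 hVy
    obtain ⟨-, -, h3, h4⟩ := h1 V hV
    have him : V.im = (2 * n + 1) * Real.pi := by rw [hn]; simp; ring
    have hre : V.re = y' := by rw [hn]; simp
    rw [← hre]
    apply h4
    refine le_antisymm h3 ?_
    rw [him, abs_mul, abs_of_pos hpi]
    refine le_mul_of_one_le_left hpi.le ?_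
    have : (1 : ℤ) ≤ |2 * n + 1| := Int.one_le_abs (by omega)
    exact_mod_cast this
  · rintro rfl
    obtain ⟨V, hV, hVi⟩ := h2 Real.pi (by rw [abs_of_pos hpi])
    have hre := (h1 V hV).2.2.2 (by rw [hVi, abs_of_pos hpi])
    refine ⟨V, hV, ?_⟩
    congr 1
    apply Complex.ext <;> simp [hVi, hre]

/-- The point `p` shows that the analytic displacement is not identically zero, so `y` is an
isolated zero. -/
theorem Good.isLimitCycle {C ε : ℝ} (h : M.Good C ε) (h' : M.Good C (-ε)) {y p : ℝ}
    (hy : y ∈ M.core) (h0 : M.disp ε y = 0) (hp : p ∈ M.core) (hp0 : M.disp ε p ≠ 0) :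
    IsLimitCycle (field (perturbation M.coef) ε) (M.orbit ε y) := by
  refine ⟨h.isPeriodicOrbit h' hy (disp_eq_zero.1 h0), ?_⟩
  obtain ⟨D, -, hD⟩ := M.loop_spec
  obtain ⟨hloop, -⟩ := hD C ε h h' y hy (disp_eq_zero.1 h0)
  have han := h.disp_analytic h'
  have hne : ∀ᶠ z in 𝓝[≠] y, M.disp ε z ≠ 0 := by
    rcases (han y hy).eventually_eq_zero_or_eventually_ne_zero with h3 | h3
    · exact absurd (han.eqOn_zero_of_preconnected_of_eventuallyEq_zero isPreconnected_Ioo hy h3 hp)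
        hp0
    · exact h3
  obtain ⟨d₁, hd₁, hne⟩ := Metric.mem_nhdsWithin_iff.1 hne
  obtain ⟨d₂, hd₂, hcore⟩ := Metric.isOpen_iff.1 (isOpen_Ioo : IsOpen M.core) y hy
  set d := min d₁ d₂ with hd
  have hd0 : 0 < d := lt_min hd₁ hd₂
  set A : Set ℂ := {z | ‖z - 1‖ ∈ Ioo (Real.exp (-M.hi)) (Real.exp (-M.lo))} with hA
  -- The neighbourhood is the annulus `A` with the section ray removed except for a window around
  -- `y`. Solutions in it can meet the section only where `y` is the sole zero.
  set B : Set ℂ := {z | z.im = 0} ∩ ({z | z.re ≤ 1} ∩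
    {z | ‖z - 1‖ ∈ (Ioo (Real.exp (-(y + d))) (Real.exp (-(y - d))))ᶜ}) with hB
  have hnc : Continuous (fun z : ℂ => ‖z - 1‖) := by fun_prop
  have hAo : IsOpen A := isOpen_Ioo.preimage hnc
  have hBc : IsClosed B := (isClosed_eq Complex.continuous_im continuous_const).inter
    ((isClosed_le Complex.continuous_re continuous_const).inter
      (isOpen_Ioo.isClosed_compl.preimage hnc))
  refine ⟨A ∩ Bᶜ, hAo.inter hBc.isOpen_compl, ?_, fun γ T hγ hU => ?_⟩
  · rintro _ ⟨V, hV, rfl⟩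
    obtain ⟨h3, -, h4, h5⟩ := hloop V hV
    refine ⟨?_, fun hVB => ?_⟩
    · change ‖toPlane V - 1‖ ∈ Ioo _ _
      rw [norm_toPlane_sub_one]
      exact ⟨Real.exp_lt_exp.2 (by linarith [h3.2]), Real.exp_lt_exp.2 (by linarith [h3.1])⟩
    · obtain ⟨hi, hr, hn⟩ := hVB
      have hi' : (toPlane V).im = 0 := hi
      have hr' : (toPlane V).re ≤ 1 := hr
      have hpos := Real.exp_pos (-V.re)
      have hsin : Real.sin V.im = 0 := by
        simpa [toPlane, Complex.exp_im, hpos.ne'] using hi'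
      have hcos : Real.cos V.im ≤ 0 := by
        simp [toPlane, Complex.exp_re] at hr'
        by_contra! hc
        exact absurd hr' (mul_pos hpos hc).not_ge
      have habs : |V.im| = Real.pi := by
        obtain ⟨k, hk⟩ := Real.sin_eq_zero_iff.1 hsin
        have hk0 : k ≠ 0 := by
          rintro rfl
          simp only [Int.cast_zero, zero_mul] at hk
          rw [← hk, Real.cos_zero] at hcos
          linarith
        refine le_antisymm h4 ?_
        rw [← hk, abs_mul, abs_of_pos Real.pi_pos]
        refine le_mul_of_one_le_left Real.pi_pos.le ?_
        have : (1 : ℤ) ≤ |k| := Int.one_le_abs hk0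
        exact_mod_cast this
      refine hn ?_
      rw [norm_toPlane_sub_one, h5 habs]
      exact ⟨Real.exp_lt_exp.2 (by linarith), Real.exp_lt_exp.2 (by linarith)⟩
  · refine h.range_eq_orbit h' hγ (fun t => (hU ⟨t, rfl⟩).1) fun t z hz => ?_
    have hB' := (hU ⟨t, rfl⟩).2
    rw [hz, toPlane_add_pi] at hB'
    have hn : ‖(1 - Real.exp (-z) : ℂ) - 1‖ = Real.exp (-z) := by
      rw [sub_sub_cancel_left, norm_neg, Complex.norm_real, Real.norm_eq_abs, Real.abs_exp]
    have hzd : |z - y| < d := by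
      by_contra! hge
      refine hB' ⟨?_, ?_, fun hmem => ?_⟩
      · change ((1 : ℂ) - Real.exp (-z)).im = 0
        rw [Complex.sub_im, Complex.ofReal_im, Complex.one_im, sub_zero]
      · change ((1 : ℂ) - Real.exp (-z)).re ≤ 1
        rw [Complex.sub_re, Complex.ofReal_re, Complex.one_re]
        linarith [Real.exp_pos (-z)]
      · have hmem' : ‖(1 - Real.exp (-z) : ℂ) - 1‖ ∈
          Ioo (Real.exp (-(y + d))) (Real.exp (-(y - d))) := hmem
        rw [hn] at hmem'
        have a1 := Real.exp_lt_exp.1 hmem'.1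
        have a2 := Real.exp_lt_exp.1 hmem'.2
        have : |z - y| < d := abs_lt.2 ⟨by linarith, by linarith⟩
        linarith
    refine ⟨hcore (hzd.trans_le (min_le_right _ _)), fun heq => ?_⟩
    by_contra hzy
    exact hne ⟨hzd.trans_le (min_le_left _ _), hzy⟩ (disp_eq_zero.2 heq)

/-- Points of the two loops at the same height are compared; for `ε = 0` the loop lies on the line
`Re W = Y`. -/
theorem hausdorffEDist_orbit_le (M : Model) : ∃ K, 0 ≤ K ∧ ∀ C ε, M.Good C 0 → M.Good C ε →
    M.Good C (-ε) → ∀ y ∈ M.core, ∀ Y ∈ M.core, M.disp ε y = 0 →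
    Metric.hausdorffEDist (M.orbit ε y) (M.orbit 0 Y) ≤ ENNReal.ofReal (K * (|ε| + |y - Y|)) := by
  obtain ⟨D, hD0, hD⟩ := M.loop_spec
  refine ⟨Real.exp (-M.lo) * (D + 1), by positivity, fun C ε h0 h h' y hy Y hY hz => ?_⟩
  obtain ⟨a1, a2⟩ := hD C ε h h' y hy (disp_eq_zero.1 hz)
  obtain ⟨b1, b2⟩ := hD C 0 h0 (by rwa [neg_zero]) Y hY (by rw [neg_zero])
  have key : ∀ V ∈ M.loop ε y, ∀ V' ∈ M.loop 0 Y, V.im = V'.im → edist (toPlane V) (toPlane V') ≤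
      ENNReal.ofReal (Real.exp (-M.lo) * (D + 1) * (|ε| + |y - Y|)) := fun V hV V' hV' him => by
    rw [edist_dist]
    refine ENNReal.ofReal_le_ofReal ((dist_toPlane_le (a1 V hV).1 (b1 V' hV').1).trans ?_)
    rw [mul_assoc]
    refine mul_le_mul_of_nonneg_left ?_ (Real.exp_pos _).le
    have c1 := (a1 V hV).2.1
    have c2 := (b1 V' hV').2.1
    rw [abs_zero, mul_zero] at c2
    have c3 : V'.re = Y := sub_eq_zero.1 (abs_nonpos_iff.1 c2)
    refine (Complex.norm_le_abs_re_add_abs_im _).trans ?_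
    rw [Complex.sub_re, Complex.sub_im, him, sub_self, abs_zero, add_zero, c3]
    have c4 := abs_sub_le V.re y Y
    have := abs_nonneg ε
    have := abs_nonneg (y - Y)
    nlinarith
  refine Metric.hausdorffEDist_le_of_mem_edist ?_ ?_
  · rintro _ ⟨V, hV, rfl⟩
    obtain ⟨V', hV', him⟩ := b2 V.im (a1 V hV).2.2.1
    exact ⟨_, ⟨V', hV', rfl⟩, key V hV V' hV' him.symm⟩
  · rintro _ ⟨V', hV', rfl⟩
    obtain ⟨V, hV, him⟩ := a2 V'.im (b1 V' hV').2.2.1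
    exact ⟨_, ⟨V, hV, rfl⟩, by rw [edist_comm]; exact key V hV V' hV' him⟩

/-- Each sign change of the Melnikov function produces a limit cycle. -/
theorem limitCyclesBifurcate (M : Model) {n : ℕ} {P : Set ℂ → Prop} (s : Fin (n + 1) → ℝ)
    (hs : StrictMono s) (hcore : ∀ j, s j ∈ M.core) (hk : AnalyticOnNhd ℝ M.melnikov M.core)
    (hsign : ∀ i : Fin n, M.melnikov (s i.castSucc) * M.melnikov (s i.succ) < 0)
    (hP : ∀ Γ : Set ℂ, (∀ z ∈ Γ, ∃ W : ℂ, W.re ∈ Ioo M.lo M.hi ∧ toPlane W = z) →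
      (∃ x ∈ Ioo M.lo M.hi, toPlane (x : ℝ) ∈ Γ) →
      (∃ y ∈ Ioo M.lo M.hi, toPlane ((y : ℝ) + Real.pi * I) ∈ Γ) → P Γ) :
    LimitCyclesBifurcate n P := by
  have hsub : ∀ i : Fin n, Icc (s i.castSucc) (s i.succ) ⊆ M.core := fun i =>
    ordConnected_Ioo.out (hcore _) (hcore _)
  have hlt : ∀ i : Fin n, s i.castSucc < s i.succ := fun i => hs (Fin.castSucc_lt_succ)
  choose Y hYI hY0 hYs using fun i : Fin n =>
    exists_sign_change (hlt i) (hk.mono (hsub i)) (hsign i)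
  obtain ⟨C, hC, hgood⟩ := M.eventually_good
  have hgood2 : ∀ᶠ ε in 𝓝 (0 : ℝ), M.Good C ε ∧ M.Good C (-ε) := by
    have : Tendsto (fun ε : ℝ => -ε) (𝓝 0) (𝓝 0) := by
      simpa using (continuous_neg (G := ℝ)).tendsto 0
    exact hgood.and (this.eventually hgood)
  have hg0 : M.Good C 0 := hgood.self_of_nhds
  have hneg : ∀ p ∈ M.core, ∀ q ∈ M.core, M.melnikov p * M.melnikov q < 0 →
      ∀ᶠ ε in 𝓝 (0 : ℝ), ε ≠ 0 → M.disp ε p * M.disp ε q < 0 := by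
    intro p hp q hq hpq
    have hp0 : M.melnikov p ≠ 0 := fun h => by rw [h, zero_mul] at hpq; exact lt_irrefl _ hpq
    have hq0 : M.melnikov q ≠ 0 := fun h => by rw [h, mul_zero] at hpq; exact lt_irrefl _ hpq
    filter_upwards [hgood2, eventually_mul_abs_lt C (abs_pos.2 hp0),
      eventually_mul_abs_lt C (abs_pos.2 hq0)] with ε h h1 h2 hε
    exact disp_mul_neg h.1 h.2 hp hq hε h1 h2 hpq
  have hzero : ∀ ε, M.Good C ε → M.Good C (-ε) → ∀ p ∈ M.core, ∀ q ∈ M.core, p ≤ q →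
      M.disp ε p * M.disp ε q < 0 → ∃ y ∈ Icc p q, M.disp ε y = 0 := by
    intro ε h h' p hp q hq hpq hlt
    have hc : ContinuousOn (M.disp ε) (uIcc p q) := by
      rw [uIcc_of_le hpq]
      exact ((h.disp_analytic h').mono (ordConnected_Ioo.out hp hq)).continuousOn
    have h0 : (0 : ℝ) ∈ uIcc (M.disp ε p) (M.disp ε q) := by
      rw [mem_uIcc]
      rcases mul_neg_iff.1 hlt with h1 | h1
      · exact Or.inr ⟨h1.2.le, h1.1.le⟩
      · exact Or.inl ⟨h1.1.le, h1.2.le⟩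
    obtain ⟨y, hy, hy0⟩ := intermediate_value_uIcc hc h0
    rw [uIcc_of_le hpq] at hy
    exact ⟨y, hy, hy0⟩
  -- Choosing the zero closest to `Y i` gives convergence: `M` changes sign arbitrarily close to `Y
  -- i`, so for small `ε ≠ 0` some zero of the displacement is that close, and the chosen one is no
  -- farther.
  have hchoice : ∀ ε, ∀ i : Fin n, ∃ y : ℝ, M.Good C ε → M.Good C (-ε) →
      (∃ z ∈ Icc (s i.castSucc) (s i.succ), M.disp ε z = 0) →
      (y ∈ Icc (s i.castSucc) (s i.succ) ∧ M.disp ε y = 0) ∧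
      ∀ z ∈ Icc (s i.castSucc) (s i.succ), M.disp ε z = 0 → |y - Y i| ≤ |z - Y i| := by
    intro ε i
    by_cases hall : M.Good C ε ∧ M.Good C (-ε) ∧
      (∃ z ∈ Icc (s i.castSucc) (s i.succ), M.disp ε z = 0)
    · obtain ⟨h, h', z, hz, hz0⟩ := hall
      have hc : ContinuousOn (M.disp ε) (Icc (s i.castSucc) (s i.succ)) :=
        ((h.disp_analytic h').mono (hsub i)).continuousOn
      have hcl := hc.preimage_isClosed_of_isClosed isClosed_Icc (isClosed_singleton (x := (0 : ℝ)))
      have hcomp := isCompact_Icc.of_isClosed_subset hcl inter_subset_left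
      obtain ⟨y, hy, hymin⟩ := hcomp.exists_isMinOn ⟨z, hz, hz0⟩
        (f := fun z => |z - Y i|) (by fun_prop)
      exact ⟨y, fun _ _ _ => ⟨⟨hy.1, hy.2⟩, fun z hz hz0 => hymin ⟨hz, hz0⟩⟩⟩
    · exact ⟨0, fun h h' hz => absurd ⟨h, h', hz⟩ hall⟩
  choose y hy using hchoice
  have hall : ∀ᶠ ε in 𝓝 (0 : ℝ), (M.Good C ε ∧ M.Good C (-ε)) ∧
      ∀ i : Fin n, ε ≠ 0 → M.disp ε (s i.castSucc) * M.disp ε (s i.succ) < 0 :=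
    hgood2.and (eventually_all.2 fun i => hneg _ (hcore _) _ (hcore _) (hsign i))
  obtain ⟨ε₀, hε₀, hev⟩ := Metric.eventually_nhds_iff.1 hall
  have hYc : ∀ i, Y i ∈ M.core := fun i => hsub i (Ioo_subset_Icc_self (hYI i))
  have hPorb : ∀ ε y, M.Good C ε → M.Good C (-ε) → y ∈ M.core → M.disp ε y = 0 →
      P (M.orbit ε y) := by
    intro ε y h h' hy hy0
    obtain ⟨D, -, hD⟩ := M.loop_spec
    obtain ⟨a1, a2⟩ := hD C ε h h' y hy (disp_eq_zero.1 hy0)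
    refine hP _ ?_ ?_ ⟨y, core_subset hy, (h.mem_orbit h' hy hy0).2 rfl⟩
    · rintro _ ⟨V, hV, rfl⟩
      exact ⟨V, (a1 V hV).1, rfl⟩
    · obtain ⟨V, hV, hV0⟩ := a2 0 (by simp [Real.pi_pos.le])
      refine ⟨V.re, (a1 V hV).1, V, hV, ?_⟩
      congr 1
      apply Complex.ext <;> simp [hV0]
  have hg0' : M.Good C (-0) := by rwa [neg_zero]
  have hfacts : ∀ ε, 0 < |ε| → |ε| < ε₀ → M.Good C ε ∧ M.Good C (-ε) ∧
      ∀ i, (y ε i ∈ Icc (s i.castSucc) (s i.succ) ∧ M.disp ε (y ε i) = 0) ∧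
        M.disp ε (s i.castSucc) ≠ 0 ∧ M.disp ε (s i.succ) ≠ 0 := by
    intro ε hpos hlt'
    obtain ⟨⟨h, h'⟩, hd⟩ := hev (by simpa using hlt')
    refine ⟨h, h', fun i => ?_⟩
    have hd := hd i (abs_pos.1 hpos)
    refine ⟨(hy ε i h h' (hzero ε h h' _ (hcore _) _ (hcore _) (hlt i).le hd)).1, ?_, ?_⟩
    · intro h0; rw [h0, zero_mul] at hd; exact lt_irrefl _ hd
    · intro h0; rw [h0, mul_zero] at hd; exact lt_irrefl _ hd
  have hord : ∀ i j : Fin n, i < j → s i.succ ≤ s j.castSucc := fun i j hij =>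
    hs.monotone (Fin.succ_le_castSucc_iff.2 hij)
  refine ⟨perturbation M.coef, fun i => M.orbit 0 (Y i), ?_, fun i => ⟨?_, ?_⟩, ε₀,
    fun ε i => M.orbit ε (y ε i), hε₀, fun ε hpos hlt' => ⟨?_, fun i => ⟨?_, ?_⟩⟩, fun i => ?_⟩
  · have hmon : StrictMono Y := fun i j hij =>
      ((hYI i).2.trans_le (hord i j hij)).trans (hYI j).1
    intro i j hij
    apply hmon.injective
    have := (hg0.mem_orbit hg0' (hYc i) (disp_zero_left _)).2 rfl
    have e : M.orbit 0 (Y i) = M.orbit 0 (Y j) := hij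
    rw [e] at this
    exact (hg0.mem_orbit hg0' (hYc j) (disp_zero_left _)).1 this
  · exact hg0.isPeriodicOrbit hg0' (hYc i) (disp_eq_zero.1 (disp_zero_left _))
  · exact hPorb 0 _ hg0 hg0' (hYc i) (disp_zero_left _)
  · obtain ⟨h, h', hf⟩ := hfacts ε hpos hlt'
    have hmon : StrictMono (y ε) := fun i j hij => by
      have h1 := (hf i).1.1.2
      have h2 := hord i j hij
      have h3 : y ε j ≠ s j.castSucc := fun h => (hf j).2.1 (h ▸ (hf j).1.2)
      exact (h1.trans h2).trans_lt (lt_of_le_of_ne (hf j).1.1.1 h3.symm)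
    intro i j hij
    apply hmon.injective
    have := (h.mem_orbit h' (hsub i (hf i).1.1) (hf i).1.2).2 rfl
    have e : M.orbit ε (y ε i) = M.orbit ε (y ε j) := hij
    rw [e] at this
    exact (h.mem_orbit h' (hsub j (hf j).1.1) (hf j).1.2).1 this
  · obtain ⟨h, h', hf⟩ := hfacts ε hpos hlt'
    exact h.isLimitCycle h' (hsub i (hf i).1.1) (hf i).1.2 (hcore _) (hf i).2.1
  · obtain ⟨h, h', hf⟩ := hfacts ε hpos hlt'
    exact hPorb ε _ h h' (hsub i (hf i).1.1) (hf i).1.2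
  · obtain ⟨K, hK, hH⟩ := M.hausdorffEDist_orbit_le
    have hty : Tendsto (fun ε => |y ε i - Y i|) (𝓝[≠] 0) (𝓝 0) := by
      rw [Metric.tendsto_nhds]
      intro d hd
      obtain ⟨p, hp, q, hq, hpd, hqd, hpq, hm⟩ := hYs i d hd
      have h1 := hneg p (hsub i hp) q (hsub i hq) hm
      rw [eventually_nhdsWithin_iff]
      filter_upwards [h1, hgood2] with ε h1 h2 hε
      obtain ⟨z, hz, hz0⟩ := hzero ε h2.1 h2.2 p (hsub i hp) q (hsub i hq) hpq.le (h1 hε)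
      have hzI : z ∈ Icc (s i.castSucc) (s i.succ) := ⟨hp.1.trans hz.1, hz.2.trans hq.2⟩
      have h3 := (hy ε i h2.1 h2.2 ⟨z, hzI, hz0⟩).2 z hzI hz0
      rw [Real.dist_eq, sub_zero, abs_abs]
      refine h3.trans_lt ?_
      rw [abs_lt] at hpd hqd ⊢
      exact ⟨by linarith [hz.1], by linarith [hz.2]⟩
    have htε : Tendsto (fun ε : ℝ => |ε|) (𝓝[≠] 0) (𝓝 0) := by
      have := (continuous_abs (G := ℝ)).tendsto 0
      rw [abs_zero] at this
      exact this.mono_left nhdsWithin_le_nhds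
    have htot : Tendsto (fun ε => ENNReal.ofReal (K * (|ε| + |y ε i - Y i|))) (𝓝[≠] 0) (𝓝 0) := by
      have := ENNReal.tendsto_ofReal ((htε.add hty).const_mul K)
      simpa using this
    refine tendsto_of_tendsto_of_tendsto_of_le_of_le' tendsto_const_nhds htot
      (Eventually.of_forall fun _ => zero_le) ?_
    rw [eventually_nhdsWithin_iff]
    filter_upwards [Metric.ball_mem_nhds (0 : ℝ) hε₀] with ε hε hne
    obtain ⟨h, h', hf⟩ := hfacts ε (abs_pos.2 hne) (by simpa using hε)
    exact hH C ε hg0 h h' _ (hsub i (hf i).1.1) _ (hYc i) (hf i).1.2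

end Model

/-! ### The two circles in the coordinate `W`. -/

section Circles

/-- For `a < 1`, the circle of center `a` through `1` is `e^(Re W) cos (Im W) = -1/(2(1 - a))`, a
vertical line in `w = e^W`. -/
theorem norm_toPlane_sub_sq (a : ℝ) (W : ℂ) :
    ‖toPlane W - a‖ ^ 2 = (1 - a) ^ 2
      + Real.exp (-W.re) ^ 2 * (2 * (1 - a) * (Real.exp W.re * Real.cos W.im) + 1) := by
  have h : Real.exp W.re * Real.exp (-W.re) = 1 := by rw [← Real.exp_add]; simp
  rw [← Complex.normSq_eq_norm_sq, Complex.normSq_apply]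
  simp only [toPlane, Complex.sub_re, Complex.add_re, Complex.one_re, Complex.exp_re,
    Complex.sub_im, Complex.add_im, Complex.one_im, Complex.exp_im, Complex.neg_re, Complex.neg_im,
    Complex.ofReal_re, Complex.ofReal_im, Real.cos_neg, Real.sin_neg]
  linear_combination Real.exp (-W.re) ^ 2 * Real.sin_sq_add_cos_sq W.im
    - 2 * (1 - a) * Real.cos W.im * Real.exp (-W.re) * h

theorem lt_norm_toPlane_sub {a : ℝ} {W : ℂ}
    (h : -1 < 2 * (1 - a) * (Real.exp W.re * Real.cos W.im)) : 1 - a < ‖toPlane W - a‖ := by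
  refine lt_of_pow_lt_pow_left₀ 2 (norm_nonneg _) ?_
  rw [norm_toPlane_sub_sq]
  have : 0 < Real.exp (-W.re) ^ 2 * (2 * (1 - a) * (Real.exp W.re * Real.cos W.im) + 1) :=
    mul_pos (by positivity) (by linarith)
  linarith

theorem norm_toPlane_sub_lt {a : ℝ} (ha : a < 1) {W : ℂ}
    (h : 2 * (1 - a) * (Real.exp W.re * Real.cos W.im) < -1) : ‖toPlane W - a‖ < 1 - a := by
  refine lt_of_pow_lt_pow_left₀ 2 (by linarith) ?_
  rw [norm_toPlane_sub_sq]
  have : Real.exp (-W.re) ^ 2 * (2 * (1 - a) * (Real.exp W.re * Real.cos W.im) + 1) < 0 :=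
    mul_neg_of_pos_of_neg (by positivity) (by linarith)
  linarith

variable {W : ℂ}

theorem one_lt_norm_toPlane (h : -(1 / 2) < Real.exp W.re * Real.cos W.im) :
    1 < ‖toPlane W‖ := by
  simpa using lt_norm_toPlane_sub (a := 0) (W := W) (by linarith)

theorem norm_toPlane_lt_one (h : Real.exp W.re * Real.cos W.im < -(1 / 2)) :
    ‖toPlane W‖ < 1 := by
  simpa using norm_toPlane_sub_lt (a := 0) (by norm_num) (W := W) (by linarith)

theorem third_lt_norm_toPlane (h : -(3 / 2) < Real.exp W.re * Real.cos W.im) :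
    1 / 3 < ‖toPlane W - 2 / 3‖ := by
  have := lt_norm_toPlane_sub (a := 2 / 3) (W := W) (by linarith)
  push_cast at this
  linarith

theorem norm_toPlane_lt_third (h : Real.exp W.re * Real.cos W.im < -(3 / 2)) :
    ‖toPlane W - 2 / 3‖ < 1 / 3 := by
  have := norm_toPlane_sub_lt (a := 2 / 3) (by norm_num) (W := W) (by linarith)
  push_cast at this
  linarith

end Circles

/-! ### The switching curves as graphs. -/

section Level

/-- The upper half of the line `Re w = -c` in the coordinate `W = log w`. -/
noncomputable def level (c s : ℝ) : ℝ := Real.arccos (-(c * Real.exp (-s)))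

variable {c s : ℝ}

theorem cos_level (h0 : 0 ≤ c) (h1 : c * Real.exp (-s) ≤ 1) :
    Real.cos (level c s) = -(c * Real.exp (-s)) :=
  Real.cos_arccos (by linarith) (by linarith [mul_nonneg h0 (Real.exp_pos (-s)).le])

theorem sin_level (c s : ℝ) : Real.sin (level c s) = √(1 - (c * Real.exp (-s)) ^ 2) := by
  rw [level, Real.sin_arccos, neg_sq]

theorem exp_mul_cos_lt {W : ℂ} (h0 : 0 ≤ c) (h1 : c * Real.exp (-W.re) ≤ 1)
    (h : level c W.re < W.im) (hπ : W.im ≤ Real.pi) : Real.exp W.re * Real.cos W.im < -c := by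
  have := Real.strictAntiOn_cos ⟨Real.arccos_nonneg _, Real.arccos_le_pi _⟩
    ⟨(Real.arccos_nonneg _).trans h.le, hπ⟩ h
  rw [← level, cos_level h0 h1] at this
  have h2 := mul_lt_mul_of_pos_left this (Real.exp_pos W.re)
  have h3 : Real.exp W.re * Real.exp (-W.re) = 1 := by rw [← Real.exp_add]; simp
  linear_combination h2 - c * h3

theorem lt_exp_mul_cos {W : ℂ} (h0 : 0 ≤ c) (h1 : c * Real.exp (-W.re) ≤ 1)
    (h : W.im < level c W.re) (hW : 0 ≤ W.im) : -c < Real.exp W.re * Real.cos W.im := by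
  have := Real.strictAntiOn_cos ⟨hW, h.le.trans (Real.arccos_le_pi _)⟩
    ⟨Real.arccos_nonneg _, Real.arccos_le_pi _⟩ h
  rw [← level, cos_level h0 h1] at this
  have h2 := mul_lt_mul_of_pos_left this (Real.exp_pos W.re)
  have h3 : Real.exp W.re * Real.exp (-W.re) = 1 := by rw [← Real.exp_add]; simp
  linear_combination h2 + c * h3

theorem hasDerivAt_level (h0 : 0 < c) (h1 : c * Real.exp (-s) < 1) :
    HasDerivAt (level c) (-(c * Real.exp (-s)) / √(1 - (c * Real.exp (-s)) ^ 2)) s := by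
  have hp := mul_pos h0 (Real.exp_pos (-s))
  have h2 := Real.hasDerivAt_arccos (x := -(c * Real.exp (-s))) (by linarith) (by linarith)
  have h3 : HasDerivAt (fun s => -(c * Real.exp (-s))) (c * Real.exp (-s)) s := by
    refine (((hasDerivAt_id s).neg.exp).const_mul c).neg.congr_deriv ?_
    simp
  have h4 := h2.comp s h3
  rw [neg_sq] at h4
  refine h4.congr_deriv ?_
  ring

theorem analyticAt_level (h0 : 0 < c) (h1 : c * Real.exp (-s) < 1) :
    AnalyticAt ℝ (level c) s := by
  have hp := mul_pos h0 (Real.exp_pos (-s))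
  have h2 : AnalyticAt ℝ Real.arccos (-(c * Real.exp (-s))) :=
    (Real.contDiffAt_arccos (by linarith) (by linarith)).analyticAt
  have h3 : AnalyticAt ℝ (fun s => -(c * Real.exp (-s))) s := by fun_prop
  exact AnalyticAt.comp (f := fun s => -(c * Real.exp (-s))) h2 h3

/-- With `u = c e⁻ˢ < 3/5` the slope has modulus `u/√(1 - u²) ≤ (3/5)/(4/5) < 1`. -/
theorem isCurve_level {lo hi : ℝ} (h0 : 0 < c) (h1 : c * Real.exp (-lo) ≤ 3 / 5) :
    IsCurve lo hi 1 (level c) := by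
  have key : ∀ s ∈ Ioo lo hi, c * Real.exp (-s) < 3 / 5 := fun s hs => by
    refine lt_of_lt_of_le (mul_lt_mul_of_pos_left (Real.exp_lt_exp.2 ?_) h0) h1
    linarith [hs.1]
  refine ⟨fun s hs => analyticAt_level h0 (by linarith [key s hs]), fun s hs t ht => ?_,
    fun _ _ => Real.arccos_nonneg _, fun _ _ => Real.arccos_le_pi _⟩
  have := (convex_Ioo lo hi).norm_image_sub_le_of_norm_hasDerivWithin_le (C := 1)
    (fun s hs => (hasDerivAt_level h0 (by linarith [key s hs])).hasDerivWithinAt)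
    (fun s hs => ?_) ht hs
  · simpa [Real.norm_eq_abs] using this
  have hp := mul_pos h0 (Real.exp_pos (-s))
  have hk := key s hs
  have h2 : 4 / 5 ≤ √(1 - (c * Real.exp (-s)) ^ 2) := Real.le_sqrt_of_sq_le (by nlinarith)
  rw [norm_div, norm_neg, Real.norm_of_nonneg hp.le, Real.norm_of_nonneg (Real.sqrt_nonneg _)]
  exact (div_le_one (by linarith)).2 (by linarith)

end Level

/-! ### Linear independence of the functions in the first order term. -/

section Basis

/-- The monomial parts of the first order term. -/
noncomputable def curveFn (ψ : ℝ → ℝ) : Fin 4 → ℝ → ℝ :=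
  ![fun s => Real.exp s * Real.sin (ψ s), ψ, fun s => Real.exp (-s) * Real.sin (ψ s),
    fun s => Real.exp (-(2 * s)) * (Real.sin (ψ s) * Real.cos (ψ s))]

theorem driftPrim_curvePt_im (a : Fin 4 → ℝ) (ψ : ℝ → ℝ) (s : ℝ) :
    (driftPrim a (curvePt ψ s)).im = ∑ j, a j * curveFn ψ j s := by
  simp only [driftPrim, curveFn, Fin.sum_univ_four]
  have e1 : (a 3 / 2 : ℂ) = ((a 3 / 2 : ℝ) : ℂ) := by push_cast; rfl
  have e2 : -(2 * curvePt ψ s) = ((-(2 * s) : ℝ) : ℂ) + ((-(2 * ψ s) : ℝ) : ℂ) * I := by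
    simp only [curvePt]; push_cast; ring
  rw [e1, e2]
  simp only [Complex.sub_im, Complex.add_im, Complex.im_ofReal_mul, Complex.exp_im,
    Complex.one_im, Complex.neg_re, Complex.neg_im, curvePt_re, curvePt_im, Complex.add_re,
    Complex.ofReal_re, Complex.ofReal_im, Complex.re_ofReal_mul, Complex.I_re, Complex.I_im,
    Real.sin_neg, mul_zero, add_zero, mul_one, zero_add, sub_zero, Real.sin_two_mul]
  simp
  ring

/-- The numerator of the derivative of a combination of the functions `curveFn (level c)`, as a
polynomial in `e⁻²ˢ`. -/
noncomputable def curvePoly (c : ℝ) (d : Fin 4 → ℝ) : Polynomial ℝ :=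
  .C (c * d 0) + .C (-(c ^ 2 * d 1) - c * d 2) * .X
    + .C (2 * c ^ 3 * d 2 + 3 * c ^ 2 * d 3) * .X ^ 2 + .C (-(4 * c ^ 4 * d 3)) * .X ^ 3

/-- The coefficients are triangular: the extreme ones give `d 0` and `d 3`, then the quadratic one
gives `d 2` and the linear one `d 1`. -/
theorem eq_zero_of_curvePoly_eq_zero {c : ℝ} (hc : c ≠ 0) {d : Fin 4 → ℝ}
    (h : curvePoly c d = 0) : d = 0 := by
  have h0 := congrArg (Polynomial.coeff · 0) h
  have h1 := congrArg (Polynomial.coeff · 1) h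
  have h2 := congrArg (Polynomial.coeff · 2) h
  have h3 := congrArg (Polynomial.coeff · 3) h
  simp [curvePoly, Polynomial.coeff_X, Polynomial.coeff_C, Polynomial.coeff_X_pow, hc,
    -map_mul, -map_add, -map_sub, -map_neg] at h0 h1 h2 h3
  simp [h3, hc] at h2
  simp [h2, hc] at h1
  ext j
  fin_cases j <;> simp [h0, h1, h2, h3]

/-- Differentiation removes the arccosine, leaving an algebraic function of `e⁻ˢ`. -/
theorem hasDerivAt_sum_curveFn {c s : ℝ} (h0 : 0 < c) (h1 : c * Real.exp (-s) < 1)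
    (d : Fin 4 → ℝ) :
    HasDerivAt (fun s => ∑ j, d j * curveFn (level c) j s)
      ((curvePoly c d).eval (Real.exp (-(2 * s)))
        / (c * Real.exp (-s) * √(1 - (c * Real.exp (-s)) ^ 2))) s := by
  have hl := hasDerivAt_level h0 h1
  have hp := mul_pos h0 (Real.exp_pos (-s))
  have hS : 0 < 1 - (c * Real.exp (-s)) ^ 2 := by nlinarith
  have hsin := hl.sin
  have hcos := hl.cos
  rw [cos_level h0.le h1.le] at hsin
  rw [sin_level] at hcos
  have e0 := ((Real.hasDerivAt_exp s).mul hsin).const_mul (d 0)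
  have e1 := hl.const_mul (d 1)
  have e2 := (((hasDerivAt_id s).neg.exp).mul hsin).const_mul (d 2)
  have e3 := ((((hasDerivAt_id s).const_mul (2 : ℝ)).neg.exp).mul (hsin.mul hcos)).const_mul (d 3)
  have e := ((e0.add e1).add e2).add e3
  have hexp : Real.exp (-(2 * s)) = Real.exp (-s) ^ 2 := by rw [← Real.exp_nat_mul]; ring_nf
  have hexp' : Real.exp s = (Real.exp (-s))⁻¹ := by rw [Real.exp_neg, inv_inv]
  refine (e.congr_deriv ?_).congr_of_eventuallyEq (Eventually.of_forall fun t => ?_)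
  · simp only [Pi.neg_apply, Pi.mul_apply, id, curvePoly, Polynomial.eval_add, Polynomial.eval_mul,
      Polynomial.eval_C, Polynomial.eval_X, Polynomial.eval_pow, sin_level, cos_level h0.le h1.le,
      hexp, hexp']
    have hS2 := Real.sq_sqrt hS.le
    set S := √(1 - (c * Real.exp (-s)) ^ 2) with hSdef
    have hSpos : 0 < S := Real.sqrt_pos.2 hS
    set u := Real.exp (-s)
    have hu : 0 < u := Real.exp_pos _
    field_simp
    ring_nf
    simp only [hS2]
    ring
  · simp [curveFn, Fin.sum_univ_four]

/-- For nonzero `p`, the root `a` would have odd multiplicity on the left and even multiplicity on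
the right. -/
theorem eq_zero_of_sq_mul_eq {a b k : ℝ} (hab : a ≠ b) (hk : k ≠ 0) {p q : Polynomial ℝ}
    (h : p ^ 2 * (.X - .C a) = q ^ 2 * (.C k * (.X - .C b))) : p = 0 ∧ q = 0 := by
  have hX : ∀ x : ℝ, (Polynomial.X - Polynomial.C x) ≠ 0 := Polynomial.X_sub_C_ne_zero
  have hC : Polynomial.C k ≠ 0 := by simpa using hk
  have hp : p = 0 := by
    by_contra hp
    have hq : q ≠ 0 := by
      rintro rfl
      simp [hp, hX a] at h
    have h1 := congrArg (Polynomial.rootMultiplicity a) h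
    rw [Polynomial.rootMultiplicity_mul (mul_ne_zero (pow_ne_zero 2 hp) (hX a)), pow_two,
      Polynomial.rootMultiplicity_mul (mul_ne_zero hp hp),
      Polynomial.rootMultiplicity_mul (mul_ne_zero (pow_ne_zero 2 hq) (mul_ne_zero hC (hX b))),
      pow_two, Polynomial.rootMultiplicity_mul (mul_ne_zero hq hq),
      Polynomial.rootMultiplicity_mul (mul_ne_zero hC (hX b)), Polynomial.rootMultiplicity_C,
      Polynomial.rootMultiplicity_X_sub_C_self, Polynomial.rootMultiplicity_X_sub_C,
      if_neg hab] at h1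
    omega
  subst hp
  refine ⟨rfl, ?_⟩
  simpa [hC, hX b, eq_comm] using h

theorem infinite_exp_image {lo hi : ℝ} (h : lo < hi) :
    ((fun s => Real.exp (-(2 * s))) '' Ioo lo hi).Infinite :=
  (Ioo_infinite h).image fun s _ t _ hst => by
    have := Real.exp_injective hst
    linarith

theorem eq_zero_of_sum_curveFn {c lo hi p : ℝ} {d : Fin 4 → ℝ} (hlt : lo < hi) (h0 : 0 < c)
    (h1 : c * Real.exp (-lo) ≤ 1)
    (h : ∀ s ∈ Ioo lo hi, ∑ j, d j * curveFn (level c) j s + p = 0) : d = 0 := by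
  refine eq_zero_of_curvePoly_eq_zero h0.ne' ?_
  refine Polynomial.eq_zero_of_infinite_isRoot _ ((infinite_exp_image hlt).mono ?_)
  rintro _ ⟨s, hs, rfl⟩
  have hs1 : c * Real.exp (-s) < 1 := by
    refine lt_of_lt_of_le (mul_lt_mul_of_pos_left (Real.exp_lt_exp.2 ?_) h0) h1
    linarith [hs.1]
  have hd := (hasDerivAt_sum_curveFn h0 hs1 d).add_const p
  have hz : HasDerivAt (fun s => ∑ j, d j * curveFn (level c) j s + p) 0 s :=
    (hasDerivAt_const s 0).congr_of_eventuallyEq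
      (Filter.eventually_of_mem (Ioo_mem_nhds hs.1 hs.2) h)
  have hp := mul_pos h0 (Real.exp_pos (-s))
  have hS : 0 < 1 - (c * Real.exp (-s)) ^ 2 := by nlinarith
  have hS' := Real.sqrt_pos.2 hS
  have := hd.unique hz
  rw [div_eq_zero_iff, or_iff_left (mul_pos hp hS').ne'] at this
  exact this

/-- The derivatives of the two sums are opposite. Squaring clears both square roots and leaves a
polynomial identity in `e⁻²ˢ`, whose linear factors vanish at `1/c₂²` and `1/c₁²`. -/
theorem eq_zero_of_sum_curveFn_add {c₁ c₂ lo hi p : ℝ} {d₁ d₂ : Fin 4 → ℝ} (hlt : lo < hi)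
    (h0 : 0 < c₁) (h12 : c₁ < c₂) (h1 : c₂ * Real.exp (-lo) ≤ 1)
    (h : ∀ s ∈ Ioo lo hi, ∑ j, d₁ j * curveFn (level c₁) j s
      + ∑ j, d₂ j * curveFn (level c₂) j s + p = 0) : d₁ = 0 ∧ d₂ = 0 := by
  have h0' : 0 < c₂ := h0.trans h12
  have hpoly : (curvePoly c₁ d₁) ^ 2 * (.X - .C (1 / c₂ ^ 2))
      = (curvePoly c₂ d₂) ^ 2 * (.C (c₁ ^ 4 / c₂ ^ 4) * (.X - .C (1 / c₁ ^ 2))) := by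
    refine Polynomial.eq_of_infinite_eval_eq _ _ ((infinite_exp_image hlt).mono ?_)
    rintro _ ⟨s, hs, rfl⟩
    have hs2 : c₂ * Real.exp (-s) < 1 := by
      refine lt_of_lt_of_le (mul_lt_mul_of_pos_left (Real.exp_lt_exp.2 ?_) h0') h1
      linarith [hs.1]
    have hs1 : c₁ * Real.exp (-s) < 1 :=
      (mul_lt_mul_of_pos_right h12 (Real.exp_pos _)).trans hs2
    have hd := ((hasDerivAt_sum_curveFn h0 hs1 d₁).add
      (hasDerivAt_sum_curveFn h0' hs2 d₂)).add_const p
    have hz : HasDerivAt (fun s => ∑ j, d₁ j * curveFn (level c₁) j s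
        + ∑ j, d₂ j * curveFn (level c₂) j s + p) 0 s :=
      (hasDerivAt_const s 0).congr_of_eventuallyEq
        (Filter.eventually_of_mem (Ioo_mem_nhds hs.1 hs.2) h)
    have key := hd.unique hz
    have hexp : Real.exp (-(2 * s)) = Real.exp (-s) ^ 2 := by
      rw [← Real.exp_nat_mul]; ring_nf
    have hp1 := mul_pos h0 (Real.exp_pos (-s))
    have hp2 := mul_pos h0' (Real.exp_pos (-s))
    have hS1 : 0 < 1 - (c₁ * Real.exp (-s)) ^ 2 := by nlinarith
    have hS2 : 0 < 1 - (c₂ * Real.exp (-s)) ^ 2 := by nlinarith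
    have q1 := Real.sq_sqrt hS1.le
    have q2 := Real.sq_sqrt hS2.le
    have r1 := Real.sqrt_pos.2 hS1
    have r2 := Real.sqrt_pos.2 hS2
    simp only [mem_ofPred_eq, Polynomial.eval_mul, Polynomial.eval_pow, Polynomial.eval_sub,
      Polynomial.eval_X, Polynomial.eval_C]
    generalize Polynomial.eval (Real.exp (-(2 * s))) (curvePoly c₁ d₁) = A at *
    generalize Polynomial.eval (Real.exp (-(2 * s))) (curvePoly c₂ d₂) = B at *
    rw [hexp]
    have hu : 0 < Real.exp (-s) := Real.exp_pos _
    generalize Real.exp (-s) = u at *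
    generalize √(1 - (c₁ * u) ^ 2) = S at *
    generalize √(1 - (c₂ * u) ^ 2) = T at *
    rw [div_add_div _ _ (by positivity) (by positivity), div_eq_zero_iff,
      or_iff_left (by positivity)] at key
    have k1 : A * (c₂ * T) = -(B * (c₁ * S)) := by
      have : u * (A * (c₂ * T) + B * (c₁ * S)) = 0 := by linear_combination key
      rcases mul_eq_zero.1 this with h | h
      · exact absurd h hu.ne'
      · linarith
    have k2 : A ^ 2 * (c₂ ^ 2 * (1 - (c₂ * u) ^ 2)) = B ^ 2 * (c₁ ^ 2 * (1 - (c₁ * u) ^ 2)) := by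
      rw [← q1, ← q2]
      linear_combination (A * (c₂ * T) - B * (c₁ * S)) * k1
    field_simp
    linear_combination -k2
  have hne : 1 / c₂ ^ 2 ≠ 1 / c₁ ^ 2 := by
    have : c₁ ^ 2 < c₂ ^ 2 := by nlinarith
    exact (one_div_lt_one_div_of_lt (by positivity) this).ne
  obtain ⟨h2, h3⟩ := eq_zero_of_sq_mul_eq hne (by positivity) hpoly
  exact ⟨eq_zero_of_curvePoly_eq_zero h0.ne' h2, eq_zero_of_curvePoly_eq_zero h0'.ne' h3⟩

end Basis

/-! ### The concrete models for the two families of orbits. -/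

theorem analyticAt_curveFn {ψ : ℝ → ℝ} {s : ℝ} (h : AnalyticAt ℝ ψ s) (j : Fin 4) :
    AnalyticAt ℝ (curveFn ψ j) s := by
  have hsin : AnalyticAt ℝ (fun s => Real.sin (ψ s)) s := Real.analyticAt_sin.fun_comp h
  have hcos : AnalyticAt ℝ (fun s => Real.cos (ψ s)) s := Real.analyticAt_cos.fun_comp h
  fin_cases j
  · exact AnalyticAt.mul (by fun_prop) hsin
  · exact h
  · exact AnalyticAt.mul (by fun_prop) hsin
  · exact AnalyticAt.mul (by fun_prop) (hsin.mul hcos)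

theorem isCurve_const {lo hi L x : ℝ} (hL : 0 ≤ L) (h0 : 0 ≤ x) (hπ : x ≤ Real.pi) :
    IsCurve lo hi L (fun _ => x) :=
  ⟨fun _ _ => analyticAt_const, fun s _ t _ => by
    rw [sub_self, abs_zero]
    exact mul_nonneg hL (abs_nonneg _), fun _ _ => h0, fun _ _ => hπ⟩

/-- Coefficients whose first order term is a combination of the functions `curveFn φ₁` with the
coefficients `d₁`, the functions `curveFn φ₂` with the coefficients `d₂`, and a constant. -/
def zoneCoef (p : ℝ) (d₁ d₂ : Fin 4 → ℝ) : Zone → Fin 4 → ℝ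
  | .plus => ![0, p, 0, 0]
  | .central => ![0, p, 0, 0] - d₂
  | .minus => ![0, p, 0, 0] - d₂ - d₁

namespace Model

/-- Only the jumps of the coefficients, `d₁` across `φ₁` and `d₂` across `φ₂`, survive. The line `Im
W = 0` contributes nothing and `Im W = π` only the linear term of `driftPrim`. -/
theorem melnikov_eq (M : Model) {p : ℝ} {d₁ d₂ : Fin 4 → ℝ} (h : M.coef = zoneCoef p d₁ d₂)
    (s : ℝ) : M.melnikov s = ∑ j, d₁ j * curveFn M.φ₁ j s + ∑ j, d₂ j * curveFn M.φ₂ j s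
      + -(p * Real.pi) := by
  simp only [melnikov, driftPrim_curvePt_im, h, zoneCoef, Fin.sum_univ_four, Pi.sub_apply]
  simp [curveFn]
  ring

theorem analyticOnNhd_melnikov (M : Model) : AnalyticOnNhd ℝ M.melnikov M.core := by
  intro s hs
  have hs' : s ∈ Ioo M.lo M.hi := by
    have := M.η_pos
    exact ⟨by linarith [hs.1], by linarith [hs.2]⟩
  have key : ∀ (a : Fin 4 → ℝ) {ψ : ℝ → ℝ}, AnalyticAt ℝ ψ s →
      AnalyticAt ℝ (fun s => (driftPrim a (curvePt ψ s)).im) s := fun a ψ hψ => by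
    simp only [driftPrim_curvePt_im]
    exact Finset.analyticAt_fun_sum _ fun j _ => analyticAt_const.mul (analyticAt_curveFn hψ j)
  have h1 := M.sec₁.curve₁.analyticAt s hs'
  have h2 := M.sec₂.curve₁.analyticAt s hs'
  exact ((key _ analyticAt_const).sub (key _ h1)).add
    (((key _ h1).sub (key _ h2)).add ((key _ h2).sub (key _ analyticAt_const)))

/-- Independence of `n + 1` functions allows the values `(-1)^j` at `n + 1` points, hence `n` sign
changes. -/
theorem limitCyclesBifurcate_of_linearIndependent {n : ℕ} {P : Set ℂ → Prop} {lo hi η : ℝ}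
    (M : (Fin (n + 1) → ℝ) → Model) (hlo : ∀ c, (M c).lo = lo) (hhi : ∀ c, (M c).hi = hi)
    (hη : ∀ c, (M c).η = η) (f : Fin (n + 1) → ℝ → ℝ)
    (hf : ∀ c : Fin (n + 1) → ℝ,
      (∀ s ∈ Ioo (lo + 2 * η) (hi - 2 * η), ∑ i, c i * f i s = 0) → c = 0)
    (hM : ∀ c s, (M c).melnikov s = ∑ i, c i * f i s)
    (hP : ∀ Γ : Set ℂ, (∀ z ∈ Γ, ∃ W : ℂ, W.re ∈ Ioo lo hi ∧ toPlane W = z) →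
      (∃ x ∈ Ioo lo hi, toPlane (x : ℝ) ∈ Γ) →
      (∃ y ∈ Ioo lo hi, toPlane ((y : ℝ) + Real.pi * I) ∈ Γ) → P Γ) :
    LimitCyclesBifurcate n P := by
  obtain ⟨s, hs, hsI, hv⟩ := exists_interpolation f _ hf
  obtain ⟨c, hc⟩ := hv fun j => (-1) ^ (j : ℕ)
  refine (M c).limitCyclesBifurcate s hs (fun j => ?_) (M c).analyticOnNhd_melnikov (fun i => ?_) ?_
  · rw [core, hlo, hhi, hη]
    exact hsI j
  · rw [hM, hM, hc, hc, Fin.val_castSucc, Fin.val_succ, pow_succ, ← mul_assoc, ← pow_add,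
      Even.neg_one_pow ⟨_, rfl⟩]
    norm_num
  · rw [hlo, hhi]
    exact hP

end Model

theorem half_mul_exp_le {s : ℝ} (hs : 0 ≤ s) : 1 / 2 * Real.exp (-s) ≤ 1 / 2 := by
  have : Real.exp (-s) ≤ 1 := Real.exp_le_one_iff.2 (by linarith)
  linarith

theorem three_halves_mul_exp_le {s : ℝ} (hs : 1 ≤ s) : 3 / 2 * Real.exp (-s) ≤ 3 / 5 := by
  have h : Real.exp (-s) ≤ Real.exp (-1) := Real.exp_le_exp.2 (by linarith)
  have h2 : Real.exp (-1) < 2 / 5 := by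
    rw [Real.exp_neg, inv_lt_comm₀ (Real.exp_pos 1) (by norm_num)]
    linarith [Real.exp_one_gt_d9]
  linarith

theorem level_half_le {s : ℝ} (hs : 0 ≤ s) : level (1 / 2) s ≤ 2 * Real.pi / 3 := by
  have hc : Real.cos (2 * Real.pi / 3) = -(1 / 2) := by
    rw [show 2 * Real.pi / 3 = Real.pi - Real.pi / 3 by ring, Real.cos_pi_sub, Real.cos_pi_div_three]
  have h := Real.arccos_cos (x := 2 * Real.pi / 3) (by positivity) (by linarith [Real.pi_pos])
  rw [← h, hc]
  exact Real.arccos_le_arccos (by linarith [half_mul_exp_le hs])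

theorem exp_fifth_lt : Real.exp (1 / 5) < 3 / 2 := by
  refine lt_of_pow_lt_pow_left₀ 5 (by norm_num) ?_
  rw [← Real.exp_nat_mul]
  norm_num
  linarith [Real.exp_one_lt_d9]

theorem neg_lt_exp_mul_cos {s : ℝ} (hs : s < 1 / 5) (θ : ℝ) :
    -(3 / 2) < Real.exp s * Real.cos θ := by
  have h1 : Real.exp s < 3 / 2 := (Real.exp_lt_exp.2 hs).trans exp_fifth_lt
  nlinarith [Real.neg_one_le_cos θ, Real.exp_pos s]

/-- Models for the orbits that cross the outer circle only. -/
noncomputable def outerModel (c : Fin 5 → ℝ) : Model where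
  coef := zoneCoef (c 4) ![c 0, c 1, c 2, c 3] 0
  -- On `0 < s < 1/5` one has `1/2 < e^s < 3/2`: the line `Re W = s` crosses the outer circle and
  -- misses the inner one.
  lo := 0
  hi := 1 / 5
  L := 1
  η := 1 / 100
  φ₁ := level (1 / 2)
  -- An artificial curve inside the central zone, above `level (1/2) ≤ 2π/3`. As `d₂ = 0`, the
  -- coefficients do not jump there, and the third sector can use the central zone with the
  -- coefficients of `plus`.
  φ₂ := fun _ => 5 * Real.pi / 6
  η_pos := by norm_num
  L_nonneg := by norm_num
  sec₁ :=
    { curve₀ := isCurve_const zero_le_one le_rfl Real.pi_pos.le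
      curve₁ := isCurve_level (by norm_num) (by norm_num)
      lt := fun s _ => Real.arccos_pos.2 (by linarith [Real.exp_pos (-s)])
      exists_zone := ⟨_, rfl⟩
      zone := fun W hW h0 h1 => ⟨.minus, rfl, one_lt_norm_toPlane <|
        lt_exp_mul_cos (by norm_num) (by linarith [half_mul_exp_le hW.1.le]) h1 h0.le⟩ }
  sec₂ :=
    { curve₀ := isCurve_level (by norm_num) (by norm_num)
      curve₁ := isCurve_const zero_le_one (by positivity) (by linarith [Real.pi_pos])
      lt := fun s hs => by linarith [level_half_le hs.1.le, Real.pi_pos]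
      exists_zone := ⟨_, rfl⟩
      zone := fun W hW h0 h1 => ⟨.central, rfl,
        third_lt_norm_toPlane (neg_lt_exp_mul_cos hW.2 _), norm_toPlane_lt_one <|
        exp_mul_cos_lt (by norm_num) (by linarith [half_mul_exp_le hW.1.le]) h0
          (by linarith [Real.pi_pos])⟩ }
  sec₃ :=
    { curve₀ := isCurve_const zero_le_one (by positivity) (by linarith [Real.pi_pos])
      curve₁ := isCurve_const zero_le_one Real.pi_pos.le le_rfl
      lt := fun s _ => by linarith [Real.pi_pos]
      exists_zone := ⟨_, rfl⟩
      zone := fun W hW h0 h1 => ⟨.central, sub_zero _,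
        third_lt_norm_toPlane (neg_lt_exp_mul_cos hW.2 _), norm_toPlane_lt_one <|
        exp_mul_cos_lt (by norm_num) (by linarith [half_mul_exp_le hW.1.le])
          (by linarith [level_half_le hW.1.le, Real.pi_pos]) h1.le⟩ }

/-- Models for the orbits that cross both circles. -/
noncomputable def bothModel (c : Fin 9 → ℝ) : Model where
  coef := zoneCoef (c 8) ![c 0, c 1, c 2, c 3] ![c 4, c 5, c 6, c 7]
  -- For `s ≥ 1` both curves exist with slope at most `1`, since `(3/2) e⁻¹ < 3/5`.
  lo := 1
  hi := 2
  L := 1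
  η := 1 / 100
  φ₁ := level (1 / 2)
  φ₂ := level (3 / 2)
  η_pos := by norm_num
  L_nonneg := by norm_num
  sec₁ :=
    { curve₀ := isCurve_const zero_le_one le_rfl Real.pi_pos.le
      curve₁ := isCurve_level (by norm_num) (by linarith [half_mul_exp_le zero_le_one])
      lt := fun s _ => Real.arccos_pos.2 (by linarith [Real.exp_pos (-s)])
      exists_zone := ⟨_, rfl⟩
      zone := fun W hW h0 h1 => ⟨.minus, rfl, one_lt_norm_toPlane <|
        lt_exp_mul_cos (by norm_num) (by linarith [half_mul_exp_le (zero_le_one.trans hW.1.le)])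
          h1 h0.le⟩ }
  sec₂ :=
    { curve₀ := isCurve_level (by norm_num) (by linarith [half_mul_exp_le zero_le_one])
      curve₁ := isCurve_level (by norm_num) (three_halves_mul_exp_le le_rfl)
      lt := fun s hs => Real.strictAntiOn_arccos
        ⟨by linarith [three_halves_mul_exp_le hs.1.le], by linarith [Real.exp_pos (-s)]⟩
        ⟨by linarith [half_mul_exp_le (zero_le_one.trans hs.1.le)],
          by linarith [Real.exp_pos (-s)]⟩ (by linarith [Real.exp_pos (-s)])
      exists_zone := ⟨_, rfl⟩
      zone := fun W hW h0 h1 => ⟨.central, rfl,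
        third_lt_norm_toPlane <| lt_exp_mul_cos (by norm_num)
          (by linarith [three_halves_mul_exp_le hW.1.le]) h1 ((Real.arccos_nonneg _).trans h0.le),
        norm_toPlane_lt_one <| exp_mul_cos_lt (by norm_num)
          (by linarith [half_mul_exp_le (zero_le_one.trans hW.1.le)]) h0
          (h1.le.trans (Real.arccos_le_pi _))⟩ }
  sec₃ :=
    { curve₀ := isCurve_level (by norm_num) (three_halves_mul_exp_le le_rfl)
      curve₁ := isCurve_const zero_le_one Real.pi_pos.le le_rfl
      lt := fun s hs => lt_of_le_of_ne (Real.arccos_le_pi _) fun h => by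
        linarith [Real.arccos_eq_pi.1 h, three_halves_mul_exp_le hs.1.le]
      exists_zone := ⟨_, rfl⟩
      zone := fun W hW h0 h1 => ⟨.plus, rfl, norm_toPlane_lt_third <|
        exp_mul_cos_lt (by norm_num) (by linarith [three_halves_mul_exp_le hW.1.le]) h0 h1.le⟩ }

theorem one_lt_norm_toPlane_ofReal (x : ℝ) : 1 < ‖toPlane (x : ℝ)‖ :=
  one_lt_norm_toPlane (by simpa using lt_trans (by norm_num) (Real.exp_pos x))

theorem exp_mul_cos_add_pi (y : ℝ) :
    Real.exp ((y : ℂ) + Real.pi * I).re * Real.cos ((y : ℂ) + Real.pi * I).im = -Real.exp y := by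
  simp

theorem limitCyclesBifurcate_crossesOnlyOuter : LimitCyclesBifurcate 4 CrossesOnlyOuter := by
  set f : Fin 5 → ℝ → ℝ := ![curveFn (level (1 / 2)) 0, curveFn (level (1 / 2)) 1,
    curveFn (level (1 / 2)) 2, curveFn (level (1 / 2)) 3, fun _ => -Real.pi]
  have hsum : ∀ (c : Fin 5 → ℝ) (s : ℝ), ∑ i, c i * f i s
      = ∑ j, (![c 0, c 1, c 2, c 3] : Fin 4 → ℝ) j * curveFn (level (1 / 2)) j s
        + -(c 4 * Real.pi) := fun c s => by
    rw [Fin.sum_univ_five, Fin.sum_univ_four, ← mul_neg]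
    rfl
  refine Model.limitCyclesBifurcate_of_linearIndependent (lo := 0) (hi := 1 / 5) (η := 1 / 100)
    outerModel (fun _ => rfl) (fun _ => rfl) (fun _ => rfl) f (fun c hc => ?_) (fun c s => ?_) ?_
  · simp only [hsum] at hc
    have hd := eq_zero_of_sum_curveFn (by norm_num) (by norm_num)
      (by linarith [half_mul_exp_le (s := 0 + 2 * (1 / 100)) (by norm_num)]) hc
    have h4 := hc (1 / 10) ⟨by norm_num, by norm_num⟩
    simp only [hd, Pi.zero_apply, zero_mul, Finset.sum_const_zero, zero_add, neg_eq_zero,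
      mul_eq_zero, Real.pi_ne_zero, or_false] at h4
    have h0 := congrFun hd 0
    have h1 := congrFun hd 1
    have h2 := congrFun hd 2
    have h3 := congrFun hd 3
    ext i
    fin_cases i
    exacts [h0, h1, h2, h3, h4]
  · rw [(outerModel c).melnikov_eq (d₂ := 0) rfl, hsum]
    simp [outerModel]
  · rintro Γ hΓ ⟨x, -, hxΓ⟩ ⟨y, hy, hyΓ⟩
    refine ⟨⟨⟨_, hyΓ, ?_⟩, _, hxΓ, ?_⟩, fun z hz => ?_⟩
    · rw [sub_zero]
      refine norm_toPlane_lt_one ?_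
      rw [exp_mul_cos_add_pi]
      linarith [Real.add_one_le_exp y, hy.1]
    · rw [sub_zero]
      exact one_lt_norm_toPlane_ofReal x
    · obtain ⟨W, hW, rfl⟩ := hΓ z hz
      exact (third_lt_norm_toPlane (neg_lt_exp_mul_cos hW.2 _)).ne'

theorem limitCyclesBifurcate_crossesBoth : LimitCyclesBifurcate 8 CrossesBoth := by
  set f : Fin 9 → ℝ → ℝ := ![curveFn (level (1 / 2)) 0, curveFn (level (1 / 2)) 1,
    curveFn (level (1 / 2)) 2, curveFn (level (1 / 2)) 3, curveFn (level (3 / 2)) 0,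
    curveFn (level (3 / 2)) 1, curveFn (level (3 / 2)) 2, curveFn (level (3 / 2)) 3,
    fun _ => -Real.pi]
  have hsum : ∀ (c : Fin 9 → ℝ) (s : ℝ), ∑ i, c i * f i s
      = ∑ j, (![c 0, c 1, c 2, c 3] : Fin 4 → ℝ) j * curveFn (level (1 / 2)) j s
        + ∑ j, (![c 4, c 5, c 6, c 7] : Fin 4 → ℝ) j * curveFn (level (3 / 2)) j s
        + -(c 8 * Real.pi) := fun c s => by
    rw [Fin.sum_univ_castSucc, Fin.sum_univ_eight, Fin.sum_univ_four, Fin.sum_univ_four, ← mul_neg]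
    simp only [← add_assoc]
    rfl
  refine Model.limitCyclesBifurcate_of_linearIndependent (lo := 1) (hi := 2) (η := 1 / 100)
    bothModel (fun _ => rfl) (fun _ => rfl) (fun _ => rfl) f (fun c hc => ?_) (fun c s => ?_) ?_
  · simp only [hsum] at hc
    obtain ⟨hd, he⟩ := eq_zero_of_sum_curveFn_add (by norm_num) (by norm_num) (by norm_num)
      (by linarith [three_halves_mul_exp_le (s := 1 + 2 * (1 / 100)) (by norm_num)]) hc
    -- With the other eight coefficients zero, any single point determines the constant.
    have h8 := hc (3 / 2) ⟨by norm_num, by norm_num⟩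
    simp only [hd, he, Pi.zero_apply, zero_mul, Finset.sum_const_zero, zero_add, neg_eq_zero,
      mul_eq_zero, Real.pi_ne_zero, or_false] at h8
    have h0 := congrFun hd 0
    have h1 := congrFun hd 1
    have h2 := congrFun hd 2
    have h3 := congrFun hd 3
    have h4 := congrFun he 0
    have h5 := congrFun he 1
    have h6 := congrFun he 2
    have h7 := congrFun he 3
    ext i
    fin_cases i
    exacts [h0, h1, h2, h3, h4, h5, h6, h7, h8]
  · rw [(bothModel c).melnikov_eq rfl, hsum]
    rfl
  · rintro Γ - ⟨x, -, hxΓ⟩ ⟨y, hy, hyΓ⟩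
    have hy2 := Real.add_one_le_exp y
    refine ⟨⟨⟨_, hyΓ, ?_⟩, _, hxΓ, ?_⟩, ⟨_, hyΓ, norm_toPlane_lt_third ?_⟩,
      _, hxΓ, third_lt_norm_toPlane ?_⟩
    · rw [sub_zero]
      refine norm_toPlane_lt_one ?_
      rw [exp_mul_cos_add_pi]
      linarith [hy.1]
    · rw [sub_zero]
      exact one_lt_norm_toPlane_ofReal x
    · rw [exp_mul_cos_add_pi]
      linarith [hy.1]
    · simpa using lt_trans (by norm_num) (Real.exp_pos x)

end TangentCircles

theorem theoremC :
    TangentCircles.LimitCyclesBifurcate 4 TangentCircles.CrossesOnlyOuter ∧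
      TangentCircles.LimitCyclesBifurcate 8 TangentCircles.CrossesBoth :=
  ⟨TangentCircles.limitCyclesBifurcate_crossesOnlyOuter,
    TangentCircles.limitCyclesBifurcate_crossesBoth⟩
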